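/- Let $A$ be a finite-dimensional semisimple $\mathbb{Q}$-algebra and let $\mathfrak{A}\subseteq A$ be an order, that is, a subring which is finitely generated as a $\mathbb{Z}$-module and satisfies $\mathbb{Q}\cdot\mathfrak{A}=A$. Let $\mathsf{LCA}_{\mathfrak{A}}$ be the category whose objects are right $\mathfrak{A}$-modules equipped with a locally compact Hausdorff topology making the additive group a topological group and making right multiplication by each $\alpha\in\mathfrak{A}$ continuous, and whose morphisms are the continuous right $\mathfrak{A}$-module homomorphisms. Call a pair of composable morphisms $X\xrightarrow{i}Y\xrightarrow{p}Z$ a kernel-cokernel pair if $i$ is a kernel of $p$ and $p$ is a cokernel of $i$; the morphisms $i$ (resp. $p$) occurring in such pairs are the admissible monics (resp. admissible epics). An object $G$ is injective if every morphism $X\to G$ extends along every admissible monic $X\to Y$, and projective if every morphism $G\to Z$ lifts along every admissible epic $Y\to Z$. A vector $\mathfrak{A}$-module is an object of $\mathsf{LCA}_{\mathfrak{A}}$ whose underlying topological group is isomorphic to $\mathbb{R}^n$ for some $n\ge 0$. For an object $M$ let $M^\vee$ denote its Pontryagin dual, the group of continuous group homomorphisms $M\to\mathbb{R}/\mathbb{Z}$,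 with the left $\mathfrak{A}$-module structure $(\alpha\cdot\varphi)(m)=\varphi(m\cdot\alpha)$. Then: 1. An object $G\in\mathsf{LCA}_{\mathfrak{A}}$ is injective if and only if it is isomorphic in $\mathsf{LCA}_{\mathfrak{A}}$ to $V\oplus I$ for some vector $\mathfrak{A}$-module $V$ and some compact connected object $I$ such that $I^\vee$ is projective as an (algebraic) left $\mathfrak{A}$-module. 2. An object $G\in\mathsf{LCA}_{\mathfrak{A}}$ is projective if and only if it is isomorphic in $\mathsf{LCA}_{\mathfrak{A}}$ to $V\oplus P$ for some vector $\mathfrak{A}$-module $V$ and some discrete object $P$ which is projective as an (algebraic) right $\mathfrak{A}$-module. -/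

import Mathlib

open CategoryTheory CategoryTheory.Limits
open scoped MulOpposite

universe u v

/-- A subring `𝔄` of a `ℚ`-algebra `A` is an order if it is a finitely generated `ℤ`-module
and `ℚ · 𝔄 = A`. -/
structure IsOrder {A : Type v} [Ring A] [Algebra ℚ A] (𝔄 : Subring A) : Prop where
  finite : Module.Finite ℤ 𝔄
  span_eq_top : Submodule.span ℚ (𝔄 : Set A) = ⊤

/-- Objects of `LCA_R`: right `R`-modules (modules over `Rᵐᵒᵖ`) with a locally compact Hausdorff
group topology for which multiplication by every scalar is continuous. -/
structure LCAMod (R : Type v) [Ring R] where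
  /-- The underlying type. -/
  carrier : Type u
  [addCommGroup : AddCommGroup carrier]
  [module : Module Rᵐᵒᵖ carrier]
  [topologicalSpace : TopologicalSpace carrier]
  [isTopologicalAddGroup : IsTopologicalAddGroup carrier]
  [locallyCompactSpace : LocallyCompactSpace carrier]
  [t2Space : T2Space carrier]
  [continuousConstSMul : ContinuousConstSMul Rᵐᵒᵖ carrier]

namespace LCAMod

variable {R : Type v} [Ring R]

instance : CoeSort (LCAMod.{u} R) (Type u) := ⟨LCAMod.carrier⟩

attribute [instance] addCommGroup module topologicalSpace isTopologicalAddGroup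
  locallyCompactSpace t2Space continuousConstSMul

/-- Morphisms of `LCA_R`: continuous right `R`-module homomorphisms. -/
@[ext]
structure Hom (M N : LCAMod.{u} R) where
  /-- The underlying continuous linear map. -/
  hom : M →L[Rᵐᵒᵖ] N

instance : Category (LCAMod.{u} R) where
  Hom := Hom
  id M := ⟨ContinuousLinearMap.id Rᵐᵒᵖ M⟩
  comp f g := ⟨g.hom.comp f.hom⟩

instance : HasZeroMorphisms (LCAMod.{u} R) where
  zero _ _ := ⟨⟨0⟩⟩
  comp_zero f _ := by
    apply Hom.ext
    exact ContinuousLinearMap.zero_comp f.hom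
  zero_comp _ _ _ f := by
    apply Hom.ext
    exact ContinuousLinearMap.comp_zero f.hom

/-- The direct sum `M ⊕ N` in `LCA_R`, on the product group with the product topology. -/
def directSum (M N : LCAMod.{u} R) : LCAMod.{u} R where
  carrier := M × N

/-- `M` is a vector module: its underlying topological group is isomorphic to `ℝⁿ`
for some `n`. -/
def IsVectorModule (M : LCAMod.{u} R) : Prop :=
  ∃ n : ℕ, Nonempty (M ≃ₜ+ (Fin n → ℝ))

/-- The group underlying the Pontryagin dual `M^∨`: continuous group homomorphisms from `M` to the
circle group `ℝ / ℤ`. -/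
def Dual (M : LCAMod.{u} R) : Type u :=
  M →ₜ+ UnitAddCircle

noncomputable instance (M : LCAMod.{u} R) : AddCommGroup M.Dual :=
  inferInstanceAs (AddCommGroup (M →ₜ+ UnitAddCircle))

instance (M : LCAMod.{u} R) : FunLike M.Dual M UnitAddCircle :=
  inferInstanceAs (FunLike (M →ₜ+ UnitAddCircle) M UnitAddCircle)

instance (M : LCAMod.{u} R) : AddMonoidHomClass M.Dual M UnitAddCircle :=
  inferInstanceAs (AddMonoidHomClass (M →ₜ+ UnitAddCircle) M UnitAddCircle)

/-- The left `R`-module structure on the dual: `(α • φ) m = φ (m · α)`. -/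
noncomputable instance (M : LCAMod.{u} R) : Module R M.Dual where
  smul α φ :=
    { toFun := fun m => φ (MulOpposite.op α • m)
      map_zero' := by
        rw [smul_zero]
        exact map_zero φ
      map_add' := fun m m' => by
        rw [smul_add]
        exact map_add φ _ _
      continuous_toFun :=
        (ContinuousAddMonoidHom.continuous_toFun φ).comp
          (continuous_const_smul (MulOpposite.op α)) }
  one_smul φ := by
    refine DFunLike.ext _ _ fun m => ?_
    change φ (MulOpposite.op (1 : R) • m) = φ m
    rw [MulOpposite.op_one, one_smul]
  mul_smul α β φ := by
    refine DFunLike.ext _ _ fun m => ?_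
    change φ (MulOpposite.op (α * β) • m) = φ (MulOpposite.op β • MulOpposite.op α • m)
    rw [MulOpposite.op_mul, mul_smul]
  smul_zero _ := DFunLike.ext _ _ fun _ => rfl
  smul_add _ _ _ := DFunLike.ext _ _ fun _ => rfl
  add_smul α β φ := by
    refine DFunLike.ext _ _ fun m => ?_
    change φ (MulOpposite.op (α + β) • m) = φ (MulOpposite.op α • m) + φ (MulOpposite.op β • m)
    rw [MulOpposite.op_add, add_smul]
    exact map_add φ _ _
  zero_smul φ := by
    refine DFunLike.ext _ _ fun m => ?_
    change φ (MulOpposite.op (0 : R) • m) = 0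
    rw [MulOpposite.op_zero, zero_smul]
    exact map_zero φ

lemma Dual.smul_apply (M : LCAMod.{u} R) (α : R) (φ : M.Dual) (m : M) :
    (α • φ) m = φ (MulOpposite.op α • m) := rfl

end LCAMod

section ExactStructure

variable {C : Type u} [Category.{v} C] [HasZeroMorphisms C]

/-- `X → Y → Z` is a kernel-cokernel pair: `i` is a kernel of `p` and `p` is a cokernel of `i`.
In a quasi-abelian category these are the short exact sequences of the natural
exact structure. -/
def IsKernelCokernelPair {X Y Z : C} (i : X ⟶ Y) (p : Y ⟶ Z) : Prop :=
  ∃ w : i ≫ p = 0,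
    Nonempty (IsLimit (KernelFork.ofι i w)) ∧ Nonempty (IsColimit (CokernelCofork.ofπ p w))

/-- Admissible monics of the exact structure given by all kernel-cokernel pairs. -/
def IsAdmissibleMonic {X Y : C} (i : X ⟶ Y) : Prop :=
  ∃ (Z : C) (p : Y ⟶ Z), IsKernelCokernelPair i p

/-- Admissible epics of the exact structure given by all kernel-cokernel pairs. -/
def IsAdmissibleEpic {Y Z : C} (p : Y ⟶ Z) : Prop :=
  ∃ (X : C) (i : X ⟶ Y), IsKernelCokernelPair i p

/-- Injective objects in the sense of exact categories: morphisms to `G` extend along all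
admissible monics. -/
def IsExactInjective (G : C) : Prop :=
  ∀ ⦃X Y : C⦄ (i : X ⟶ Y), IsAdmissibleMonic i → ∀ f : X ⟶ G, ∃ g : Y ⟶ G, i ≫ g = f

/-- Projective objects in the sense of exact categories: morphisms from `G` lift along all
admissible epics. -/
def IsExactProjective (G : C) : Prop :=
  ∀ ⦃Y Z : C⦄ (p : Y ⟶ Z), IsAdmissibleEpic p → ∀ f : G ⟶ Z, ∃ g : G ⟶ Y, g ≫ p = f

end ExactStructure

/-! The admissible monics are exactly the closed embeddings, and the admissible epics are exactly
the open surjections. For plain groups, `ℝ` then has both the extension and the lifting property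
(`exists_real_extension`, `exists_real_lift`). A Casimir element `∑ cᵢ ⊗ bᵢ` of the order, obtained
from the regular trace form of the semisimple algebra, averages a continuous homomorphism into a
linear one at the cost of a factor `N` (`exists_average`). Since `N` is invertible on a vector
module, vector modules are both injective and projective. Compact modules with projective dual are
injective by Pontryagin duality and injectivity of the circle; discrete projective modules are
clearly projective.

Conversely, let `G` be injective. The regular module is a closed lattice in its scalar extension to
`ℝ`, so every point of `G` lies on a one-parameter subgroup (`exists_oneParameter`) and `G` is
connected. A connected group has a cocompact lattice `ℤⁿ` and hence a proper homomorphism to `ℝⁿ`.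
Its kernel is a compact submodule with quotient a vector module; projectivity of that quotient
splits the kernel off, and the dual of the kernel is a summand of a free module.

Let `G` be projective. The epic `Hom(𝔄, ℝ) → Hom(𝔄, ℝ/ℤ)` turns each circle character of `G` into a
real one (`exists_real_character_ne_zero`), so real characters separate points and `G` has an open
vector submodule (`exists_isOpen_addEquiv_real`). It splits off by injectivity, with discrete
projective complement.

The analytic input is that characters separate the points of a locally compact abelian group. This
is proved by Gelfand theory in the bicommutant of the translations on `L²`. -/

open MeasureTheory Filter Topology Set
open scoped Pointwise

set_option linter.unusedSectionVars false

/-! ### Smearing a unitary representation by a compactly supported function -/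

section UnitaryRepresentation

variable {G : Type*} [AddCommGroup G] [TopologicalSpace G] [IsTopologicalAddGroup G]
  [MeasurableSpace G] [BorelSpace G]
  (μ : Measure G) [IsFiniteMeasureOnCompacts μ]
  {H : Type*} [NormedAddCommGroup H] [InnerProductSpace ℂ H] [CompleteSpace H]
  (T : G → H →ₗᵢ[ℂ] H)

lemma integrable_smul_orbit (hT : ∀ v, Continuous fun g => T g v) {f : G → ℝ}
    (hf : Continuous f) (hc : HasCompactSupport f) (v : H) :
    Integrable (fun g => f g • T g v) μ :=
  (hf.smul (hT v)).integrable_of_hasCompactSupport hc.smul_right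

/-- The operator `v ↦ ∫ f(g) T(g) v dg` attached to a compactly supported function. -/
noncomputable def smearedOperator (hT : ∀ v, Continuous fun g => T g v) {f : G → ℝ}
    (hf : Continuous f) (hc : HasCompactSupport f) : H →L[ℂ] H :=
  LinearMap.mkContinuous
    { toFun := fun v => ∫ g, f g • T g v ∂μ
      map_add' := fun v w => by
        simp only [map_add, smul_add]
        exact integral_add (integrable_smul_orbit μ T hT hf hc v)
          (integrable_smul_orbit μ T hT hf hc w)
      map_smul' := fun c v => by
        simp only [map_smul, RingHom.id_apply]
        rw [← integral_smul]
        simp_rw [smul_comm _ c] }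
    (∫ g, ‖f g‖ ∂μ) (fun v => by
      refine (norm_integral_le_integral_norm _).trans ?_
      rw [← integral_mul_const]
      simp [norm_smul])

lemma smearedOperator_apply (hT : ∀ v, Continuous fun g => T g v) {f : G → ℝ}
    (hf : Continuous f) (hc : HasCompactSupport f) (v : H) :
    smearedOperator μ T hT hf hc v = ∫ g, f g • T g v ∂μ := rfl

/-- With this bound, `L¹`-continuity of translation yields operator-norm convergence, which strong
continuity of `T` alone does not give. -/
lemma norm_smearedOperator_sub_le (hT : ∀ v, Continuous fun g => T g v) {f f' : G → ℝ}
    (hf : Continuous f) (hc : HasCompactSupport f) (hf' : Continuous f')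
    (hc' : HasCompactSupport f') :
    ‖smearedOperator μ T hT hf hc - smearedOperator μ T hT hf' hc'‖ ≤ ∫ g, ‖f g - f' g‖ ∂μ := by
  refine ContinuousLinearMap.opNorm_le_bound _ (integral_nonneg fun _ => norm_nonneg _) fun v => ?_
  rw [sub_apply, smearedOperator_apply, smearedOperator_apply,
    ← integral_sub (integrable_smul_orbit μ T hT hf hc v) (integrable_smul_orbit μ T hT hf' hc' v)]
  refine (norm_integral_le_integral_norm _).trans ?_
  rw [← integral_mul_const]
  simp [← sub_smul, norm_smul]

/-- This places the smeared operators in the bicommutant of the operators `T g`. -/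
lemma smearedOperator_comm (hT : ∀ v, Continuous fun g => T g v) {f : G → ℝ}
    (hf : Continuous f) (hc : HasCompactSupport f) (S : H →L[ℂ] H)
    (hS : ∀ g v, S (T g v) = T g (S v)) :
    S * smearedOperator μ T hT hf hc = smearedOperator μ T hT hf hc * S := by
  ext v
  change S (∫ g, f g • T g v ∂μ) = ∫ g, f g • T g (S v) ∂μ
  rw [← ContinuousLinearMap.integral_comp_comm _ (integrable_smul_orbit μ T hT hf hc v)]
  congr 1
  ext g
  rw [← hS, ← Complex.coe_smul, map_smul]; rfl

lemma translation_comp_smearedOperator [μ.IsAddLeftInvariant]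
    (hT : ∀ v, Continuous fun g => T g v) (hadd : ∀ g h v, T (g + h) v = T g (T h v)) {f : G → ℝ}
    (hf : Continuous f) (hc : HasCompactSupport f) (x : G) :
    (T x).toContinuousLinearMap * smearedOperator μ T hT hf hc =
      smearedOperator μ T hT (f := fun g => f (-x + g)) (hf.comp (continuous_const_add (-x)))
        (hc.comp_homeomorph (Homeomorph.addLeft (-x))) := by
  ext v
  change (T x).toContinuousLinearMap (∫ g, f g • T g v ∂μ) = ∫ g, f (-x + g) • T g v ∂μ
  rw [← ContinuousLinearMap.integral_comp_comm _ (integrable_smul_orbit μ T hT hf hc v),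
    ← integral_add_left_eq_self (fun g => f (-x + g) • T g v) x]
  congr 1
  ext g
  rw [neg_add_cancel_left, hadd, ← Complex.coe_smul, map_smul, ← Complex.coe_smul]; rfl

end UnitaryRepresentation

/-! ### The translation representation on `L^p` -/

section Translation

variable {G : Type*} [AddCommGroup G] [TopologicalSpace G] [IsTopologicalAddGroup G]
  [MeasurableSpace G] [BorelSpace G]
  (μ : Measure G) [μ.IsAddLeftInvariant]

/-- The translation representation on `L^p`. -/
noncomputable def translationLp (p : ENNReal) [Fact (1 ≤ p)] (x : G) :
    Lp ℂ p μ →ₗᵢ[ℂ] Lp ℂ p μ :=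
  Lp.compMeasurePreservingₗᵢ ℂ (fun g => x + g) (measurePreserving_add_left μ x)

lemma translationLp_add (p : ENNReal) [Fact (1 ≤ p)] (x y : G) (f : Lp ℂ p μ) :
    translationLp μ p (x + y) f = translationLp μ p x (translationLp μ p y f) := by
  have := Lp.compMeasurePreserving_comp_apply f (measurePreserving_add_left μ y)
    (measurePreserving_add_left μ x)
  refine Eq.trans ?_ this
  change Lp.compMeasurePreserving _ _ f = _
  congr 1
  ext g
  simp [add_assoc, add_left_comm]

lemma translationLp_zero (p : ENNReal) [Fact (1 ≤ p)] (f : Lp ℂ p μ) :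
    translationLp μ p 0 f = f := by
  have key : ∀ (c : G → G) (hc : MeasurePreserving c μ μ), c = id →
      Lp.compMeasurePreserving c hc f = f := by
    rintro _ hc rfl
    exact Lp.compMeasurePreserving_id_apply f
  exact key _ (measurePreserving_add_left μ 0) (funext zero_add)

lemma continuous_translationLp [R1Space G] [IsLocallyFiniteMeasure μ] [μ.InnerRegularCompactLTTop]
    (p : ENNReal) [Fact (1 ≤ p)] (hp : p ≠ ⊤) (f : Lp ℂ p μ) :
    Continuous fun x => translationLp μ p x f := by
  let c : C(G, C(G, G)) := ContinuousMap.curry ⟨fun x : G × G => x.1 + x.2, continuous_add⟩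
  exact Continuous.compMeasurePreservingLp (f := fun _ : G => f) (g := c) continuous_const
    c.continuous (fun x => measurePreserving_add_left μ x) hp

lemma tendsto_integral_norm_translate_sub [R1Space G] [IsLocallyFiniteMeasure μ]
    [μ.InnerRegularCompactLTTop] {f : G → ℝ}
    (hf : Continuous f) (hc : HasCompactSupport f) :
    Tendsto (fun x => ∫ g, ‖f (-x + g) - f g‖ ∂μ) (𝓝 0) (𝓝 0) := by
  have hm : MemLp (fun g => (f g : ℂ)) 1 μ :=
    (Complex.continuous_ofReal.comp hf).memLp_of_hasCompactSupport
      (hc.comp_left (g := fun r : ℝ => (r : ℂ)) (by simp))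
  have h1 := (continuous_translationLp μ 1 ENNReal.one_ne_top (hm.toLp _))
  have h2 : Continuous fun x => ‖translationLp μ 1 (-x) (hm.toLp _) - hm.toLp _‖ :=
    ((h1.comp continuous_neg).sub continuous_const).norm
  have h3 := h2.tendsto 0
  simp only [neg_zero, translationLp_zero, sub_self, norm_zero] at h3
  refine h3.congr fun x => ?_
  have : translationLp μ 1 (-x) (hm.toLp _) =
    (hm.comp_measurePreserving (measurePreserving_add_left μ (-x))).toLp _ := rfl
  rw [this, ← MemLp.toLp_sub, Lp.norm_toLp, eLpNorm_one_eq_lintegral_enorm,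
    integral_norm_eq_lintegral_enorm]
  · congr 2
    ext g
    simp only [Pi.sub_apply, Function.comp_apply, ← Complex.ofReal_sub]
    rw [← ofReal_norm, ← ofReal_norm, Complex.norm_real]
  · exact ((hf.comp (continuous_const_add (-x))).sub hf).integrable_of_hasCompactSupport
      ((hc.comp_homeomorph (Homeomorph.addLeft (-x))).sub hc) |>.aestronglyMeasurable

end Translation

/-! ### Group characters obtained from the Gelfand spectrum -/

section Characters

variable {G : Type*} [AddCommGroup G] [TopologicalSpace G] [IsTopologicalAddGroup G]
  [MeasurableSpace G] [BorelSpace G] [R1Space G]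
  (μ : Measure G) [IsFiniteMeasureOnCompacts μ] [μ.IsAddLeftInvariant] [IsLocallyFiniteMeasure μ]
  [μ.InnerRegularCompactLTTop]
  {H : Type*} [NormedAddCommGroup H] [InnerProductSpace ℂ H] [CompleteSpace H]
  (T : G → H →ₗᵢ[ℂ] H)

lemma WeakDual.CharacterSpace.eq_of_forall_apply_eq {A : Type*} [CommCStarAlgebra A] {a b : A}
    (h : ∀ φ : WeakDual.characterSpace ℂ A, φ a = φ b) : a = b :=
  (gelfandTransform_isometry A).injective (ContinuousMap.ext h)

/-- A continuous homomorphism to the unit circle, written additively. -/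
lemma exists_character_of_norm_eq_one (χ : G → ℂ) (hχ : Continuous χ) (h1 : ∀ g, ‖χ g‖ = 1)
    (hadd : ∀ g h, χ (g + h) = χ g * χ h) :
    ∃ ψ : G →ₜ+ UnitAddCircle, ∀ g, ψ g = 0 → χ g = 1 := by
  let c : G → Circle := fun g => ⟨χ g, by simp [Submonoid.unitSphere, h1]⟩
  have hc : Continuous c := hχ.subtype_mk _
  have hcadd : ∀ g h, c (g + h) = c g * c h := fun g h => Subtype.ext (hadd g h)
  let e := AddCircle.homeomorphCircle (T := (1 : ℝ)) one_ne_zero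
  have he : ∀ x y, e (x + y) = e x * e y := fun x y => by
    simp only [e, AddCircle.homeomorphCircle_apply, AddCircle.toCircle_add]
  have he0 : e 0 = 1 := by simp [e, AddCircle.homeomorphCircle_apply]
  refine ⟨⟨AddMonoidHom.mk' (fun g => e.symm (c g)) fun g h => ?_, e.symm.continuous.comp hc⟩,
    fun g hg => ?_⟩
  · apply e.injective
    rw [he, e.apply_symm_apply, e.apply_symm_apply, e.apply_symm_apply, hcadd]
  · have hg' : e.symm (c g) = 0 := hg
    have h2 : c g = 1 := by rw [← e.apply_symm_apply (c g), hg', he0]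
    exact congrArg Subtype.val h2

lemma adjoint_eq_of_isometry_of_rightInverse (S S' : H →ₗᵢ[ℂ] H) (h : ∀ v, S (S' v) = v) :
    star S.toContinuousLinearMap = S'.toContinuousLinearMap := by
  rw [ContinuousLinearMap.star_eq_adjoint, eq_comm, ContinuousLinearMap.eq_adjoint_iff]
  intro v w
  change inner ℂ (S' v) w = inner ℂ v (S w)
  conv_rhs => rw [← h v]
  exact (S.inner_map_map _ _).symm

/-- A Gelfand character `φ` of the bicommutant that does not kill the smeared operator restricts to
a continuous unitary character of `G`, which is trivial at `x`; so no `φ` distinguishes the two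
sides. -/
theorem translation_comp_smearedOperator_eq_of_characters (hT : ∀ v, Continuous fun g => T g v)
    (hadd : ∀ g h v, T (g + h) v = T g (T h v)) (h0 : ∀ v, T 0 v = v) (x : G)
    (hx : ∀ χ : G →ₜ+ UnitAddCircle, χ x = 0) {f : G → ℝ}
    (hf : Continuous f) (hc : HasCompactSupport f) :
    (T x).toContinuousLinearMap * smearedOperator μ T hT hf hc = smearedOperator μ T hT hf hc := by
  let τ : G → (H →L[ℂ] H) := fun g => (T g).toContinuousLinearMap
  have hτadd : ∀ g h, τ (g + h) = τ g * τ h := fun g h => ContinuousLinearMap.ext (hadd g h)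
  have hτ0 : τ 0 = 1 := ContinuousLinearMap.ext h0
  have hstar : ∀ g, star (τ g) = τ (-g) := fun g =>
    adjoint_eq_of_isometry_of_rightInverse _ _ fun v => by rw [← hadd, add_neg_cancel, h0]
  let S : Set (H →L[ℂ] H) := Set.range τ
  let C := StarSubalgebra.centralizer ℂ S
  -- The bicommutant is a norm-closed star algebra, commutative because the translations commute,
  -- and contains both the translations and the smeared operators.
  let B := StarSubalgebra.centralizer ℂ (C : Set (H →L[ℂ] H))
  have hS : S ∪ star S = S := by
    refine Set.union_eq_left.2 ?_
    rintro a ⟨g, hg⟩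
    exact ⟨-g, by rw [← hstar, hg, star_star]⟩
  have hBmem : ∀ a, a ∈ B ↔ ∀ s, (∀ g, τ g * s = s * τ g) → s * a = a * s := by
    intro a
    change a ∈ ((C : Set (H →L[ℂ] H)) ∪ star (C : Set (H →L[ℂ] H))).centralizer ↔ _
    rw [StarMemClass.star_coe_eq, Set.union_self]
    change (∀ s ∈ (S ∪ star S).centralizer, _) ↔ _
    rw [hS]
    refine forall_congr' fun s => ?_
    simp only [Set.mem_centralizer_iff, S, Set.forall_mem_range]
  have hτB : ∀ g, τ g ∈ B := fun g => (hBmem _).2 fun s hs => (hs g).symm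
  have hCB : ∀ {f : G → ℝ} (hf : Continuous f) (hc : HasCompactSupport f),
      smearedOperator μ T hT hf hc ∈ B := fun hf hc => (hBmem _).2 fun s hs =>
    smearedOperator_comm μ T hT hf hc s fun g v => (DFunLike.congr_fun (hs g) v).symm
  have hcomm : ∀ a ∈ B, ∀ b ∈ B, a * b = b * a := by
    intro a ha b hb
    refine (hBmem b).1 hb a fun g => (hBmem a).1 ha (τ g) fun h => ?_
    rw [← hτadd, ← hτadd, add_comm]
  have hclosed : IsClosed (B : Set (H →L[ℂ] H)) := Set.isClosed_centralizer _
  let _ : CStarAlgebra B := StarSubalgebra.cstarAlgebra B (h_closed := hclosed)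
  let _ : CommCStarAlgebra B := { (inferInstance : CStarAlgebra B) with
    mul_comm := fun a b => Subtype.ext (hcomm _ a.2 _ b.2) }
  suffices h : (⟨τ x, hτB x⟩ : B) * ⟨_, hCB hf hc⟩ = ⟨_, hCB hf hc⟩ from congrArg Subtype.val h
  refine WeakDual.CharacterSpace.eq_of_forall_apply_eq fun φ => ?_
  rw [map_mul]
  by_cases hz : φ ⟨_, hCB hf hc⟩ = 0
  · rw [hz, mul_zero]
  let u : G → B := fun g => ⟨τ g, hτB g⟩
  have huadd : ∀ g h, u (g + h) = u g * u h := fun g h => Subtype.ext (hτadd g h)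
  have hu0 : u 0 = 1 := Subtype.ext hτ0
  have hustar : ∀ g, star (u g) = u (-g) := fun g => Subtype.ext (hstar g)
  have hnorm : ∀ g, ‖φ (u g)‖ = 1 := by
    intro g
    have h1 : φ (u g) * star (φ (u g)) = 1 := by
      rw [← map_star, ← map_mul, hustar, ← huadd, add_neg_cancel, hu0, map_one]
    have h2 := congrArg norm h1
    rw [norm_mul, norm_star, norm_one] at h2
    nlinarith [norm_nonneg (φ (u g))]
  -- The map `τ` need not be norm continuous, but its product with the smeared operator is; dividing
  -- by the nonzero value of `φ` there gives continuity at `0`.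
  have hcont0 : Tendsto (fun g => φ (u g)) (𝓝 0) (𝓝 1) := by
    have h1 : Tendsto (fun g => u g * ⟨_, hCB hf hc⟩) (𝓝 0) (𝓝 (⟨_, hCB hf hc⟩ : B)) := by
      rw [tendsto_subtype_rng, tendsto_iff_norm_sub_tendsto_zero]
      refine squeeze_zero (fun _ => norm_nonneg _) (fun g => ?_)
        (tendsto_integral_norm_translate_sub μ hf hc)
      change ‖(T g).toContinuousLinearMap * _ - _‖ ≤ _
      rw [translation_comp_smearedOperator μ T hT hadd hf hc g]
      exact norm_smearedOperator_sub_le μ T hT _ _ hf hc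
    have h2 := ((map_continuous φ).tendsto _).comp h1
    have h3 := h2.div_const (φ ⟨_, hCB hf hc⟩)
    rw [div_self hz] at h3
    refine h3.congr fun g => ?_
    simp only [Function.comp_apply, map_mul]
    exact mul_div_cancel_right₀ _ hz
  have hcont : Continuous fun g => φ (u g) := by
    rw [continuous_iff_continuousAt]
    intro g
    have h1 : Tendsto (fun h => h - g) (𝓝 g) (𝓝 0) := by
      have := (continuous_sub_right g).tendsto g
      rwa [sub_self] at this
    have h2 := (hcont0.comp h1).mul_const (φ (u g))
    rw [one_mul] at h2
    refine h2.congr fun h => ?_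
    simp only [Function.comp_apply, ← map_mul, ← huadd, sub_add_cancel]
  obtain ⟨ψ, hψ⟩ := exists_character_of_norm_eq_one (fun g => φ (u g)) hcont hnorm
    (fun g h => by rw [huadd, map_mul])
  have : φ (u x) = 1 := hψ x (hx ψ)
  change φ (u x) * _ = _
  rw [this, one_mul]

end Characters

/-! ### Characters separate points -/

section Separation

variable {G : Type*} [AddCommGroup G] [TopologicalSpace G] [IsTopologicalAddGroup G]
  [LocallyCompactSpace G] [T2Space G]

/-- Smearing `v` by a bump function near `0` with integral `I` gives a vector fixed by `T x` and
within `I * ε / 2` of `I • v`. Hence `T x` moves `v` by at most `ε`. -/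
theorem unitaryRep_apply_eq_of_characters [MeasurableSpace G] [BorelSpace G]
    (μ : Measure G) [μ.IsAddHaarMeasure] [μ.InnerRegularCompactLTTop]
    {H : Type*} [NormedAddCommGroup H] [InnerProductSpace ℂ H] [CompleteSpace H]
    (T : G → H →ₗᵢ[ℂ] H) (hT : ∀ v, Continuous fun g => T g v)
    (hadd : ∀ g h v, T (g + h) v = T g (T h v)) (h0 : ∀ v, T 0 v = v) (x : G)
    (hx : ∀ χ : G →ₜ+ UnitAddCircle, χ x = 0) (v : H) : T x v = v := by
  refine eq_of_forall_dist_le fun ε hε => ?_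
  have hU : {g | dist (T g v) v < ε / 2} ∈ 𝓝 (0 : G) := by
    have := (hT v).tendsto 0
    rw [h0] at this
    exact this (Metric.ball_mem_nhds v (half_pos hε))
  obtain ⟨f, hf1, hf0, hfc, hfI⟩ := exists_continuous_one_zero_of_isCompact
    (isCompact_singleton (x := (0 : G))) (t := (interior {g | dist (T g v) v < ε / 2})ᶜ)
    isOpen_interior.isClosed_compl (by
      rw [Set.disjoint_singleton_left]
      exact fun h => h (mem_interior_iff_mem_nhds.2 hU))
  have hfint : Integrable f μ := f.continuous.integrable_of_hasCompactSupport hfc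
  have hpos : 0 < ∫ g, f g ∂μ :=
    f.continuous.integral_pos_of_hasCompactSupport_nonneg_nonzero hfc (fun g => (hfI g).1)
      (x := 0) (by rw [hf1 rfl]; exact one_ne_zero)
  set w := smearedOperator μ T hT f.continuous hfc v with hw
  have hTw : T x w = w := DFunLike.congr_fun
    (translation_comp_smearedOperator_eq_of_characters μ T hT hadd h0 x hx f.continuous hfc) v
  set I := ∫ g, f g ∂μ
  have hwv : ‖w - I • v‖ ≤ I * (ε / 2) := by
    have h1 : w - I • v = ∫ g, f g • (T g v - v) ∂μ := by
      simp only [smul_sub]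
      rw [integral_sub (integrable_smul_orbit μ T hT f.continuous hfc v) (hfint.smul_const v),
        integral_smul_const]
      rfl
    rw [h1, ← integral_mul_const]
    refine norm_integral_le_of_norm_le (hfint.mul_const _) (Eventually.of_forall fun g => ?_)
    rw [norm_smul, Real.norm_of_nonneg (hfI g).1]
    by_cases hg : g ∈ interior {g | dist (T g v) v < ε / 2}
    · refine mul_le_mul_of_nonneg_left ?_ (hfI g).1
      rw [← dist_eq_norm]
      exact (interior_subset hg).le
    · rw [hf0 hg]
      simp
  have h2 : I • (T x v - v) = (w - I • v) - T x (w - I • v) := by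
    rw [map_sub, hTw, ← Complex.coe_smul, ← Complex.coe_smul, map_smul, smul_sub]
    abel
  have h3 : I * ‖T x v - v‖ ≤ I * ε := by
    calc I * ‖T x v - v‖ = ‖I • (T x v - v)‖ := by rw [norm_smul, Real.norm_of_nonneg hpos.le]
      _ ≤ ‖w - I • v‖ + ‖T x (w - I • v)‖ := by rw [h2]; exact norm_sub_le _ _
      _ ≤ I * ε := by rw [LinearIsometry.norm_map]; linarith
  rw [dist_eq_norm]
  exact le_of_mul_le_mul_left h3 hpos

/-- Continuous characters separate the points of a locally compact abelian group. -/
theorem exists_character_ne_zero {x : G} (hx : x ≠ 0) : ∃ χ : G →ₜ+ UnitAddCircle, χ x ≠ 0 := by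
  by_contra! h
  let _ : MeasurableSpace G := borel G
  have : BorelSpace G := ⟨rfl⟩
  let μ : Measure G := Measure.addHaar
  have key := unitaryRep_apply_eq_of_characters μ (translationLp μ 2)
    (continuous_translationLp μ 2 ENNReal.ofNat_ne_top)
    (fun g h v => translationLp_add μ 2 g h v) (translationLp_zero μ 2) x h
  obtain ⟨U, V, hU, hV, hxU, h0V, hUV⟩ := t2_separation hx
  -- The neighbourhood `K` is so small that `x + K` misses it, yet triviality of translation by `x`
  -- on `L²` forces the indicator of `K` to agree with its translate almost everywhere.
  obtain ⟨K, hK, hK0, hKc⟩ : ∃ K ∈ 𝓝 (0 : G), K ⊆ V ∩ (fun g => x + g) ⁻¹' U ∧ IsCompact K :=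
    local_compact_nhds ((hV.inter (hU.preimage (continuous_const_add x))).mem_nhds
      ⟨h0V, by simpa using hxU⟩)
  have hKm : MeasurableSet K := hKc.measurableSet
  have hKfin : μ K ≠ ⊤ := hKc.measure_lt_top.ne
  have h1 := key (indicatorConstLp 2 hKm hKfin (1 : ℂ))
  have h2 : translationLp μ 2 x (indicatorConstLp 2 hKm hKfin (1 : ℂ)) =ᵐ[μ]
      (K.indicator fun _ => (1 : ℂ)) ∘ (fun g => x + g) :=
    (Lp.coeFn_compMeasurePreserving _ (measurePreserving_add_left μ x)).trans
      ((measurePreserving_add_left μ x).quasiMeasurePreserving.ae_eq_comp indicatorConstLp_coeFn)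
  rw [h1] at h2
  have h3 : K.indicator (fun _ => (1 : ℂ)) =ᵐ[μ] (K.indicator fun _ => (1 : ℂ)) ∘ (fun g => x + g) :=
    indicatorConstLp_coeFn.symm.trans h2
  have h4 : μ K = 0 := by
    refine measure_mono_null ?_ h3
    intro g hg hg'
    have h5 : x + g ∉ K := fun h => Set.disjoint_left.1 hUV (hK0 hg).2 (hK0 h).1
    simp [hg, h5] at hg'
  exact (Measure.measure_pos_of_mem_nhds μ hK).ne' h4

/-- A closed subgroup is the common kernel of the characters that vanish on it. -/
theorem exists_character_of_notMem (X : AddSubgroup G) (hX : IsClosed (X : Set G)) {y : G}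
    (hy : y ∉ X) : ∃ χ : G →ₜ+ UnitAddCircle, (∀ x ∈ X, χ x = 0) ∧ χ y ≠ 0 := by
  have := hX
  obtain ⟨χ, hχ⟩ := exists_character_ne_zero (G := G ⧸ X) (x := (y : G ⧸ X))
    (by rwa [Ne, QuotientAddGroup.eq_zero_iff])
  refine ⟨⟨(χ : G ⧸ X →+ UnitAddCircle).comp (QuotientAddGroup.mk' X),
    (map_continuous χ).comp QuotientAddGroup.continuous_mk⟩, fun x hx => ?_, hχ⟩
  change χ (x : G ⧸ X) = 0
  rw [(QuotientAddGroup.eq_zero_iff x).2 hx, map_zero]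

end Separation

/-! ### Characters of `ℝ`, the circle and its powers; injectivity of the circle -/

section CircleCharacters

lemma UnitAddCircle.exists_rep_abs_eq_norm (z : UnitAddCircle) :
    ∃ x : ℝ, (x : UnitAddCircle) = z ∧ |x| = ‖z‖ := by
  induction z using QuotientAddGroup.induction_on with | H x => ?_
  refine ⟨x - round x, ?_, UnitAddCircle.norm_eq.symm⟩
  have : ((round x : ℝ) : UnitAddCircle) = 0 := (AddCircle.coe_eq_zero_iff 1).2 ⟨round x, by simp⟩
  change ((x - round x : ℝ) : UnitAddCircle) = (x : UnitAddCircle)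
  rw [AddCircle.coe_sub, this, sub_zero]

lemma UnitAddCircle.norm_coe_of_abs_le {x : ℝ} (hx : |x| ≤ 1 / 2) :
    ‖(x : UnitAddCircle)‖ = |x| := by
  rw [AddCircle.norm_coe_eq_abs_iff 1 one_ne_zero]
  simpa using hx

lemma UnitAddCircle.eq_of_coe_eq {x y : ℝ} (h : (x : UnitAddCircle) = y) (hxy : |x - y| < 1) :
    x = y := by
  have h1 : ((x - y : ℝ) : UnitAddCircle) = 0 := by rw [AddCircle.coe_sub, h, sub_self]
  obtain ⟨n, hn⟩ := (AddCircle.coe_eq_zero_iff 1).1 h1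
  simp only [zsmul_eq_mul, mul_one] at hn
  rw [← hn, ← Int.cast_abs, ← Int.cast_one, Int.cast_lt, Int.abs_lt_one_iff] at hxy
  rw [hxy] at hn
  simp at hn
  linarith

/-- The circle has no small subgroups. -/
lemma UnitAddCircle.eq_zero_of_forall_norm_lt {z : UnitAddCircle} (h : ∀ n : ℕ, ‖n • z‖ < 1 / 4) :
    z = 0 := by
  obtain ⟨x, rfl, hx⟩ := exists_rep_abs_eq_norm z
  -- While the norm is below `1/4`, doubling stays where the norm is the absolute value of the real
  -- representative, so the norm doubles exactly. A nonzero point would therefore leave the ball.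
  have h1 : ∀ k : ℕ, ‖(2 ^ k) • (x : UnitAddCircle)‖ = 2 ^ k * |x| := by
    intro k
    induction k with
    | zero => simp [hx]
    | succ k ih =>
      have h2 := h (2 ^ k)
      rw [ih] at h2
      have h3 : (2 ^ (k + 1)) • (x : UnitAddCircle) = ((2 ^ (k + 1) * x : ℝ) : UnitAddCircle) := by
        rw [← AddCircle.coe_nsmul]
        simp
      have h4 : |(2 ^ (k + 1) * x : ℝ)| = 2 ^ (k + 1) * |x| := by
        rw [abs_mul, abs_of_pos (by positivity)]
      rw [h3, norm_coe_of_abs_le, h4]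
      rw [h4, pow_succ]
      linarith
  by_contra hne
  have hx0 : 0 < |x| := abs_pos.2 fun h0 => hne (by rw [h0]; exact AddCircle.coe_zero 1)
  obtain ⟨k, hk⟩ := pow_unbounded_of_one_lt (1 / |x|) (one_lt_two (α := ℝ))
  have h5 := h (2 ^ k)
  rw [h1] at h5
  rw [div_lt_iff₀ hx0] at hk
  linarith

/-- The characters of `ℝ` are `t ↦ a t mod 1`. -/
theorem exists_eq_coe_mul_of_character (χ : ℝ →ₜ+ UnitAddCircle) :
    ∃ a : ℝ, ∀ t, χ t = ((a * t : ℝ) : UnitAddCircle) := by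
  obtain ⟨δ, hδ, hχ⟩ : ∃ δ > 0, ∀ t : ℝ, |t| < δ → ‖χ t‖ < 1 / 4 := by
    have h1 : Tendsto (fun t => ‖χ t‖) (𝓝 0) (𝓝 0) := by
      have := ((map_continuous χ).norm.tendsto 0)
      rwa [map_zero, norm_zero] at this
    obtain ⟨δ, hδ, h2⟩ := Metric.eventually_nhds_iff.1
      (h1.eventually (gt_mem_nhds (show (0 : ℝ) < 1 / 4 by norm_num)))
    exact ⟨δ, hδ, fun t ht => h2 (by simpa using ht)⟩
  choose rep hrep hrepn using UnitAddCircle.exists_rep_abs_eq_norm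
  let s : ℕ → ℝ := fun k => δ / 2 ^ (k + 1)
  have hs0 : ∀ k, 0 < s k := fun k => by positivity
  have hs : ∀ k, |s k| < δ := fun k => by
    rw [abs_of_pos (hs0 k)]
    exact div_lt_self hδ (one_lt_pow₀ one_lt_two (by simp))
  have hsd : ∀ k, s k = s (k + 1) + s (k + 1) := fun k => by
    simp only [s]
    field_simp
    ring
  let b : ℕ → ℝ := fun k => rep (χ (s k))
  have hb : ∀ k, |b k| < 1 / 4 := fun k => by rw [hrepn]; exact hχ _ (hs k)
  -- Both sides lift the same point and differ by less than `1/4 + 1/2 < 1`, so they are equal; this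
  -- makes the lifts linear along the dyadic sequence `s`.
  have hbd : ∀ k, b k = b (k + 1) + b (k + 1) := fun k => by
    refine UnitAddCircle.eq_of_coe_eq ?_ ?_
    · rw [AddCircle.coe_add, hrep, hrep, ← map_add, ← hsd]
    · have h1 := abs_lt.1 (hb k)
      have h2 := abs_lt.1 (hb (k + 1))
      rw [abs_lt]
      constructor <;> linarith [h1.1, h1.2, h2.1, h2.2]
  let a := b 0 / s 0
  have hba : ∀ k, b k = a * s k := by
    intro k
    induction k with
    | zero => simp only [a]; field_simp [(hs0 0).ne']
    | succ k ih =>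
      have h1 := hbd k
      rw [ih, hsd k] at h1
      linarith
  refine ⟨a, ?_⟩
  let S : AddSubgroup ℝ :=
    { carrier := {t | χ t = ((a * t : ℝ) : UnitAddCircle)}
      zero_mem' := by simp
      add_mem' := fun {x y} hx hy => by
        simp only [mem_ofPred_eq] at hx hy ⊢
        rw [map_add, hx, hy, mul_add, AddCircle.coe_add]
      neg_mem' := fun {x} hx => by
        simp only [mem_ofPred_eq] at hx ⊢
        rw [map_neg, hx, mul_neg, AddCircle.coe_neg] }
  have hSc : IsClosed (S : Set ℝ) :=
    isClosed_eq (map_continuous χ) ((AddCircle.continuous_mk' 1).comp (continuous_const_mul a))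
  have hSd : Dense (S : Set ℝ) := by
    refine S.dense_of_not_isolated_zero fun ε hε => ?_
    obtain ⟨k, hk⟩ := pow_unbounded_of_one_lt (δ / ε) (one_lt_two (α := ℝ))
    refine ⟨s k, ?_, hs0 k, ?_⟩
    · change χ (s k) = _
      rw [← hba, hrep]
    · simp only [s]
      rw [div_lt_iff₀ hε] at hk
      rw [div_lt_iff₀ (by positivity), pow_succ]
      nlinarith
  intro t
  have : t ∈ (S : Set ℝ) := by rw [← hSc.closure_eq, hSd.closure_eq]; trivial
  exact this

/-- The continuous endomorphisms of the circle are multiplications by integers. -/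
theorem exists_eq_zsmul_of_endomorphism (χ : UnitAddCircle →ₜ+ UnitAddCircle) :
    ∃ n : ℤ, ∀ t, χ t = n • t := by
  obtain ⟨a, ha⟩ := exists_eq_coe_mul_of_character
    ⟨(χ : UnitAddCircle →+ UnitAddCircle).comp (QuotientAddGroup.mk' _),
      (map_continuous χ).comp (AddCircle.continuous_mk' 1)⟩
  replace ha : ∀ t : ℝ, χ (t : UnitAddCircle) = ((a * t : ℝ) : UnitAddCircle) := ha
  have h1 := ha 1
  rw [AddCircle.coe_period, map_zero, mul_one, eq_comm, AddCircle.coe_eq_zero_iff] at h1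
  obtain ⟨n, hn⟩ := h1
  refine ⟨n, fun t => ?_⟩
  induction t using QuotientAddGroup.induction_on with | H x => ?_
  change χ (x : UnitAddCircle) = n • (x : UnitAddCircle)
  rw [ha, ← hn, ← AddCircle.coe_zsmul]
  simp

/-- The characters of a power of the circle are the finite integral combinations of the
coordinates. -/
theorem exists_eq_finsuppSum_of_character {S : Type*} (χ : (S → UnitAddCircle) →ₜ+ UnitAddCircle) :
    ∃ c : S →₀ ℤ, ∀ x, χ x = c.sum fun s n => n • x s := by
  classical
  have h1 : {x | ‖χ x‖ < 1 / 4} ∈ 𝓝 (0 : S → UnitAddCircle) :=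
    (isOpen_lt (map_continuous χ).norm continuous_const).mem_nhds (by simp)
  rw [nhds_pi, Filter.mem_pi] at h1
  obtain ⟨I, hI, t, ht, hsub⟩ := h1
  -- The elements vanishing on the finite set `I` form a subgroup that `χ` sends into a small ball,
  -- and the circle has no small subgroups.
  have hzero : ∀ x : S → UnitAddCircle, (∀ i ∈ I, x i = 0) → χ x = 0 := fun x hx => by
    refine UnitAddCircle.eq_zero_of_forall_norm_lt fun n => ?_
    rw [← map_nsmul]
    refine hsub fun i hi => ?_
    rw [Pi.smul_apply, hx i hi, smul_zero]
    exact mem_of_mem_nhds (ht i)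
  have hn : ∀ i, ∃ n : ℤ, ∀ t : UnitAddCircle, χ (Pi.single i t) = n • t := fun i =>
    exists_eq_zsmul_of_endomorphism
      ⟨(χ : (S → UnitAddCircle) →+ UnitAddCircle).comp (AddMonoidHom.single (fun _ : S => UnitAddCircle) i),
        (map_continuous χ).comp (continuous_single (A := fun _ : S => UnitAddCircle) i)⟩
  choose n hn using hn
  let c : S →₀ ℤ := Finsupp.onFinset hI.toFinset (fun i => if i ∈ I then n i else 0)
    fun i h => hI.mem_toFinset.2 (by by_contra hn; exact h (if_neg hn))
  refine ⟨c, fun x => ?_⟩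
  have h2 : χ (x - ∑ i ∈ hI.toFinset, Pi.single i (x i)) = 0 := hzero _ fun i hi => by
    rw [Pi.sub_apply, Finset.sum_apply, Finset.sum_eq_single i]
    · simp
    · intro j _ hj
      simp [hj.symm]
    · simp [hi]
  rw [map_sub, sub_eq_zero, map_sum] at h2
  rw [h2, Finsupp.onFinset_sum _ (by simp)]
  refine Finset.sum_congr rfl fun i hi => ?_
  rw [hn, if_pos (by simpa using hi)]

/-- The circle is injective: characters extend along closed embeddings. -/
theorem exists_character_extension {X Y : Type*} [AddCommGroup X] [TopologicalSpace X]
    [AddCommGroup Y] [TopologicalSpace Y] [IsTopologicalAddGroup Y] [LocallyCompactSpace Y]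
    [T2Space Y] (i : X →+ Y) (hi : IsClosedEmbedding i) (χ : X →ₜ+ UnitAddCircle) :
    ∃ ψ : Y →ₜ+ UnitAddCircle, ∀ x, ψ (i x) = χ x := by
  -- The range of `j` is the graph of `χ`, closed because its first projection is a closed
  -- embedding.
  let j : X →+ Y × UnitAddCircle := i.prod (χ : X →+ UnitAddCircle)
  have hj : IsProperMap j := isProperMap_of_comp_of_t2
    (hi.continuous.prodMk (map_continuous χ)) continuous_fst hi.isProperMap
  -- The multiples of `χ` that extend form a subgroup of `ℤ`; it is everything once no prime divides
  -- all its elements.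
  let D : AddSubgroup ℤ :=
    { carrier := {n | ∃ ψ : Y →ₜ+ UnitAddCircle, ∀ x, ψ (i x) = n • χ x}
      zero_mem' := ⟨0, fun x => by simp⟩
      add_mem' := by
        rintro m n ⟨ψ, hψ⟩ ⟨φ, hφ⟩
        exact ⟨ψ + φ, fun x => by rw [add_smul, ← hψ, ← hφ]; rfl⟩
      neg_mem' := by
        rintro m ⟨ψ, hψ⟩
        exact ⟨-ψ, fun x => by rw [neg_smul, ← hψ]; rfl⟩ }
  have hprime : ∀ p : ℕ, p.Prime → ∃ n ∈ D, ¬ (p : ℤ) ∣ n := by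
    intro p hp
    have hp0 : (p : ℝ) ≠ 0 := Nat.cast_ne_zero.2 hp.ne_zero
    -- A character `Θ` that vanishes on the graph but not at `(0, 1/p)` acts on the circle factor by
    -- some `n` prime to `p`, and its restriction to `Y` extends `-n • χ`.
    have hnot : ((0 : Y), (((p : ℝ)⁻¹ : ℝ) : UnitAddCircle)) ∉ j.range := by
      rintro ⟨x, hx⟩
      obtain ⟨h1, h2⟩ := Prod.ext_iff.1 hx
      have h3 : x = 0 := hi.injective (by rw [map_zero]; exact h1)
      have h4 : χ x = (((p : ℝ)⁻¹ : ℝ) : UnitAddCircle) := h2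
      rw [h3, map_zero, eq_comm, AddCircle.coe_eq_zero_iff] at h4
      obtain ⟨n, hn⟩ := h4
      simp only [zsmul_eq_mul, mul_one] at hn
      have h5 : (n * p : ℤ) = 1 := by
        have : (n * p : ℝ) = 1 := by rw [hn, inv_mul_cancel₀ hp0]
        exact_mod_cast this
      exact hp.one_lt.ne' (by
        have := Int.isUnit_iff.1 (IsUnit.of_mul_eq_one_right _ h5)
        omega)
    obtain ⟨Θ, hΘ, hΘp⟩ := exists_character_of_notMem j.range (by
      rw [AddMonoidHom.coe_range]; exact hj.isClosedMap.isClosed_range) hnot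
    obtain ⟨n, hn⟩ := exists_eq_zsmul_of_endomorphism
      ⟨(Θ : Y × UnitAddCircle →+ UnitAddCircle).comp (AddMonoidHom.inr _ _),
        (map_continuous Θ).comp (by fun_prop : Continuous fun t : UnitAddCircle => ((0 : Y), t))⟩
    replace hn : ∀ t, Θ (0, t) = n • t := hn
    refine ⟨-n, ⟨⟨(Θ : Y × UnitAddCircle →+ UnitAddCircle).comp (AddMonoidHom.inl _ _),
        (map_continuous Θ).comp (by fun_prop : Continuous fun y : Y => (y, (0 : UnitAddCircle)))⟩,
        fun x => ?_⟩, fun hdvd => ?_⟩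
    · change Θ (i x, 0) = _
      have h1 : Θ (i x, χ x) = 0 := hΘ _ ⟨x, rfl⟩
      have h2 : ((i x, χ x) : Y × UnitAddCircle) = (i x, 0) + (0, χ x) := by simp
      rw [h2, map_add, hn] at h1
      rw [neg_smul]
      exact eq_neg_of_add_eq_zero_left h1
    · obtain ⟨k, hk⟩ := hdvd
      apply hΘp
      rw [hn, ← AddCircle.coe_zsmul, AddCircle.coe_eq_zero_iff]
      refine ⟨-k, ?_⟩
      have : (n : ℝ) = p * (-k) := by
        have : n = p * (-k) := by linarith
        exact_mod_cast this
      rw [zsmul_eq_mul, zsmul_eq_mul, this]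
      field_simp
      push_cast
      ring
  obtain ⟨d, hd⟩ := Int.subgroup_cyclic D
  have hd1 : d.natAbs = 1 := by
    by_contra hne
    obtain ⟨p, hp, hpd⟩ := Nat.exists_prime_and_dvd hne
    obtain ⟨n, hnD, hn⟩ := hprime p hp
    rw [hd, AddSubgroup.mem_closure_singleton] at hnD
    obtain ⟨k, rfl⟩ := hnD
    exact hn (Dvd.dvd.mul_left (Int.natCast_dvd.2 hpd) k)
  have h1 : (1 : ℤ) ∈ D := by
    rw [hd, AddSubgroup.mem_closure_singleton]
    rcases Int.natAbs_eq_iff.1 hd1 with h | h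
    · exact ⟨1, by simp [h]⟩
    · exact ⟨-1, by simp [h]⟩
  obtain ⟨ψ, hψ⟩ := h1
  exact ⟨ψ, fun x => by rw [hψ, one_smul]⟩

end CircleCharacters

/-! ### Extending real homomorphisms by a stability argument -/

section RealHomomorphisms

/-- Multiples of a nonzero value are unbounded. This kills real homomorphisms on compact subgroups
and makes them unique when prescribed on cocompact ones. -/
lemma AddMonoidHom.eq_zero_of_bounded {X : Type*} [AddCommGroup X] (f : X →+ ℝ) {B : ℝ}
    (hf : ∀ x, |f x| ≤ B) (x : X) : f x = 0 := by
  by_contra hne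
  obtain ⟨n, hn⟩ := Archimedean.arch (B + 1) (abs_pos.2 hne)
  have h := hf (n • x)
  rw [map_nsmul, nsmul_eq_mul, abs_mul, Nat.abs_cast] at h
  rw [nsmul_eq_mul] at hn
  linarith

lemma AddMonoidHom.continuous_of_bounded_nhds {Y : Type*} [AddCommGroup Y] [TopologicalSpace Y]
    [IsTopologicalAddGroup Y] (f : Y →+ ℝ) {B : ℝ} {U : Set Y} (hU : U ∈ 𝓝 (0 : Y))
    (hf : ∀ y ∈ U, |f y| ≤ B) : Continuous f := by
  refine continuous_of_continuousAt_zero f ?_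
  rw [ContinuousAt, map_zero, Metric.tendsto_nhds]
  intro ε hε
  obtain ⟨n, hn⟩ := exists_nat_gt (B / ε)
  have h1 : (fun y : Y => (n + 1) • y) ⁻¹' U ∈ 𝓝 (0 : Y) := by
    refine (continuous_nsmul (n + 1)).continuousAt.preimage_mem_nhds ?_
    rwa [smul_zero]
  filter_upwards [h1] with y hy
  have h2 := hf _ hy
  rw [map_nsmul, nsmul_eq_mul, abs_mul, Nat.abs_cast] at h2
  rw [div_lt_iff₀ hε] at hn
  rw [Real.dist_eq, sub_zero]
  push_cast at h2
  nlinarith [abs_nonneg (f y)]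

/-- Hyers–Ulam stability: a real function that is additive up to a bounded error is at bounded
distance from a homomorphism. -/
theorem exists_addMonoidHom_of_approximately_additive {Y : Type*} [AddCommGroup Y] (β : Y → ℝ)
    {D : ℝ} (hβ : ∀ y z, |β (y + z) - β y - β z| ≤ D) :
    ∃ F : Y →+ ℝ, ∀ y, |F y - β y| ≤ D := by
  -- The homomorphism is the limit of `β (2 ^ n • y) / 2 ^ n`; the successive errors `D / 2 / 2 ^ n`
  -- sum to `D`.
  let s : Y → ℕ → ℝ := fun y n => β (2 ^ n • y) / 2 ^ n
  have hs : ∀ y n, dist (s y n) (s y (n + 1)) ≤ D / 2 / 2 ^ n := by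
    intro y n
    have h1 := hβ (2 ^ n • y) (2 ^ n • y)
    have h2 : 2 ^ n • y + 2 ^ n • y = 2 ^ (n + 1) • y := by rw [← add_smul, pow_succ, mul_two]
    rw [h2] at h1
    have h3 : s y n - s y (n + 1) =
        -(β (2 ^ (n + 1) • y) - β (2 ^ n • y) - β (2 ^ n • y)) / 2 / 2 ^ n := by
      simp only [s]
      field_simp
      ring
    rw [Real.dist_eq, h3, abs_div, abs_div, abs_neg, abs_two, abs_of_pos (by positivity : (0:ℝ) < 2 ^ n)]
    gcongr
  have hconv : ∀ y, ∃ a, Tendsto (s y) atTop (𝓝 a) := fun y =>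
    cauchySeq_tendsto_of_complete (cauchySeq_of_le_geometric_two (hs y))
  choose F hF using hconv
  have hadd : ∀ y z, F (y + z) = F y + F z := by
    intro y z
    have h1 : Tendsto (fun n => s (y + z) n - s y n - s z n) atTop (𝓝 (F (y + z) - F y - F z)) :=
      ((hF _).sub (hF _)).sub (hF _)
    have h2 : Tendsto (fun n => s (y + z) n - s y n - s z n) atTop (𝓝 0) := by
      have h3 : Tendsto (fun n : ℕ => D / 2 ^ n) atTop (𝓝 0) :=
        tendsto_const_nhds.div_atTop (tendsto_pow_atTop_atTop_of_one_lt one_lt_two)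
      refine squeeze_zero_norm (fun n => ?_) h3
      have h4 : s (y + z) n - s y n - s z n =
          (β (2 ^ n • y + 2 ^ n • z) - β (2 ^ n • y) - β (2 ^ n • z)) / 2 ^ n := by
        simp only [s, smul_add]
        ring
      rw [h4, Real.norm_eq_abs, abs_div, abs_of_pos (by positivity : (0:ℝ) < 2 ^ n)]
      have := hβ (2 ^ n • y) (2 ^ n • z)
      gcongr
    linarith [tendsto_nhds_unique h1 h2]
  refine ⟨AddMonoidHom.mk' F hadd, fun y => ?_⟩
  have h1 := dist_le_of_le_geometric_two_of_tendsto₀ (hs y) (hF y)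
  rw [dist_comm, Real.dist_eq] at h1
  simpa [s] using h1

/-- A real homomorphism on a cocompact (not necessarily embedded) subgroup extends if it is bounded
over compact sets. -/
theorem exists_real_extension_of_cocompact {X Y : Type*} [AddCommGroup X] [AddCommGroup Y]
    [TopologicalSpace Y] [IsTopologicalAddGroup Y] [LocallyCompactSpace Y] (φ : X →+ Y) {C : Set Y}
    (hC : IsCompact C) (hφC : ∀ y, ∃ x, y - φ x ∈ C) (f : X →+ ℝ)
    (hf : ∀ K, IsCompact K → ∃ B : ℝ, ∀ x, φ x ∈ K → |f x| ≤ B) :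
    ∃ F : Y →ₜ+ ℝ, ∀ x, F (φ x) = f x := by
  -- The section `σ` is only coarse, but the additivity defect of `f ∘ σ` is a value of `f` over the
  -- compact set `C + C - C`, hence bounded.
  choose σ hσ using hφC
  obtain ⟨D, hD⟩ := hf _ ((hC.add hC).add hC.neg)
  obtain ⟨F, hF⟩ := exists_addMonoidHom_of_approximately_additive (fun y => f (σ y)) (D := D)
    (fun y z => by
      rw [← map_sub, ← map_sub]
      refine hD _ ?_
      have h1 : φ (σ (y + z) - σ y - σ z) =
          ((y - φ (σ y)) + (z - φ (σ z))) - ((y + z) - φ (σ (y + z))) := by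
        rw [map_sub, map_sub]
        abel
      rw [h1, sub_eq_add_neg]
      exact Set.add_mem_add (Set.add_mem_add (hσ y) (hσ z)) (Set.neg_mem_neg.2 (hσ _)))
  obtain ⟨K, hK, hK0⟩ := exists_compact_mem_nhds (0 : Y)
  obtain ⟨B, hB⟩ := hf _ (hK.add hC.neg)
  have hFc : Continuous F := by
    refine F.continuous_of_bounded_nhds hK0 (B := D + B) fun y hy => ?_
    have h1 : |f (σ y)| ≤ B := hB _
      ⟨y, hy, -(y - φ (σ y)), Set.neg_mem_neg.2 (hσ y), by simp⟩
    have h2 := hF y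
    calc |F y| = |(F y - f (σ y)) + f (σ y)| := by rw [sub_add_cancel]
      _ ≤ _ := (abs_add_le _ _).trans (add_le_add h2 h1)
  obtain ⟨B', hB'⟩ := hf _ hC.neg
  refine ⟨⟨F, hFc⟩, fun x => ?_⟩
  have h1 := AddMonoidHom.eq_zero_of_bounded (F.comp φ - f) (B := D + B') (fun x => by
    have h2 : |f (σ (φ x) - x)| ≤ B' := hB' _ (by
      have := hσ (φ x)
      rwa [Set.mem_neg, map_sub, neg_sub])
    have h3 := hF (φ x)
    rw [map_sub] at h2
    calc |(F.comp φ - f) x| = |(F (φ x) - f (σ (φ x))) + (f (σ (φ x)) - f x)| := by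
          rw [sub_add_sub_cancel]; rfl
      _ ≤ _ := (abs_add_le _ _).trans (add_le_add h3 h2)) x
  exact sub_eq_zero.1 h1

/-- Divisibility of `ℝ` gives an algebraic extension, and it is continuous because it is so on an
open subgroup. -/
lemma exists_real_extension_of_isOpen {Y : Type*} [AddCommGroup Y] [TopologicalSpace Y]
    [IsTopologicalAddGroup Y] (U : AddSubgroup Y) (hU : IsOpen (U : Set Y)) (f : U →ₜ+ ℝ) :
    ∃ F : Y →ₜ+ ℝ, ∀ x : U, F x = f x := by
  obtain ⟨F, hF⟩ := (Module.Baer.of_divisible (A := ℝ)).extension_property_addMonoidHom U.subtype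
    Subtype.val_injective (f : U →+ ℝ)
  have hF' : ∀ x : U, F x = f x := fun x => DFunLike.congr_fun hF x
  refine ⟨⟨F, ?_⟩, hF'⟩
  refine continuous_of_continuousAt_zero F ?_
  have h1 : ContinuousAt (F ∘ ((↑) : U → Y)) 0 := by
    have : (F ∘ ((↑) : U → Y)) = f := funext hF'
    rw [this]
    exact (map_continuous f).continuousAt
  exact (hU.isOpenEmbedding_subtypeVal.continuousAt_iff (x := (0 : U))).1 h1

end RealHomomorphisms

/-! ### Cocompact lattices in compactly generated groups -/

section Lattices

variable {G : Type u} [AddCommGroup G] [TopologicalSpace G] [IsTopologicalAddGroup G]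
  [LocallyCompactSpace G] [T2Space G]

/-- Infinitely many multiples of `x` lie in one compact set, so infinitely many lie in a single
small translate. The difference of two with far apart indices is a large multiple near `0`. -/
lemma exists_large_multiple_mem_nhds (x : G)
    (h : ¬ Tendsto (fun n : ℤ => n • x) cofinite (cocompact G)) {W : Set G} (hW : W ∈ 𝓝 (0 : G))
    (N : ℤ) : ∃ n ≥ N, n • x ∈ W := by
  rw [tendsto_cofinite_cocompact_iff] at h
  push Not at h
  obtain ⟨K, hK, hinf⟩ := h
  obtain ⟨W', hW', hsub⟩ := exists_nhds_half_neg hW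
  obtain ⟨t, -, ht⟩ := hK.elim_nhds_subcover (fun k => (fun g => g - k) ⁻¹' W') (fun k _ => by
    refine (continuous_sub_right k).continuousAt.preimage_mem_nhds ?_
    rwa [sub_self])
  have h1 : ∃ k ∈ t, {n : ℤ | n • x - k ∈ W'}.Infinite := by
    by_contra! hcon
    refine hinf ((t.finite_toSet.biUnion (t := fun k => {n : ℤ | n • x - k ∈ W'})
      (fun k hk => by simpa using hcon k hk)).subset fun n hn => ?_)
    have := ht hn
    simpa using this
  obtain ⟨k, -, hk⟩ := h1
  obtain ⟨a, ha⟩ := hk.nonempty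
  obtain ⟨b, hb, hab⟩ : ∃ b ∈ {n : ℤ | n • x - k ∈ W'}, b ∉ Icc (a - |N|) (a + |N|) := by
    by_contra! hcon
    exact hk ((Set.finite_Icc _ _).subset hcon)
  rw [mem_Icc, not_and_or, not_le, not_le] at hab
  rcases hab with h2 | h2
  · refine ⟨a - b, by linarith [le_abs_self N], ?_⟩
    have := hsub _ ha _ hb
    rwa [sub_sub_sub_cancel_right, ← sub_smul] at this
  · refine ⟨b - a, by linarith [le_abs_self N], ?_⟩
    have := hsub _ hb _ ha
    rwa [sub_sub_sub_cancel_right, ← sub_smul] at this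

/-- A cyclic subgroup of a locally compact group either has compact closure or is discrete and
infinite. -/
theorem isCompact_closure_zmultiples_or_tendsto (x : G) :
    IsCompact (closure (AddSubgroup.zmultiples x : Set G)) ∨
      Tendsto (fun n : ℤ => n • x) cofinite (cocompact G) := by
  refine or_iff_not_imp_right.2 fun h => ?_
  set H := (AddSubgroup.zmultiples x).topologicalClosure with hHdef
  have hxH : ∀ n : ℤ, n • x ∈ H := fun n =>
    AddSubgroup.le_topologicalClosure _ ⟨n, rfl⟩
  obtain ⟨V, hV, hV0⟩ := exists_compact_mem_nhds (0 : G)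
  have hVi : interior V ∈ 𝓝 (0 : G) := interior_mem_nhds.2 hV0
  obtain ⟨W, hW, hsub⟩ := exists_nhds_half_neg hVi
  have hW' : ∀ g : G, (fun y => g - y) ⁻¹' W ∈ 𝓝 g := fun g => by
    refine (continuous_sub_left g).continuousAt.preimage_mem_nhds ?_
    rwa [sub_self]
  -- Large multiples of `x` near `0` allow any element of the closure to be approximated by positive
  -- multiples only.
  have hA : ∀ g ∈ H, ∃ k : ℕ, 1 ≤ k ∧ g - (k : ℤ) • x ∈ interior V := by
    intro g hg
    obtain ⟨_, hm, m, rfl⟩ := mem_closure_iff_nhds.1 hg _ (hW' g)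
    obtain ⟨n, hn, hnx⟩ := exists_large_multiple_mem_nhds x h hW (1 - m)
    refine ⟨(m + n).toNat, by omega, ?_⟩
    have h1 := hsub _ hm _ hnx
    rw [Int.toNat_of_nonneg (by omega), add_smul, ← sub_sub]
    exact h1
  have hneg : ∀ g ∈ H, ∃ k : ℕ, 1 ≤ k ∧ g + (k : ℤ) • x ∈ interior V := by
    intro g hg
    obtain ⟨_, hm, m, rfl⟩ := mem_closure_iff_nhds.1 hg _ (hW' g)
    have hW2 : -W ∈ 𝓝 (0 : G) := neg_mem_nhds_zero G hW
    obtain ⟨n, hn, hnx⟩ := exists_large_multiple_mem_nhds x h hW2 (1 + m)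
    refine ⟨(n - m).toNat, by omega, ?_⟩
    have h1 := hsub _ hm _ hnx
    rw [Int.toNat_of_nonneg (by omega), sub_smul]
    rw [sub_neg_eq_add] at h1
    have h2 : g + (n • x - m • x) = g - m • x + n • x := by abel
    rw [h2]
    exact h1
  have hHV : IsCompact ((H : Set G) ∩ V) :=
    hV.inter_left (AddSubgroup.isClosed_topologicalClosure _)
  obtain ⟨t, ht⟩ := hHV.elim_finite_subcover
    (fun k : ℕ => if 1 ≤ k then (fun g => g + (k : ℤ) • x) ⁻¹' interior V else ∅)
    (fun k => by
      split_ifs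
      · exact isOpen_interior.preimage (continuous_add_const _)
      · exact isOpen_empty)
    (fun g hg => by
      obtain ⟨k, hk, hgk⟩ := hneg g hg.1
      exact mem_iUnion.2 ⟨k, by rw [if_pos hk]; exact hgk⟩)
  let N := t.sup id
  -- Compactness of `H ∩ V` bounds the return time: from any point of it, at most `N` positive steps
  -- by `x` lead back to `V`.
  have hB : ∀ g ∈ H, g ∈ V → ∃ k : ℕ, 1 ≤ k ∧ k ≤ N ∧ g + (k : ℤ) • x ∈ V := by
    intro g hg hgV
    obtain ⟨k, hkt, hk⟩ := mem_iUnion₂.1 (ht ⟨hg, hgV⟩)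
    split_ifs at hk with hk1
    · exact ⟨k, hk1, Finset.le_sup (f := id) hkt, interior_subset hk⟩
    · exact hk.elim
  have hcover : (H : Set G) ⊆ ⋃ k ∈ Finset.range (N + 1), (fun g => g + (k : ℤ) • x) '' V := by
    intro g hg
    classical
    have hex : ∃ k : ℕ, 1 ≤ k ∧ g - (k : ℤ) • x ∈ V := by
      obtain ⟨k, hk, hgk⟩ := hA g hg
      exact ⟨k, hk, interior_subset hgk⟩
    obtain ⟨h1, h2⟩ := Nat.find_spec hex
    set k := Nat.find hex
    -- If the least positive `k` with `g - k • x ∈ V` exceeded `N`, a return after `j ≤ N` steps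
    -- would give the smaller positive index `k - j`. So finitely many translates of `V` cover `H`.
    have hkN : k ≤ N := by
      by_contra hlt
      push Not at hlt
      obtain ⟨j, hj1, hjN, hj⟩ := hB _ (sub_mem hg (hxH k)) h2
      have hjk : j < k := lt_of_le_of_lt hjN hlt
      refine Nat.find_min hex (m := k - j) (by omega) ⟨by omega, ?_⟩
      rw [Nat.cast_sub hjk.le, sub_smul, ← sub_add]
      exact hj
    refine mem_iUnion₂.2 ⟨k, Finset.mem_range.2 (by omega), g - (k : ℤ) • x, h2, ?_⟩
    simp
  refine IsCompact.of_isClosed_subset ?_ isClosed_closure hcover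
  exact (Finset.range (N + 1)).isCompact_biUnion fun k _ => hV.image (continuous_add_const _)

/-- Compact sets lift along open surjections. -/
lemma exists_isCompact_image_superset {X Y : Type*} [TopologicalSpace X] [TopologicalSpace Y]
    [LocallyCompactSpace X] {f : X → Y} (hf : IsOpenMap f) (hs : Function.Surjective f) {K : Set Y}
    (hK : IsCompact K) : ∃ K', IsCompact K' ∧ K ⊆ f '' K' := by
  choose g hg using hs
  choose V hV hV0 using fun y => exists_compact_mem_nhds (g y)
  obtain ⟨t, -, ht⟩ := hK.elim_nhds_subcover (fun y => f '' V y) (fun y _ => by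
    have := hf.image_mem_nhds (hV0 y)
    rwa [hg] at this)
  refine ⟨⋃ y ∈ t, V y, t.isCompact_biUnion fun y _ => hV y, ht.trans ?_⟩
  rw [image_iUnion₂]

/-- The group contains a finitely generated free, discrete and cocompact subgroup. -/
def HasCocompactLattice (G : Type*) [AddCommGroup G] [TopologicalSpace G] : Prop :=
  ∃ (n : ℕ) (v : Fin n → G),
    Tendsto (fun z : Fin n → ℤ => ∑ i, z i • v i) cofinite (cocompact G) ∧
    ∃ C : Set G, IsCompact C ∧ ∀ g, ∃ z : Fin n → ℤ, g - ∑ i, z i • v i ∈ C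

/-- Induction on the number of generators: one with relatively compact multiples is absorbed into
the compact set, any other spans a discrete `ℤ` by which the group is divided, the lattice of the
quotient being lifted afterwards. -/
theorem hasCocompactLattice_of_generators (k : ℕ) : ∀ (G : Type u) [AddCommGroup G]
    [TopologicalSpace G] [IsTopologicalAddGroup G] [LocallyCompactSpace G] [T2Space G]
    (x : Fin k → G) (C : Set G), IsCompact C → (∀ g, ∃ z : Fin k → ℤ, g - ∑ i, z i • x i ∈ C) →
    HasCocompactLattice G := by
  induction k with
  | zero =>
    intro G _ _ _ _ _ x C hC hx
    refine ⟨0, x, ?_, C, hC, hx⟩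
    rw [Filter.cofinite_eq_bot]
    exact tendsto_bot
  | succ k ih =>
    intro G _ _ _ _ _ x C hC hx
    rcases isCompact_closure_zmultiples_or_tendsto (x 0) with hc | ht
    · refine ih G (fun i => x i.succ) _ (hc.add hC) fun g => ?_
      obtain ⟨z, hz⟩ := hx g
      refine ⟨fun i => z i.succ, z 0 • x 0, subset_closure ⟨z 0, rfl⟩, _, hz, ?_⟩
      simp only [Fin.sum_univ_succ]
      abel
    · have hclosed : IsClosed (AddSubgroup.zmultiples (x 0) : Set G) := by
        have hp : IsProperMap (fun n : ℤ => n • x 0) := by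
          rw [isProperMap_iff_tendsto_cocompact, cocompact_eq_cofinite]
          exact ⟨continuous_of_discreteTopology, ht⟩
        exact hp.isClosedMap.isClosed_range
      obtain ⟨n, w, hw, C', hC', hwC⟩ := ih (G ⧸ AddSubgroup.zmultiples (x 0))
        (fun i => ((x i.succ : G) : G ⧸ AddSubgroup.zmultiples (x 0))) _
        (hC.image QuotientAddGroup.continuous_mk) (fun g => by
          induction g using QuotientAddGroup.induction_on with | H g => ?_
          obtain ⟨z, hz⟩ := hx g
          refine ⟨fun i => z i.succ, _, hz, ?_⟩
          rw [Fin.sum_univ_succ, QuotientAddGroup.mk_sub, QuotientAddGroup.mk_add,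
            (QuotientAddGroup.eq_zero_iff _).2 (AddSubgroup.zsmul_mem_zmultiples (x 0) (z 0)), zero_add]
          exact congrArg _ (map_sum (QuotientAddGroup.mk' (AddSubgroup.zmultiples (x 0))) _ _))
      choose v hv using fun i => QuotientAddGroup.mk_surjective (w i)
      have hsum : ∀ z : Fin n → ℤ, ((∑ i, z i • v i : G) : G ⧸ AddSubgroup.zmultiples (x 0)) =
          ∑ i, z i • w i := fun z => by
        refine (map_sum (QuotientAddGroup.mk' (AddSubgroup.zmultiples (x 0))) _ _).trans ?_
        refine Finset.sum_congr rfl fun i _ => ?_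
        rw [map_zsmul, ← hv]
        rfl
      refine ⟨n + 1, Fin.cons (x 0) v, ?_, ?_⟩
      · rw [tendsto_cofinite_cocompact_iff] at hw ht ⊢
        intro K hK
        have h1 := hw _ (hK.image QuotientAddGroup.continuous_mk)
        refine (h1.biUnion fun z' _ => ((ht _ (hK.image
          (continuous_sub_right (∑ i, z' i • v i)))).image
            fun m : ℤ => (Fin.cons m z' : Fin (n + 1) → ℤ))).subset fun z hz => ?_
        simp only [Fin.sum_univ_succ, Fin.cons_zero, Fin.cons_succ] at hz
        refine mem_iUnion₂.2 ⟨Fin.tail z, ⟨_, hz, ?_⟩, z 0, ⟨_, hz, ?_⟩, Fin.cons_self_tail z⟩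
        · rw [QuotientAddGroup.mk_add,
            (QuotientAddGroup.eq_zero_iff _).2 (AddSubgroup.zsmul_mem_zmultiples (x 0) (z 0)), zero_add]
          exact hsum (Fin.tail z)
        · exact add_sub_cancel_right _ _
      · obtain ⟨K, hK, hCK⟩ := exists_isCompact_image_superset
          (QuotientAddGroup.isOpenMap_coe (N := AddSubgroup.zmultiples (x 0)))
          QuotientAddGroup.mk_surjective hC'
        refine ⟨K, hK, fun g => ?_⟩
        obtain ⟨z, hz⟩ := hwC g
        obtain ⟨c, hc, hcz⟩ := hCK hz
        rw [← hsum, ← QuotientAddGroup.mk_sub, eq_comm, QuotientAddGroup.eq] at hcz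
        obtain ⟨m, hm⟩ := hcz
        refine ⟨Fin.cons (-m) z, ?_⟩
        simp only [Fin.sum_univ_succ, Fin.cons_zero, Fin.cons_succ]
        have hm' : m • x 0 = -(g - ∑ i, z i • v i) + c := hm
        have : g - (-m • x 0 + ∑ i, z i • v i) = c := by
          rw [neg_smul, hm']
          abel
        rwa [this]

/-- For `W = V ∪ -V`, finitely many translates of `W` cover `W + W`. Modulo the subgroup generated
by the translating elements, every sum of elements of `W` reduces to an element of `W`. -/
theorem hasCocompactLattice_of_closure_eq_top {V : Set G} (hV : IsCompact V)
    (hV0 : V ∈ 𝓝 (0 : G)) (htop : AddSubgroup.closure V = ⊤) : HasCocompactLattice G := by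
  classical
  set W := V ∪ -V with hWdef
  have hW : IsCompact W := hV.union hV.neg
  have hW0 : interior W ∈ 𝓝 (0 : G) := interior_mem_nhds.2 (mem_of_superset hV0 subset_union_left)
  obtain ⟨t, -, ht⟩ := (hW.add hW).elim_nhds_subcover (fun f => (fun g => g - f) ⁻¹' interior W)
    (fun f _ => by
      refine (continuous_sub_right f).continuousAt.preimage_mem_nhds ?_
      rwa [sub_self])
  have key : ∀ g ∈ AddSubgroup.closure V, ∃ z : t → ℤ, g - ∑ i, z i • (i : G) ∈ W := by
    intro g hg
    induction hg using AddSubgroup.closure_induction with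
    | mem g hg => exact ⟨0, by simpa [hWdef] using Or.inl hg⟩
    | zero => exact ⟨0, by simpa using interior_subset (mem_of_mem_nhds hW0)⟩
    | add g h _ _ ihg ihh =>
      obtain ⟨a, ha⟩ := ihg
      obtain ⟨b, hb⟩ := ihh
      obtain ⟨f, hft, hf⟩ := mem_iUnion₂.1 (ht (Set.add_mem_add ha hb))
      refine ⟨a + b + Pi.single (⟨f, hft⟩ : t) (1 : ℤ), ?_⟩
      have h1 : ∑ i : t, (a + b + Pi.single (⟨f, hft⟩ : t) (1 : ℤ) : t → ℤ) i • (i : G) =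
          ∑ i, a i • (i : G) + ∑ i, b i • (i : G) + f := by
        simp only [Pi.add_apply, add_smul, Finset.sum_add_distrib]
        congr 1
        rw [Finset.sum_eq_single ⟨f, hft⟩]
        · simp
        · intro j _ hj
          simp [hj]
        · simp
      rw [h1]
      have h2 : g + h - (∑ i, a i • (i : G) + ∑ i, b i • (i : G) + f) =
          (g - ∑ i, a i • (i : G)) + (h - ∑ i, b i • (i : G)) - f := by abel
      rw [h2]
      exact interior_subset hf
    | neg g _ ihg =>
      obtain ⟨a, ha⟩ := ihg
      refine ⟨-a, ?_⟩
      have h1 : -g - ∑ i, (-a) i • (i : G) = -(g - ∑ i, a i • (i : G)) := by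
        simp only [Pi.neg_apply, neg_smul, Finset.sum_neg_distrib]
        abel
      rw [h1, hWdef, ← Set.mem_neg, Set.union_neg, neg_neg, Set.union_comm]
      exact ha
  let e := t.equivFin
  refine hasCocompactLattice_of_generators t.card G (fun i => (e.symm i : G)) W hW fun g => ?_
  obtain ⟨z, hz⟩ := key g (by rw [htop]; trivial)
  refine ⟨fun i => z (e.symm i), ?_⟩
  rwa [Equiv.sum_comp e.symm (fun i => z i • (i : G))]

lemma isOpen_closure_of_mem_nhds {V : Set G} (hV0 : V ∈ 𝓝 (0 : G)) :
    IsOpen (AddSubgroup.closure V : Set G) :=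
  AddSubgroup.isOpen_of_mem_nhds _ (g := 0) (mem_of_superset hV0 AddSubgroup.subset_closure)

variable (G) in
theorem exists_isOpen_hasCocompactLattice :
    ∃ G' : AddSubgroup G, IsOpen (G' : Set G) ∧ HasCocompactLattice G' := by
  obtain ⟨V, hV, hV0⟩ := exists_compact_mem_nhds (0 : G)
  have ho := isOpen_closure_of_mem_nhds hV0
  have hcl : IsClosed (AddSubgroup.closure V : Set G) := AddSubgroup.isClosed_of_isOpen _ ho
  have : LocallyCompactSpace (AddSubgroup.closure V) := hcl.isClosedEmbedding_subtypeVal.locallyCompactSpace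
  exact ⟨_, ho, hasCocompactLattice_of_closure_eq_top
    (hcl.isClosedEmbedding_subtypeVal.isCompact_preimage hV)
    (continuous_subtype_val.continuousAt.preimage_mem_nhds hV0)
    (AddSubgroup.closure_closure_coe_preimage)⟩

theorem hasCocompactLattice_of_connectedSpace [ConnectedSpace G] : HasCocompactLattice G := by
  obtain ⟨V, hV, hV0⟩ := exists_compact_mem_nhds (0 : G)
  have ho := isOpen_closure_of_mem_nhds hV0
  have hcl : IsClosed (AddSubgroup.closure V : Set G) := AddSubgroup.isClosed_of_isOpen _ ho
  exact hasCocompactLattice_of_closure_eq_top hV hV0 (SetLike.coe_injective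
    (IsClopen.eq_univ ⟨hcl, ho⟩ ⟨0, zero_mem _⟩))

end Lattices

/-! ### Injectivity of `ℝ` -/

section RealInjective

/-- The real line is injective: real homomorphisms extend along closed embeddings. -/
theorem exists_real_extension {X : Type*} {Y : Type u} [AddCommGroup X] [TopologicalSpace X]
    [AddCommGroup Y] [TopologicalSpace Y] [IsTopologicalAddGroup Y] [LocallyCompactSpace Y]
    [T2Space Y] (i : X →+ Y) (hi : IsClosedEmbedding i) (f : X →ₜ+ ℝ) :
    ∃ F : Y →ₜ+ ℝ, ∀ x, F (i x) = f x := by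
  have hcl : IsClosed (i.range : Set Y) := by
    rw [AddMonoidHom.coe_range]
    exact hi.isClosed_range
  -- An open subgroup of the quotient with a cocompact lattice is pulled back to an open subgroup
  -- `Y'` of `Y`; from `Y'` the extension to `Y` is automatic.
  obtain ⟨Q', hQ'o, n, w, hw, C, hC, hwC⟩ := exists_isOpen_hasCocompactLattice (Y ⧸ i.range)
  let π : Y →+ Y ⧸ i.range := QuotientAddGroup.mk' i.range
  have hπc : Continuous π := QuotientAddGroup.continuous_mk
  let Y' : AddSubgroup Y := Q'.comap π
  have hY'o : IsOpen (Y' : Set Y) := hQ'o.preimage hπc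
  have hY'c : IsClosed (Y' : Set Y) := AddSubgroup.isClosed_of_isOpen _ hY'o
  have hlc : LocallyCompactSpace Y' := hY'c.isClosedEmbedding_subtypeVal.locallyCompactSpace
  have hπi : ∀ x, π (i x) = 0 := fun x => (QuotientAddGroup.eq_zero_iff _).2 ⟨x, rfl⟩
  let i' : X →+ Y' := i.codRestrict Y' fun x => by
    change π (i x) ∈ Q'
    rw [hπi]
    exact zero_mem _
  let π' : Y' →+ Q' := (π.comp Y'.subtype).codRestrict Q' fun y => y.2
  have hπ'c : Continuous π' := (hπc.comp continuous_subtype_val).subtype_mk _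
  have hπ'i : ∀ x, π' (i' x) = 0 := fun x => Subtype.ext (hπi x)
  have hπ's : Function.Surjective π' := by
    rintro ⟨q, hq⟩
    obtain ⟨y, rfl⟩ := QuotientAddGroup.mk_surjective q
    exact ⟨⟨y, hq⟩, rfl⟩
  have hπ'ker : ∀ y, π' y = 0 → ∃ x, i' x = y := by
    intro y hy
    obtain ⟨x, hx⟩ := (QuotientAddGroup.eq_zero_iff (y : Y)).1 (congrArg Subtype.val hy)
    exact ⟨x, Subtype.ext hx⟩
  have hπ'o : IsOpenMap π' := by
    intro U hU
    refine Topology.IsInducing.subtypeVal.isOpen_iff.2 ⟨_, QuotientAddGroup.isOpenMap_coe _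
      (hY'o.isOpenMap_subtype_val U hU), ?_⟩
    ext q
    constructor
    · rintro ⟨_, ⟨y, hy, rfl⟩, hq⟩
      exact ⟨y, hy, Subtype.ext hq⟩
    · rintro ⟨y, hy, rfl⟩
      exact ⟨_, ⟨y, hy, rfl⟩, rfl⟩
  choose v hv using fun j => hπ's (w j)
  let L : (Fin n → ℤ) →+ Y' := ∑ j, ((zmultiplesHom Y' (v j)).comp (Pi.evalAddMonoidHom _ j))
  have hL : ∀ z, L z = ∑ j, z j • v j := fun z => by simp [L]
  have hπL : ∀ z, π' (L z) = ∑ j, z j • w j := fun z => by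
    rw [hL, map_sum]
    exact Finset.sum_congr rfl fun j _ => by rw [map_zsmul, hv]
  obtain ⟨K, hK, hCK⟩ := exists_isCompact_image_superset hπ'o hπ's hC
  -- Together, `X` and a lift of the lattice are cocompact in `Y'`, and `f` is extended by zero on
  -- the lattice.
  let φ : X × (Fin n → ℤ) →+ Y' := i'.coprod L
  obtain ⟨F, hF⟩ := exists_real_extension_of_cocompact φ hK (fun y => by
      obtain ⟨z, hz⟩ := hwC (π' y)
      obtain ⟨c, hc, hcz⟩ := hCK hz
      obtain ⟨x, hx⟩ := hπ'ker (y - L z - c) (by rw [map_sub, map_sub, hπL, hcz, sub_self])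
      refine ⟨(x, z), ?_⟩
      have : y - φ (x, z) = c := by
        change y - (i' x + L z) = c
        rw [hx]
        abel
      rwa [this]) ((f : X →+ ℝ).comp (AddMonoidHom.fst _ _)) (fun K hK => by
      -- Over a compact set only finitely many lattice coordinates occur, and for each of them the
      -- `X`-coordinate lies in a compact set.
      have h1 := tendsto_cofinite_cocompact_iff.1 hw _ (hK.image hπ'c)
      have h2 : Bornology.IsBounded (⋃ z ∈ (fun z : Fin n → ℤ => ∑ j, z j • w j) ⁻¹' (π' '' K),
          f '' (i ⁻¹' ((fun y : Y' => ((y - L z : Y') : Y)) '' K))) := by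
        refine (Bornology.isBounded_biUnion h1).2 fun z _ => ?_
        exact ((hi.isCompact_preimage (hK.image
          (continuous_subtype_val.comp (continuous_sub_right _)))).image
            (map_continuous f)).isBounded
      obtain ⟨B, hB⟩ := h2.exists_norm_le
      refine ⟨B, fun x hx => hB _ (mem_iUnion₂.2 ⟨x.2, ⟨_, hx, ?_⟩, x.1, ⟨_, hx, ?_⟩, rfl⟩)⟩
      · change π' (i' x.1 + L x.2) = _
        rw [map_add, hπ'i, zero_add, hπL]
      · change ((i' x.1 + L x.2 - L x.2 : Y') : Y) = i x.1
        rw [add_sub_cancel_right]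
        rfl)
  obtain ⟨F', hF'⟩ := exists_real_extension_of_isOpen Y' hY'o F
  refine ⟨F', fun x => ?_⟩
  have h3 := hF (x, 0)
  have h4 : φ (x, 0) = i' x := by
    change i' x + L 0 = i' x
    rw [map_zero, add_zero]
  rw [h4] at h3
  exact (hF' (i' x)).trans h3

end RealInjective

/-! ### Real coordinates attached to a cocompact lattice -/

section LatticeCoordinates

variable {G : Type u} [AddCommGroup G] [TopologicalSpace G] [IsTopologicalAddGroup G]
  [LocallyCompactSpace G] [T2Space G]

/-- A cocompact lattice gives a proper homomorphism to `ℝⁿ` that identifies it with `ℤⁿ`. -/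
theorem HasCocompactLattice.exists_proper (h : HasCocompactLattice G) :
    ∃ (n : ℕ) (v : Fin n → G) (Φ : G →ₜ+ (Fin n → ℝ)),
      Tendsto (fun z : Fin n → ℤ => ∑ i, z i • v i) cofinite (cocompact G) ∧
      (∃ C : Set G, IsCompact C ∧ ∀ g, ∃ z : Fin n → ℤ, g - ∑ i, z i • v i ∈ C) ∧
      (∀ i, Φ (v i) = Pi.single i 1) ∧ IsProperMap Φ := by
  obtain ⟨n, v, hv, C, hC, hvC⟩ := h
  let L : (Fin n → ℤ) →+ G := ∑ j, ((zmultiplesHom G (v j)).comp (Pi.evalAddMonoidHom _ j))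
  have hL : ∀ z, L z = ∑ j, z j • v j := fun z => by simp [L]
  have hLs : ∀ i, L (Pi.single i 1) = v i := fun i => by
    rw [hL, Finset.sum_eq_single i]
    · simp
    · intro j _ hj
      simp [hj]
    · simp
  have hF : ∀ i, ∃ F : G →ₜ+ ℝ, ∀ z, F (L z) = z i := fun i =>
    exists_real_extension_of_cocompact L hC (fun g => by simpa only [hL] using hvC g)
      ((Int.castAddHom ℝ).comp (Pi.evalAddMonoidHom _ i)) (fun K hK => by
        have h1 := (tendsto_cofinite_cocompact_iff.1 hv _ hK).image
          (fun z => |((z i : ℤ) : ℝ)|)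
        obtain ⟨B, hB⟩ := h1.bddAbove
        exact ⟨B, fun z hz => hB ⟨z, by rwa [mem_preimage, ← hL], rfl⟩⟩)
  choose F hF using hF
  let Φ : G →ₜ+ (Fin n → ℝ) :=
    ⟨AddMonoidHom.mk' (fun g i => F i g) fun a b => funext fun i => map_add (F i) a b,
      continuous_pi fun i => map_continuous (F i)⟩
  have hΦL : ∀ z, Φ (L z) = fun i => (z i : ℝ) := fun z => funext fun i => hF i z
  refine ⟨n, v, Φ, hv, ⟨C, hC, hvC⟩, fun i => ?_, ?_⟩
  · rw [← hLs, hΦL]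
    ext j
    rcases eq_or_ne j i with rfl | hj
    · simp
    · simp [hj]
  · rw [isProperMap_iff_isCompact_preimage]
    refine ⟨map_continuous Φ, fun K hK => ?_⟩
    -- If `g - L z ∈ C` and `Φ g ∈ K`, then `z = Φ (L z)` lies in the bounded set `K - Φ(C)`. Only
    -- finitely many translates of `C` are therefore needed to cover the preimage of `K`.
    have hB : Bornology.IsBounded (K + -(Φ '' C)) :=
      (hK.add (hC.image (map_continuous Φ)).neg).isBounded
    obtain ⟨B, hB⟩ := hB.exists_norm_le
    have hfin : (Set.pi univ fun _ : Fin n => Icc (-⌈B⌉) ⌈B⌉).Finite :=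
      Set.Finite.pi fun _ => Set.finite_Icc _ _
    refine IsCompact.of_isClosed_subset (hfin.isCompact_biUnion fun z _ =>
      hC.image (continuous_add_const (L z))) (hK.isClosed.preimage (map_continuous Φ)) ?_
    intro g hg
    obtain ⟨z, hz⟩ := hvC g
    rw [← hL] at hz
    refine mem_iUnion₂.2 ⟨z, ?_, g - L z, hz, sub_add_cancel _ _⟩
    intro i _
    have h1 : ‖Φ (L z)‖ ≤ B := hB _ ⟨Φ g, hg, -Φ (g - L z), Set.neg_mem_neg.2 ⟨_, hz, rfl⟩, by
      simp⟩
    have h2 : |(z i : ℝ)| ≤ B := by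
      have := (norm_le_pi_norm (Φ (L z)) i).trans h1
      rwa [hΦL] at this
    have h3 := abs_le.1 h2
    have h4 : (z i : ℝ) ≤ ⌈B⌉ := h3.2.trans (Int.le_ceil B)
    have h5 : ((-⌈B⌉ : ℤ) : ℝ) ≤ z i := by
      push_cast
      linarith [Int.le_ceil B]
    exact ⟨by exact_mod_cast h5, by exact_mod_cast h4⟩

/-- Real homomorphisms are determined by their values on a cocompact lattice. -/
lemma real_hom_eq_of_eq_on_lattice {n : ℕ} {v : Fin n → G} {C : Set G} (hC : IsCompact C)
    (hvC : ∀ g, ∃ z : Fin n → ℤ, g - ∑ i, z i • v i ∈ C) (f g : G →ₜ+ ℝ)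
    (h : ∀ i, f (v i) = g (v i)) (x : G) : f x = g x := by
  let d : G →ₜ+ ℝ := f - g
  have hd : ∀ x, d x = f x - g x := fun _ => rfl
  obtain ⟨B, hB⟩ := (hC.image (map_continuous d)).isBounded.exists_norm_le
  have := AddMonoidHom.eq_zero_of_bounded (d : G →+ ℝ) (B := B) (fun x => by
    obtain ⟨z, hz⟩ := hvC x
    have h1 : d (x - ∑ i, z i • v i) = d x := by
      rw [map_sub, map_sum, Finset.sum_eq_zero, sub_zero]
      intro i _
      rw [map_zsmul, hd, h, sub_self, smul_zero]
    have := hB _ ⟨_, hz, rfl⟩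
    rw [h1] at this
    exact this) x
  exact sub_eq_zero.1 this

end LatticeCoordinates

/-! ### Projectivity of `ℝ` -/

section RealProjective

lemma exists_eq_coe_sum_of_character {ι : Type*} [Fintype ι] (χ : (ι → ℝ) →ₜ+ UnitAddCircle) :
    ∃ a : ι → ℝ, ∀ x, χ x = ((∑ i, a i * x i : ℝ) : UnitAddCircle) := by
  classical
  have h : ∀ i, ∃ a : ℝ, ∀ t : ℝ, χ (Pi.single i t) = ((a * t : ℝ) : UnitAddCircle) := fun i =>
    exists_eq_coe_mul_of_character
      ⟨(χ : (ι → ℝ) →+ UnitAddCircle).comp (AddMonoidHom.single (fun _ : ι => ℝ) i),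
        (map_continuous χ).comp (continuous_single (A := fun _ : ι => ℝ) i)⟩
  choose a ha using h
  refine ⟨a, fun x => ?_⟩
  conv_lhs => rw [← Finset.univ_sum_single x, map_sum]
  simp only [ha]
  exact (map_sum (QuotientAddGroup.mk' (AddSubgroup.zmultiples (1 : ℝ))) _ _).symm

/-- The evaluation embedding of a group with a proper homomorphism to `ℝⁿ`. -/
lemma isClosedEmbedding_prod_eval {Y : Type u} [AddCommGroup Y] [TopologicalSpace Y]
    [IsTopologicalAddGroup Y] [LocallyCompactSpace Y] [T2Space Y] {E : Type*} [TopologicalSpace E]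
    [T2Space E] {Φ : Y → E} (hΦ : IsProperMap Φ) :
    IsClosedEmbedding fun y => ((Φ y, fun χ => χ y) : E × ((Y →ₜ+ UnitAddCircle) → UnitAddCircle)) := by
  have hc : Continuous fun y =>
      ((Φ y, fun χ => χ y) : E × ((Y →ₜ+ UnitAddCircle) → UnitAddCircle)) :=
    hΦ.continuous.prodMk (continuous_pi fun χ => map_continuous χ)
  have hinj : Function.Injective fun y =>
      ((Φ y, fun χ => χ y) : E × ((Y →ₜ+ UnitAddCircle) → UnitAddCircle)) := by
    intro y z hyz
    by_contra hne
    obtain ⟨χ, hχ⟩ := exists_character_ne_zero (sub_ne_zero.2 hne)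
    exact hχ (by rw [map_sub, sub_eq_zero]; exact congrFun (Prod.ext_iff.1 hyz).2 χ)
  refine IsClosedEmbedding.of_continuous_injective_isClosedMap hc hinj ?_
  exact (isProperMap_of_comp_of_t2 (g := Prod.fst) hc continuous_fst hΦ).isClosedMap

/-- A surjective homomorphism from a group with a cocompact lattice to the real line splits. -/
theorem exists_real_section {Y : Type u} [AddCommGroup Y] [TopologicalSpace Y]
    [IsTopologicalAddGroup Y] [LocallyCompactSpace Y] [T2Space Y] (hY : HasCocompactLattice Y)
    (q : Y →ₜ+ ℝ) (hq : Function.Surjective q) : ∃ s : ℝ →ₜ+ Y, ∀ t, q (s t) = t := by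
  obtain ⟨n, v, Φ, -, ⟨C, hC, hvC⟩, hΦv, hΦ⟩ := hY.exists_proper
  let pair : (Fin n → ℝ) → (Y →ₜ+ ℝ) := fun a =>
    ⟨AddMonoidHom.mk' (fun y => ∑ i, a i * Φ y i) fun y z => by
        rw [map_add]
        simp [mul_add, Finset.sum_add_distrib],
      (continuous_finsetSum _ fun i _ =>
        continuous_const.mul ((continuous_apply i).comp (map_continuous Φ)) :
        Continuous fun y => ∑ i, a i * Φ y i)⟩
  have hpair : ∀ a y, pair a y = ∑ i, a i * Φ y i := fun _ _ => rfl
  let l : Fin n → ℝ := fun i => q (v i)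
  have hql : ∀ y, q y = ∑ i, l i * Φ y i := by
    refine real_hom_eq_of_eq_on_lattice hC hvC q (pair l) fun i => ?_
    rw [hpair, hΦv]
    simp [Pi.single_apply, l]
  let ev : (Fin n → ℝ) →+ (Y →ₜ+ UnitAddCircle) := AddMonoidHom.mk' (fun a =>
      ⟨(QuotientAddGroup.mk' (AddSubgroup.zmultiples (1 : ℝ))).comp (pair a : Y →+ ℝ),
        (AddCircle.continuous_mk' 1).comp (map_continuous (pair a))⟩) fun a b => by
    ext y
    change ((pair (a + b) y : ℝ) : UnitAddCircle) = (pair a y : ℝ) + (pair b y : ℝ)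
    rw [← AddCircle.coe_add, hpair, hpair, hpair]
    simp [add_mul, Finset.sum_add_distrib]
  have hev : ∀ a y, ev a y = ((∑ i, a i * Φ y i : ℝ) : UnitAddCircle) := fun _ _ => rfl
  -- Elements of `ev.ker` pair integrally with `Φ y`. If `l` were a real combination of them, `q`
  -- would take only countably many values.
  have hl : l ∉ Submodule.span ℝ (ev.ker : Set (Fin n → ℝ)) := by
    intro hmem
    obtain ⟨k, r, m, hm⟩ := Submodule.mem_span_set'.1 hmem
    refine Cardinal.not_countable_real ((Set.countable_range
      (fun z : Fin k → ℤ => ∑ j, r j * z j)).mono fun t _ => ?_)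
    obtain ⟨y, rfl⟩ := hq t
    have h1 : ∀ j, ∃ z : ℤ, (z : ℝ) = ∑ i, (m j : Fin n → ℝ) i * Φ y i := fun j => by
      have h2 : ev (m j) = 0 := (m j).2
      have h3 := DFunLike.congr_fun h2 y
      rw [hev] at h3
      obtain ⟨z, hz⟩ := (AddCircle.coe_eq_zero_iff 1).1 h3
      exact ⟨z, by simpa using hz⟩
    choose z hz using h1
    refine ⟨z, ?_⟩
    simp only [hz]
    rw [hql, ← hm]
    simp only [Finset.sum_apply, Pi.smul_apply, smul_eq_mul, Finset.sum_mul, Finset.mul_sum]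
    rw [Finset.sum_comm]
    simp only [mul_assoc]
  obtain ⟨Λ₀, hΛ₀l, hΛ₀M⟩ := Submodule.exists_le_ker_of_notMem hl
  let Λ := (Λ₀ l)⁻¹ • Λ₀
  have hΛl : Λ l = 1 := by simp [Λ, hΛ₀l]
  have hΛM : ∀ a, ev a = 0 → Λ a = 0 := fun a ha => by
    have : Λ₀ a = 0 := hΛ₀M (Submodule.subset_span ha)
    simp [Λ, this]
  let w : Fin n → ℝ := fun i => Λ (Pi.single i 1)
  have hw : ∀ a, Λ a = ∑ i, a i * w i := fun a => by
    conv_lhs => rw [← Finset.univ_sum_single a, map_sum]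
    refine Finset.sum_congr rfl fun i _ => ?_
    have : (Pi.single i (a i) : Fin n → ℝ) = a i • Pi.single i 1 := by
      rw [← Pi.single_smul, smul_eq_mul, mul_one]
    rw [this, map_smul, smul_eq_mul]
  -- The functional `Λ` descends to the image of `ev` and extends to all characters of `Y` since `ℝ`
  -- is divisible. By duality, `χ ↦ ρ χ * t mod 1` should be evaluation at the point `s t`.
  obtain ⟨ρ, hρ⟩ := (Module.Baer.of_divisible (A := ℝ)).extension_property_addMonoidHom
    (QuotientAddGroup.kerLift ev) (QuotientAddGroup.kerLift_injective ev)
    (QuotientAddGroup.lift ev.ker Λ.toAddMonoidHom fun a ha => hΛM a ha)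
  replace hρ : ∀ a, ρ (ev a) = Λ a := fun a => DFunLike.congr_fun hρ (a : (Fin n → ℝ) ⧸ ev.ker)
  let ι : Y →+ (Fin n → ℝ) × ((Y →ₜ+ UnitAddCircle) → UnitAddCircle) :=
    AddMonoidHom.mk' (fun y => (Φ y, fun χ => χ y)) fun y z => by
      simp only [map_add]
      rfl
  have hι : IsClosedEmbedding ι := isClosedEmbedding_prod_eval hΦ
  let s₀ : ℝ →+ (Fin n → ℝ) × ((Y →ₜ+ UnitAddCircle) → UnitAddCircle) :=
    AddMonoidHom.mk' (fun t => (fun i => t * w i, fun χ => ((ρ χ * t : ℝ) : UnitAddCircle)))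
      fun t t' => by
        ext i
        · simp [add_mul]
        · simp [mul_add]
  have hs₀ : Continuous s₀ := (continuous_pi fun i => continuous_id.mul continuous_const).prodMk
    (continuous_pi fun χ => (AddCircle.continuous_mk' 1).comp (continuous_const_mul (ρ χ)))
  -- A character vanishing on the closed image of `Y` amounts to a relation between `ev a` and
  -- finitely many characters of `Y`. Applying `ρ` to this relation shows that it vanishes at `s₀ t`
  -- too.
  have hmem : ∀ t, s₀ t ∈ ι.range := by
    intro t
    by_contra hnot
    obtain ⟨Θ, hΘ, hΘt⟩ := exists_character_of_notMem ι.range (by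
      rw [AddMonoidHom.coe_range]; exact hι.isClosed_range) hnot
    obtain ⟨a, ha⟩ := exists_eq_coe_sum_of_character
      ⟨(Θ : (Fin n → ℝ) × ((Y →ₜ+ UnitAddCircle) → UnitAddCircle) →+ UnitAddCircle).comp
          (AddMonoidHom.inl _ _), (map_continuous Θ).comp (Continuous.prodMk_left _)⟩
    obtain ⟨c, hc⟩ := exists_eq_finsuppSum_of_character
      ⟨(Θ : (Fin n → ℝ) × ((Y →ₜ+ UnitAddCircle) → UnitAddCircle) →+ UnitAddCircle).comp
          (AddMonoidHom.inr _ _), (map_continuous Θ).comp (Continuous.prodMk_right _)⟩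
    have hsplit : ∀ x b, Θ (x, b) = ((∑ i, a i * x i : ℝ) : UnitAddCircle) +
        c.sum fun χ m => m • b χ := fun x b => by
      have h1 : ((x, b) : (Fin n → ℝ) × ((Y →ₜ+ UnitAddCircle) → UnitAddCircle)) =
        (x, 0) + (0, b) := by simp
      rw [h1, map_add]
      exact congrArg₂ _ (ha x) (hc b)
    have hrel : ev a + c.sum (fun χ m => m • χ) = 0 := by
      ext y
      have h1 : Θ (ι y) = 0 := hΘ _ ⟨y, rfl⟩
      have h2 : Θ (ι y) = _ := hsplit (Φ y) fun χ => χ y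
      rw [h1] at h2
      let e : (Y →ₜ+ UnitAddCircle) →+ UnitAddCircle := AddMonoidHom.mk' (fun χ => χ y) fun _ _ => rfl
      change e (ev a + c.sum (fun χ m => m • χ)) = 0
      rw [map_add, map_finsuppSum]
      simp only [map_zsmul]
      exact h2.symm
    have hrel' : Λ a + c.sum (fun χ m => m • ρ χ) = 0 := by
      have := congrArg ρ hrel
      rw [map_add, hρ, map_finsuppSum, map_zero] at this
      simpa only [map_zsmul] using this
    apply hΘt
    refine (hsplit _ _).trans ?_
    have h3 : (c.sum fun χ m => m • ((ρ χ * t : ℝ) : UnitAddCircle)) =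
        (((c.sum fun χ m => m • ρ χ) * t : ℝ) : UnitAddCircle) := by
      simp only [Finsupp.sum, Finset.sum_mul]
      refine Eq.trans ?_ (map_sum (QuotientAddGroup.mk' (AddSubgroup.zmultiples (1 : ℝ))) _ _).symm
      refine Finset.sum_congr rfl fun χ _ => ?_
      rw [smul_mul_assoc]
      exact (map_zsmul (QuotientAddGroup.mk' (AddSubgroup.zmultiples (1 : ℝ))) _ _).symm
    have h4 : ∑ i, a i * (t * w i) = Λ a * t := by
      rw [hw, Finset.sum_mul]
      exact Finset.sum_congr rfl fun i _ => by ring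
    rw [h3, h4, ← AddCircle.coe_add, ← add_mul, hrel', zero_mul, AddCircle.coe_zero]
  choose s hs using hmem
  have hsc : Continuous s := by
    rw [hι.isInducing.continuous_iff]
    have : ι ∘ s = s₀ := funext hs
    rwa [this]
  refine ⟨⟨AddMonoidHom.mk' s fun t t' => hι.injective (by
    rw [map_add, hs, hs, hs, map_add]), hsc⟩, fun t => ?_⟩
  change q (s t) = t
  have h5 : Φ (s t) = fun i => t * w i := congrArg Prod.fst (hs t)
  rw [hql, h5]
  have h6 : ∑ i, l i * (t * w i) = Λ l * t := by
    rw [hw, Finset.sum_mul]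
    exact Finset.sum_congr rfl fun i _ => by ring
  rw [h6, hΛl, one_mul]

/-- The real line is projective: one-parameter subgroups lift along open surjections. -/
theorem exists_real_lift {Y : Type u} {Z : Type*} [AddCommGroup Y] [TopologicalSpace Y]
    [IsTopologicalAddGroup Y] [LocallyCompactSpace Y] [T2Space Y]
    [AddCommGroup Z] [TopologicalSpace Z] [IsTopologicalAddGroup Z] [T2Space Z]
    (q : Y →ₜ+ Z) (hqo : IsOpenMap q) (γ : ℝ →ₜ+ Z) :
    ∃ γ' : ℝ →ₜ+ Y, ∀ t, q (γ' t) = γ t := by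
  -- The lift is a section of the fibre product `P = Y ×_Z ℝ` over `ℝ`. The projection to `ℝ` is
  -- open, so an open subgroup with a cocompact lattice still maps onto the connected group `ℝ`.
  let P : AddSubgroup (Y × ℝ) :=
    { carrier := {p | q p.1 = γ p.2}
      zero_mem' := by simp
      add_mem' := fun {a b} ha hb => by
        simp only [mem_ofPred_eq] at ha hb ⊢
        rw [Prod.fst_add, Prod.snd_add, map_add, map_add, ha, hb]
      neg_mem' := fun {a} ha => by
        simp only [mem_ofPred_eq] at ha ⊢
        rw [Prod.fst_neg, Prod.snd_neg, map_neg, map_neg, ha] }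
  have hPmem : ∀ y t, (y, t) ∈ P ↔ q y = γ t := fun _ _ => Iff.rfl
  have hPc : IsClosed (P : Set (Y × ℝ)) :=
    isClosed_eq ((map_continuous q).comp continuous_fst) ((map_continuous γ).comp continuous_snd)
  have : LocallyCompactSpace P := hPc.isClosedEmbedding_subtypeVal.locallyCompactSpace
  have hpo : IsOpenMap fun p : P => (p : Y × ℝ).2 := by
    refine IsOpenMap.of_nhds_le ?_
    rintro ⟨⟨y, t⟩, hyt⟩ U hU
    rw [mem_map, nhds_subtype, mem_comap] at hU
    obtain ⟨V, hV, hVU⟩ := hU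
    obtain ⟨A, hA, B, hB, hAB⟩ := mem_nhds_prod_iff.1 hV
    have h1 : q '' A ∈ 𝓝 (γ t) := by
      rw [← (hPmem y t).1 hyt]
      exact hqo.image_mem_nhds hA
    filter_upwards [hB, (map_continuous γ).continuousAt.preimage_mem_nhds h1] with t' ht' ht''
    obtain ⟨y', hy', hyt'⟩ := ht''
    exact hVU (a := ⟨(y', t'), hyt'⟩) (hAB ⟨hy', ht'⟩)
  obtain ⟨P', hP'o, hP'⟩ := exists_isOpen_hasCocompactLattice P
  have hP'c : IsClosed (P' : Set P) := AddSubgroup.isClosed_of_isOpen _ hP'o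
  have : LocallyCompactSpace P' := hP'c.isClosedEmbedding_subtypeVal.locallyCompactSpace
  let r : P' →ₜ+ ℝ := ⟨((AddMonoidHom.snd Y ℝ).comp P.subtype).comp P'.subtype,
    continuous_snd.comp (continuous_subtype_val.comp continuous_subtype_val)⟩
  have hr : Function.Surjective r := by
    have ho : IsOpen (((r : P' →+ ℝ).range : AddSubgroup ℝ) : Set ℝ) := by
      have h1 := hpo _ hP'o
      convert h1 using 1
      ext t
      constructor
      · rintro ⟨p, rfl⟩
        exact ⟨p, p.2, rfl⟩
      · rintro ⟨p, hp, rfl⟩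
        exact ⟨⟨p, hp⟩, rfl⟩
    have huniv := IsClopen.eq_univ ⟨AddSubgroup.isClosed_of_isOpen _ ho, ho⟩ ⟨0, zero_mem _⟩
    intro t
    have ht : t ∈ (((r : P' →+ ℝ).range : AddSubgroup ℝ) : Set ℝ) := by rw [huniv]; trivial
    exact ht
  obtain ⟨s, hs⟩ := exists_real_section hP' r hr
  refine ⟨⟨(((AddMonoidHom.fst Y ℝ).comp P.subtype).comp P'.subtype).comp (s : ℝ →+ P'),
    continuous_fst.comp (continuous_subtype_val.comp
      (continuous_subtype_val.comp (map_continuous s)))⟩, fun t => ?_⟩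
  have h1 : q ((s t : P) : Y × ℝ).1 = γ ((s t : P) : Y × ℝ).2 := (s t : P).2
  exact h1.trans (congrArg γ (hs t))

end RealProjective

/-! ### The regular trace form of a semisimple algebra -/

section RegularTrace

variable {A : Type*} [Ring A] [Algebra ℚ A]

/-- The trace of the left regular representation. -/
noncomputable def regularTrace (A : Type*) [Ring A] [Algebra ℚ A] : A →ₗ[ℚ] ℚ :=
  LinearMap.trace ℚ A ∘ₗ (Algebra.lmul ℚ A).toLinearMap

lemma regularTrace_apply (a : A) : regularTrace A a = LinearMap.trace ℚ A (Algebra.lmul ℚ A a) := rfl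

lemma regularTrace_mul_comm (a b : A) : regularTrace A (a * b) = regularTrace A (b * a) := by
  rw [regularTrace_apply, regularTrace_apply, map_mul (Algebra.lmul ℚ A), map_mul (Algebra.lmul ℚ A),
    LinearMap.trace_mul_comm]

/-- The regular trace form of a semisimple algebra is nondegenerate. -/
lemma eq_zero_of_forall_regularTrace_mul_eq_zero [FiniteDimensional ℚ A] [IsSemisimpleRing A]
    {x : A} (hx : ∀ y, regularTrace A (x * y) = 0) : x = 0 := by
  let I : Submodule A A :=
    { carrier := {x | ∀ y, regularTrace A (x * y) = 0}
      zero_mem' := fun y => by rw [zero_mul, map_zero]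
      add_mem' := fun {a b} ha hb y => by rw [add_mul, map_add, ha, hb, add_zero]
      smul_mem' := fun a b hb y => by
        rw [smul_eq_mul, mul_assoc, regularTrace_mul_comm, mul_assoc]
        exact hb _ }
  obtain ⟨J, hIJ⟩ := exists_isCompl I
  obtain ⟨e, he, f, hf, hef⟩ := Submodule.mem_sup.1
    (show (1 : A) ∈ I ⊔ J by rw [hIJ.sup_eq_top]; trivial)
  -- The radical `I` of the form is a left ideal, so semisimplicity gives it a right unit `e`. Left
  -- multiplication by the idempotent `e` has trace zero, hence is zero.
  have hmul : ∀ z ∈ I, z * e = z := by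
    intro z hz
    have h1 : z * f = z - z * e := by rw [eq_sub_iff_add_eq', ← mul_add, hef, mul_one]
    have h2 : z * f ∈ I ⊓ J := ⟨by rw [h1]; exact sub_mem hz (I.smul_mem z he), J.smul_mem z hf⟩
    rw [hIJ.inf_eq_bot, Submodule.mem_bot, h1, sub_eq_zero] at h2
    exact h2.symm
  have hidem : IsIdempotentElem (Algebra.lmul ℚ A e) := by
    rw [IsIdempotentElem, ← map_mul, hmul e he]
  have h0 : Algebra.lmul ℚ A e = 0 := by
    refine (LinearMap.IsIdempotentElem.trace_eq_zero_iff hidem).1 ?_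
    have := he 1
    rwa [mul_one] at this
  have he0 : e = 0 := by
    have := LinearMap.congr_fun h0 1
    simpa using this
  rw [← hmul x hx, he0, mul_zero]

/-- A basis and its dual for the regular trace form multiply to a separability element. -/
theorem exists_regularTrace_dualBasis [FiniteDimensional ℚ A] [IsSemisimpleRing A] {ι : Type*}
    [Fintype ι] (e : Module.Basis ι ℚ A) :
    ∃ d : ι → A, (∀ x i, e.repr x i = regularTrace A (d i * x)) ∧ ∑ i, e i * d i = 1 ∧
      ∀ x j, d j * x = ∑ i, e.repr (x * e i) j • d i := by
  classical
  let B : LinearMap.BilinForm ℚ A := (LinearMap.mul ℚ A).compr₂ (regularTrace A)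
  have hBapp : ∀ x y, B x y = regularTrace A (x * y) := fun _ _ => rfl
  have hB : B.Nondegenerate := by
    refine ⟨fun x hx => eq_zero_of_forall_regularTrace_mul_eq_zero hx, fun x hx => ?_⟩
    refine eq_zero_of_forall_regularTrace_mul_eq_zero fun y => ?_
    rw [regularTrace_mul_comm]
    exact hx y
  let d : ι → A := B.dualBasis hB e
  have hd : ∀ i j, regularTrace A (d i * e j) = if j = i then 1 else 0 := fun i j =>
    B.apply_dualBasis_left hB e i j
  have hrepr : ∀ x i, e.repr x i = regularTrace A (d i * x) := by
    intro x i
    conv_rhs => rw [← e.sum_repr x, Finset.mul_sum, map_sum]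
    rw [Finset.sum_eq_single i]
    · rw [mul_smul_comm, map_smul, hd, if_pos rfl, smul_eq_mul, mul_one]
    · intro j _ hj
      rw [mul_smul_comm, map_smul, hd, if_neg hj, smul_zero]
    · simp
  refine ⟨d, hrepr, ?_, fun x j => ?_⟩
  -- Pairing `∑ eᵢ dᵢ` with `a` computes the trace of left multiplication by `a` in the basis `e`,
  -- which is also the pairing of `1` with `a`.
  · rw [← sub_eq_zero]
    refine eq_zero_of_forall_regularTrace_mul_eq_zero fun a => ?_
    rw [sub_mul, one_mul, map_sub, sub_eq_zero, regularTrace_apply a,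
      LinearMap.trace_eq_matrix_trace ℚ e, Matrix.trace, Finset.sum_mul, map_sum]
    refine Finset.sum_congr rfl fun i _ => ?_
    rw [Matrix.diag_apply, LinearMap.toMatrix_apply, Algebra.coe_lmul_eq_mul, LinearMap.mul_apply',
      hrepr, regularTrace_mul_comm (e i * d i), ← mul_assoc, regularTrace_mul_comm (a * e i)]
  · rw [← sub_eq_zero]
    refine eq_zero_of_forall_regularTrace_mul_eq_zero fun y => ?_
    revert y
    suffices h : regularTrace A ∘ₗ LinearMap.mulLeft ℚ (d j * x - ∑ i, e.repr (x * e i) j • d i) = 0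
      from fun y => LinearMap.congr_fun h y
    refine e.ext fun k => ?_
    rw [LinearMap.comp_apply, LinearMap.mulLeft_apply, sub_mul, map_sub, mul_assoc, ← hrepr,
      Finset.sum_mul, map_sum, Finset.sum_eq_single k]
    · rw [smul_mul_assoc, map_smul, hd, if_pos rfl, smul_eq_mul, mul_one, sub_self]
      rfl
    · intro i _ hi
      rw [smul_mul_assoc, map_smul, hd, if_neg hi.symm, smul_zero]
    · simp

end RegularTrace

/-! ### Casimir elements of orders -/

section Orders

variable {A : Type u} [Ring A] [Algebra ℚ A] {𝔄 : Subring A}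

lemma Subring.isTorsionFree_int : Module.IsTorsionFree ℤ 𝔄 :=
  have : IsAddTorsionFree A :=
    have : Module ℚ≥0 A := Module.compHom A (algebraMap ℚ≥0 ℚ)
    .of_module_nnrat A
  Function.Injective.moduleIsTorsionFree ((↑) : 𝔄 → A) Subtype.val_injective (fun _ _ => rfl)

lemma IsOrder.free (h𝔄 : IsOrder 𝔄) : Module.Free ℤ 𝔄 :=
  have := h𝔄.finite
  have := Subring.isTorsionFree_int (𝔄 := 𝔄)
  inferInstance

/-- A `ℤ`-basis of an order is a `ℚ`-basis of the algebra. -/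
lemma IsOrder.exists_basis (h𝔄 : IsOrder 𝔄) {ι : Type*} (e : Module.Basis ι ℤ 𝔄) :
    ∃ e' : Module.Basis ι ℚ A, ∀ i, e' i = e i := by
  have hli : LinearIndependent ℚ (fun i => (e i : A)) := by
    rw [← LinearIndependent.iff_fractionRing ℤ ℚ]
    exact e.linearIndependent.map' (𝔄.subtype.toAddMonoidHom.toIntLinearMap)
      (LinearMap.ker_eq_bot.2 Subtype.val_injective)
  have hsp : ⊤ ≤ Submodule.span ℚ (Set.range fun i => (e i : A)) := by
    rw [← h𝔄.span_eq_top, Submodule.span_le]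
    intro x hx
    have h1 := e.linearCombination_repr ⟨x, hx⟩
    have h2 := congrArg 𝔄.subtype h1
    rw [Finsupp.linearCombination_apply, Finsupp.sum, map_sum] at h2
    have h3 : 𝔄.subtype ⟨x, hx⟩ = x := rfl
    rw [h3] at h2
    rw [← h2]
    refine Submodule.sum_mem _ fun i _ => ?_
    rw [map_zsmul]
    exact zsmul_mem (Submodule.subset_span (Set.mem_range_self (f := fun i => (e i : A)) i)) _
  exact ⟨Module.Basis.mk hli hsp, fun i => by simp⟩

/-- A Casimir element of an order in a semisimple algebra: a multiple of a separability idempotent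
with integral coefficients. -/
theorem IsOrder.exists_casimir [FiniteDimensional ℚ A] [IsSemisimpleRing A] (h𝔄 : IsOrder 𝔄) :
    ∃ (n : ℕ) (c b : Fin n → 𝔄) (N : ℕ), 0 < N ∧ ∑ i, c i * b i = N ∧
      ∀ x : 𝔄, ∃ t : Fin n → Fin n → ℤ, (∀ i, x * c i = ∑ j, t i j • c j) ∧
        ∀ j, b j * x = ∑ i, t i j • b i := by
  have := h𝔄.free
  have := h𝔄.finite
  let c := Module.finBasis ℤ 𝔄
  obtain ⟨e, he⟩ := h𝔄.exists_basis c
  obtain ⟨d, -, hd1, hdx⟩ := exists_regularTrace_dualBasis e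
  obtain ⟨m, hm⟩ := IsLocalization.exist_integer_multiples_of_finite (nonZeroDivisors ℤ)
    (fun p : Fin _ × Fin _ => e.repr (d p.1) p.2)
  choose z hz using hm
  have hm0 : (m : ℤ) ≠ 0 := nonZeroDivisors.coe_ne_zero m
  have hdm : ∀ i, (m : ℤ) • d i = ((∑ j, z (i, j) • c j : 𝔄) : A) := by
    intro i
    conv_lhs => rw [← e.sum_repr (d i), Finset.smul_sum]
    rw [AddSubmonoidClass.coe_finsetSum]
    refine Finset.sum_congr rfl fun j _ => ?_
    rw [← smul_assoc]
    refine (congrArg (· • e j) (hz (i, j)).symm).trans ?_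
    rw [he]
    exact Int.cast_smul_eq_zsmul ℚ _ _
  -- The dual basis has a common denominator `m`; the sign makes `b i` the positive multiple `|m| •
  -- d i`. The structure constants are integral because left multiplication by `x` preserves the
  -- `ℤ`-basis lattice.
  let N : ℕ := (m : ℤ).natAbs
  have hmN : (m : ℤ).sign * m = N := Int.sign_mul_self _
  let b : Fin _ → 𝔄 := fun i => (m : ℤ).sign • ∑ j, z (i, j) • c j
  have hb : ∀ i, (b i : A) = (N : ℤ) • d i := fun i => by
    rw [← hmN, mul_smul, hdm]
    rfl
  refine ⟨_, c, b, N, Int.natAbs_pos.2 hm0, ?_, fun x =>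
    ⟨fun i j => c.repr (x * c i) j, fun i => (c.sum_repr _).symm, fun j => ?_⟩⟩
  · apply Subtype.val_injective
    rw [AddSubmonoidClass.coe_finsetSum]
    simp only [MulMemClass.coe_mul, hb, ← he, mul_smul_comm]
    rw [← Finset.smul_sum, hd1]
    simp
  · apply Subtype.val_injective
    have hrepr : ∀ (y : 𝔄) k, e.repr (y : A) k = c.repr y k := by
      intro y k
      have h1 : (y : A) = ∑ l, (c.repr y l : ℚ) • e l := by
        conv_lhs => rw [← c.sum_repr y, AddSubmonoidClass.coe_finsetSum]
        refine Finset.sum_congr rfl fun l _ => ?_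
        rw [he]
        exact (Int.cast_smul_eq_zsmul ℚ _ _).symm
      rw [h1, e.repr_sum_self]
    rw [AddSubmonoidClass.coe_finsetSum]
    simp only [MulMemClass.coe_mul, hb, smul_mul_assoc, hdx x j, Finset.smul_sum]
    refine Finset.sum_congr rfl fun i _ => ?_
    have h2 : e.repr ((x : A) * e i) j = c.repr (x * c i) j := by
      rw [he, ← hrepr]
      rfl
    rw [h2]
    change _ = c.repr (x * c i) j • (b i : A)
    rw [hb, smul_comm, Int.cast_smul_eq_zsmul]

end Orders

/-! ### The exact structure: closed embeddings and open surjections -/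

namespace LCAMod

variable {R : Type v} [Ring R]

/-- A closed submodule as an object of `LCA_R`. -/
def closedSubmodule (M : LCAMod.{u} R) (S : Submodule Rᵐᵒᵖ M) (hS : IsClosed (S : Set M)) :
    LCAMod.{u} R :=
  have : LocallyCompactSpace S := hS.isClosedEmbedding_subtypeVal.locallyCompactSpace
  have : IsTopologicalAddGroup S := inferInstanceAs (IsTopologicalAddGroup S.toAddSubgroup)
  have : ContinuousConstSMul Rᵐᵒᵖ S :=
    ⟨fun a => (continuous_subtype_val.const_smul a).subtype_mk _⟩
  { carrier := S }

/-- The quotient by a closed submodule as an object of `LCA_R`. -/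
def quotient (M : LCAMod.{u} R) (S : Submodule Rᵐᵒᵖ M) (hS : IsClosed (S : Set M)) :
    LCAMod.{u} R :=
  have : LocallyCompactSpace (M ⧸ S) :=
    inferInstanceAs (LocallyCompactSpace (M ⧸ S.toAddSubgroup))
  have : IsTopologicalAddGroup (M ⧸ S) :=
    inferInstanceAs (IsTopologicalAddGroup (M ⧸ S.toAddSubgroup))
  have : T2Space (M ⧸ S) :=
    have : IsClosed (S.toAddSubgroup : Set M) := hS
    inferInstanceAs (T2Space (M ⧸ S.toAddSubgroup))
  have : ContinuousConstSMul Rᵐᵒᵖ (M ⧸ S) := ⟨fun a =>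
    S.isOpenQuotientMap_mkQ.continuous_comp_iff.1
      (S.isOpenQuotientMap_mkQ.continuous.comp (continuous_const_smul a))⟩
  { carrier := M ⧸ S }

lemma comp_hom_apply {X Y Z : LCAMod.{u} R} (f : X ⟶ Y) (g : Y ⟶ Z) (x : X) :
    (f ≫ g).hom x = g.hom (f.hom x) := rfl

lemma hom_ext_apply {X Y : LCAMod.{u} R} {f g : X ⟶ Y} (h : ∀ x, f.hom x = g.hom x) : f = g :=
  Hom.ext (ContinuousLinearMap.ext h)

/-- Strictly exact sequences are kernel-cokernel pairs. -/
theorem isKernelCokernelPair_of_exact {X Y Z : LCAMod.{u} R} (i : X ⟶ Y) (p : Y ⟶ Z)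
    (hi : IsClosedEmbedding i.hom) (hpo : IsOpenMap p.hom) (hps : Function.Surjective p.hom)
    (hex : ∀ y, p.hom y = 0 ↔ ∃ x, i.hom x = y) : IsKernelCokernelPair i p := by
  have w : i ≫ p = 0 := hom_ext_apply fun x => (hex _).2 ⟨x, rfl⟩
  have hlift : ∀ {W : LCAMod.{u} R} (k : W ⟶ Y), k ≫ p = 0 → ∃ l : W ⟶ X, l ≫ i = k := by
    intro W k hk
    have h1 : ∀ x, ∃ y, i.hom y = k.hom x := fun x =>
      (hex _).1 (congrArg (fun f : W ⟶ Z => f.hom x) hk)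
    choose l hl using h1
    have hlc : Continuous l := hi.isInducing.continuous_iff.2
      (k.hom.continuous.congr fun x => (hl x).symm)
    refine ⟨⟨⟨⟨⟨l, fun a b => hi.injective ?_⟩, fun a b => hi.injective ?_⟩, hlc⟩⟩,
      hom_ext_apply hl⟩
    · rw [map_add, hl, hl, hl, map_add]
    · rw [map_smul, hl, hl, map_smul]; rfl
  have hdesc : ∀ {W : LCAMod.{u} R} (k : Y ⟶ W), i ≫ k = 0 → ∃ l : Z ⟶ W, p ≫ l = k := by
    intro W k hk
    have h0 : ∀ y y', p.hom y = p.hom y' → k.hom y = k.hom y' := by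
      intro y y' h
      obtain ⟨x, hx⟩ := (hex (y - y')).1 (by rw [map_sub, h, sub_self])
      have h2 : k.hom (i.hom x) = 0 := congrArg (fun f : X ⟶ W => f.hom x) hk
      rw [hx, map_sub, sub_eq_zero] at h2
      exact h2
    choose s hs using hps
    have h1 : ∀ y, k.hom (s (p.hom y)) = k.hom y := fun y => h0 _ _ (hs _)
    have hkc : Continuous fun z => k.hom (s z) :=
      (hpo.isQuotientMap p.hom.continuous fun z => ⟨s z, hs z⟩).continuous_iff.2
        (k.hom.continuous.congr fun y => (h1 y).symm)
    refine ⟨⟨⟨⟨⟨fun z => k.hom (s z), fun a b => ?_⟩, fun a b => ?_⟩, hkc⟩⟩, hom_ext_apply h1⟩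
    · rw [← map_add]
      exact h0 _ _ (by rw [hs, map_add, hs, hs])
    · change k.hom (s (a • b)) = a • k.hom (s b)
      rw [← map_smul]
      exact h0 _ _ (by rw [hs, map_smul, hs])
  refine ⟨w, ⟨KernelFork.IsLimit.ofι i w (fun k hk => (hlift k hk).choose)
    (fun k hk => (hlift k hk).choose_spec) (fun k hk m hm => ?_)⟩,
    ⟨CokernelCofork.IsColimit.ofπ p w (fun k hk => (hdesc k hk).choose)
    (fun k hk => (hdesc k hk).choose_spec) (fun k hk m hm => ?_)⟩⟩
  · refine hom_ext_apply fun x => hi.injective ?_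
    rw [← comp_hom_apply, ← comp_hom_apply, hm, (hlift k hk).choose_spec]
  · refine hom_ext_apply fun z => ?_
    obtain ⟨y, rfl⟩ := hps z
    rw [← comp_hom_apply, ← comp_hom_apply, hm, (hdesc k hk).choose_spec]

/-- The quotient by a submodule of a topological module, as a morphism. -/
def quotientMk (M : LCAMod.{u} R) (S : Submodule Rᵐᵒᵖ M) (hS : IsClosed (S : Set M)) :
    M ⟶ M.quotient S hS :=
  ⟨⟨S.mkQ, S.isOpenQuotientMap_mkQ.continuous⟩⟩

/-- The inclusion of a closed submodule, as a morphism. -/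
def closedSubmoduleι (M : LCAMod.{u} R) (S : Submodule Rᵐᵒᵖ M) (hS : IsClosed (S : Set M)) :
    M.closedSubmodule S hS ⟶ M :=
  ⟨⟨S.subtype, continuous_subtype_val⟩⟩

lemma isClosed_ker {Y Z : LCAMod.{u} R} (p : Y ⟶ Z) :
    IsClosed (LinearMap.ker p.hom.toLinearMap : Set Y) :=
  isClosed_eq p.hom.continuous continuous_const

lemma isAdmissibleMonic_of_isClosedEmbedding {X Y : LCAMod.{u} R} (i : X ⟶ Y)
    (hi : IsClosedEmbedding i.hom) : IsAdmissibleMonic i := by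
  have hcl : IsClosed (LinearMap.range i.hom.toLinearMap : Set Y) := hi.isClosed_range
  refine ⟨_, Y.quotientMk _ hcl, isKernelCokernelPair_of_exact _ _ hi
    (Submodule.isOpenQuotientMap_mkQ _).isOpenMap (Submodule.mkQ_surjective _) fun y => ?_⟩
  exact Submodule.Quotient.mk_eq_zero _

lemma isAdmissibleEpic_of_isOpenMap {Y Z : LCAMod.{u} R} (p : Y ⟶ Z)
    (hpo : IsOpenMap p.hom) (hps : Function.Surjective p.hom) : IsAdmissibleEpic p := by
  refine ⟨_, Y.closedSubmoduleι _ (isClosed_ker p), isKernelCokernelPair_of_exact _ _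
    (isClosed_ker p).isClosedEmbedding_subtypeVal hpo hps fun y => ?_⟩
  exact ⟨fun h => ⟨⟨y, h⟩, rfl⟩, fun ⟨x, hx⟩ => hx ▸ x.2⟩

/-- Kernels and cokernels are unique, so `i` is identified with the inclusion of the closed
submodule `ker p`, and `p` with the quotient map by it. -/
lemma isClosedEmbedding_of_isKernelCokernelPair {X Y Z : LCAMod.{u} R} {i : X ⟶ Y} {p : Y ⟶ Z}
    (h : IsKernelCokernelPair i p) :
    IsClosedEmbedding i.hom ∧ IsOpenMap p.hom ∧ Function.Surjective p.hom := by
  obtain ⟨w, ⟨hl⟩, ⟨hc⟩⟩ := h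
  let K := Y.closedSubmodule _ (isClosed_ker p)
  let ι : K ⟶ Y := Y.closedSubmoduleι _ (isClosed_ker p)
  have hι : ι ≫ p = 0 := hom_ext_apply fun x => x.2
  obtain ⟨l, hl'⟩ := KernelFork.IsLimit.lift' hl ι hι
  replace hl' : l ≫ i = ι := hl'
  let m : X ⟶ K := ⟨⟨i.hom.toLinearMap.codRestrict _ fun x =>
    congrArg (fun f : X ⟶ Z => f.hom x) w, i.hom.continuous.subtype_mk _⟩⟩
  have hm : m ≫ ι = i := rfl
  have hml : m ≫ l = 𝟙 X := Fork.IsLimit.hom_ext hl (by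
    change (m ≫ l) ≫ i = 𝟙 X ≫ i
    rw [Category.assoc, hl', hm, Category.id_comp])
  have hlm : ∀ x, m.hom (l.hom x) = x := fun x => Subtype.ext
    (congrArg (fun f : K ⟶ Y => f.hom x) hl')
  have hi : IsClosedEmbedding i.hom := by
    let e : X ≃ₜ K :=
      { toFun := m.hom, invFun := l.hom
        left_inv := fun x => congrArg (fun f : X ⟶ X => f.hom x) hml
        right_inv := hlm
        continuous_toFun := m.hom.continuous
        continuous_invFun := l.hom.continuous }
    exact ((isClosed_ker p).isClosedEmbedding_subtypeVal).comp e.isClosedEmbedding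
  let Q := Y.quotient _ (isClosed_ker p)
  let π : Y ⟶ Q := Y.quotientMk _ (isClosed_ker p)
  have hπ : i ≫ π = 0 := hom_ext_apply fun x =>
    (Submodule.Quotient.mk_eq_zero _).2 (congrArg (fun f : X ⟶ Z => f.hom x) w)
  obtain ⟨d, hd⟩ := CokernelCofork.IsColimit.desc' hc π hπ
  replace hd : p ≫ d = π := hd
  have hq : IsOpenQuotientMap (Submodule.mkQ (LinearMap.ker p.hom.toLinearMap)) :=
    Submodule.isOpenQuotientMap_mkQ _
  let f : Q ⟶ Z := ⟨⟨Submodule.liftQ _ p.hom.toLinearMap le_rfl, hq.continuous_comp_iff.1 p.hom.continuous⟩⟩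
  have hf : π ≫ f = p := rfl
  have hdf : d ≫ f = 𝟙 Z := Cofork.IsColimit.hom_ext hc (by
    change p ≫ d ≫ f = p ≫ 𝟙 Z
    rw [← Category.assoc, hd, hf, Category.comp_id])
  have hfd : ∀ x, d.hom (f.hom x) = x := fun x => by
    obtain ⟨y, rfl⟩ := hq.surjective x
    exact congrArg (fun f : Y ⟶ Q => f.hom y) hd
  let e : Q ≃ₜ Z :=
    { toFun := f.hom, invFun := d.hom
      left_inv := hfd
      right_inv := fun x => congrArg (fun f : Z ⟶ Z => f.hom x) hdf
      continuous_toFun := f.hom.continuous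
      continuous_invFun := d.hom.continuous }
  exact ⟨hi, e.isOpenMap.comp hq.isOpenMap, e.surjective.comp hq.surjective⟩

theorem isExactInjective_iff (G : LCAMod.{u} R) : IsExactInjective G ↔
    ∀ ⦃X Y : LCAMod.{u} R⦄ (i : X ⟶ Y), IsClosedEmbedding i.hom → ∀ f : X ⟶ G,
      ∃ g : Y ⟶ G, i ≫ g = f := by
  refine ⟨fun h X Y i hi => h i (isAdmissibleMonic_of_isClosedEmbedding i hi),
    fun h X Y i ⟨Z, p, hip⟩ => h i (isClosedEmbedding_of_isKernelCokernelPair hip).1⟩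

theorem isExactProjective_iff (G : LCAMod.{u} R) : IsExactProjective G ↔
    ∀ ⦃Y Z : LCAMod.{u} R⦄ (p : Y ⟶ Z), IsOpenMap p.hom → Function.Surjective p.hom →
      ∀ f : G ⟶ Z, ∃ g : G ⟶ Y, g ≫ p = f := by
  refine ⟨fun h Y Z p hpo hps => h p (isAdmissibleEpic_of_isOpenMap p hpo hps),
    fun h Y Z p ⟨X, i, hip⟩ => ?_⟩
  obtain ⟨-, hpo, hps⟩ := isClosedEmbedding_of_isKernelCokernelPair hip
  exact h p hpo hps

end LCAMod

/-! ### Spaces of homomorphisms with the pointwise topology -/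

/-- The group of homomorphisms `P → B` with the topology of pointwise convergence. -/
def HomSpace (P : Type u) (B : Type v) [AddCommGroup P] [AddCommGroup B] : Type (max u v) :=
  P →+ B

namespace HomSpace

variable {P : Type u} {B : Type v} [AddCommGroup P] [AddCommGroup B]

instance : AddCommGroup (HomSpace P B) := inferInstanceAs (AddCommGroup (P →+ B))

instance : FunLike (HomSpace P B) P B := inferInstanceAs (FunLike (P →+ B) P B)

instance : AddMonoidHomClass (HomSpace P B) P B :=
  inferInstanceAs (AddMonoidHomClass (P →+ B) P B)

/-- The underlying function, as a homomorphism to the power of `B`. -/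
def coeHom : HomSpace P B →+ (P → B) where
  toFun f := f
  map_zero' := rfl
  map_add' _ _ := rfl

lemma coeHom_injective : Function.Injective (coeHom : HomSpace P B →+ (P → B)) :=
  DFunLike.coe_injective

lemma add_apply (f g : HomSpace P B) (p : P) : (f + g) p = f p + g p := rfl

section Module

variable {R : Type*} [Ring R] [Module R P]

/-- The right module structure `(f · α) p = f (α p)`. -/
instance : Module Rᵐᵒᵖ (HomSpace P B) where
  smul α f := AddMonoidHom.comp (f : P →+ B) (DistribSMul.toAddMonoidHom P α.unop)
  one_smul f := DFunLike.ext _ _ fun p => congrArg f (one_smul R p)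
  mul_smul α β f := DFunLike.ext _ _ fun p => congrArg f (mul_smul β.unop α.unop p)
  smul_zero _ := rfl
  smul_add _ _ _ := rfl
  add_smul α β f := DFunLike.ext _ _ fun p =>
    (congrArg f (add_smul α.unop β.unop p)).trans (map_add f _ _)
  zero_smul f := DFunLike.ext _ _ fun p => (congrArg f (zero_smul R p)).trans (map_zero f)

end Module

variable [TopologicalSpace B]

instance : TopologicalSpace (HomSpace P B) := .induced coeHom inferInstance

lemma isEmbedding_coeHom : IsEmbedding (coeHom : HomSpace P B →+ (P → B)) :=
  ⟨⟨rfl⟩, coeHom_injective⟩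

lemma continuous_apply (p : P) : Continuous fun f : HomSpace P B => f p :=
  (_root_.continuous_apply p).comp isEmbedding_coeHom.continuous

lemma continuous_iff {X : Type*} [TopologicalSpace X] {f : X → HomSpace P B} :
    Continuous f ↔ ∀ p, Continuous fun x => f x p := by
  rw [isEmbedding_coeHom.isInducing.continuous_iff, continuous_pi_iff]
  rfl

instance [T2Space B] : T2Space (HomSpace P B) := isEmbedding_coeHom.t2Space

instance [IsTopologicalAddGroup B] : IsTopologicalAddGroup (HomSpace P B) :=
  topologicalAddGroup_induced coeHom

instance {R : Type*} [Ring R] [Module R P] : ContinuousConstSMul Rᵐᵒᵖ (HomSpace P B) :=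
  ⟨fun α => continuous_iff.2 fun p => continuous_apply (α.unop • p)⟩

lemma isClosedEmbedding_coeHom [T2Space B] [ContinuousAdd B] :
    IsClosedEmbedding (coeHom : HomSpace P B →+ (P → B)) := by
  refine ⟨isEmbedding_coeHom, ?_⟩
  have h : Set.range (coeHom : HomSpace P B →+ (P → B)) =
      ⋂ p, ⋂ q, {f | f (p + q) = f p + f q} := by
    ext f
    simp only [Set.mem_range, Set.mem_iInter]
    constructor
    · rintro ⟨g, rfl⟩ p q
      exact map_add g p q
    · exact fun h => ⟨AddMonoidHom.mk' f h, rfl⟩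
  rw [h]
  exact isClosed_iInter fun p => isClosed_iInter fun q =>
    isClosed_eq (_root_.continuous_apply _)
      (by fun_prop : Continuous fun f : P → B => f p + f q)

instance [T2Space B] [ContinuousAdd B] [CompactSpace B] : CompactSpace (HomSpace P B) :=
  isClosedEmbedding_coeHom.compactSpace

/-- Homomorphisms from a finite free group are given by their values on a basis. -/
noncomputable def homeomorphOfBasis [IsTopologicalAddGroup B] {ι : Type*} [Fintype ι]
    (e : Module.Basis ι ℤ P) : HomSpace P B ≃ₜ (ι → B) where
  toFun f i := f (e i)
  invFun b := AddMonoidHom.mk' (fun p => ∑ i, e.repr p i • b i) fun p q => by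
    simp only [map_add, Finsupp.add_apply, add_smul, Finset.sum_add_distrib]
  left_inv f := DFunLike.ext _ _ fun p => by
    change ∑ i, e.repr p i • f (e i) = f p
    conv_rhs => rw [← e.sum_repr p, map_sum]
    simp only [map_zsmul]
  right_inv b := funext fun i => by
    classical
    change ∑ j, e.repr (e i) j • b j = b i
    rw [Finset.sum_eq_single i]
    · simp
    · intro j _ hj
      simp [hj.symm]
    · simp
  continuous_toFun := continuous_pi fun i => continuous_apply (e i)
  continuous_invFun := continuous_iff.2 fun p => continuous_finsetSum _ fun i _ =>
    (continuous_zsmul _).comp (_root_.continuous_apply i)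

/-- Every character of `Hom(P, ℝ/ℤ)` is the evaluation at an element of `P`. -/
theorem exists_eq_eval (Θ : HomSpace P UnitAddCircle →ₜ+ UnitAddCircle) :
    ∃ p : P, ∀ f : HomSpace P UnitAddCircle, Θ f = f p := by
  -- The character extends to the full power of the circle, where it is a finite integral
  -- combination of coordinates; the same combination taken in `P` is the required element.
  obtain ⟨ψ, hψ⟩ : ∃ ψ : (P → UnitAddCircle) →ₜ+ UnitAddCircle,
      ∀ f : HomSpace P UnitAddCircle, ψ (coeHom f) = Θ f :=
    exists_character_extension coeHom isClosedEmbedding_coeHom Θ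
  obtain ⟨c, hc⟩ := exists_eq_finsuppSum_of_character ψ
  refine ⟨c.sum fun p n => n • p, fun f => ?_⟩
  rw [← hψ, hc, map_finsuppSum]
  simp only [map_zsmul]
  rfl

end HomSpace

/-! ### Pontryagin duality for compact modules -/

namespace LCAMod

variable {R : Type v} [Ring R]

/-- The compact module `Hom(P, ℝ/ℤ)`. -/
def circleHom (R : Type v) [Ring R] (P : Type u) [AddCommGroup P] [Module R P] : LCAMod.{u} R where
  carrier := HomSpace P UnitAddCircle

instance (P : Type u) [AddCommGroup P] [Module R P] :
    FunLike (circleHom R P) P UnitAddCircle :=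
  inferInstanceAs (FunLike (HomSpace P UnitAddCircle) P UnitAddCircle)

instance (P : Type u) [AddCommGroup P] [Module R P] :
    AddMonoidHomClass (circleHom R P) P UnitAddCircle :=
  inferInstanceAs (AddMonoidHomClass (HomSpace P UnitAddCircle) P UnitAddCircle)

/-- The vector module `Hom(P, ℝ)` for a finite free group `P`. -/
noncomputable def realHom (R : Type v) [Ring R] (P : Type u) [AddCommGroup P] [Module R P]
    {ι : Type*} [Fintype ι] (e : Module.Basis ι ℤ P) : LCAMod.{u} R :=
  have : LocallyCompactSpace (HomSpace P ℝ) :=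
    (HomSpace.homeomorphOfBasis e).isClosedEmbedding.locallyCompactSpace
  { carrier := HomSpace P ℝ }

instance (P : Type u) [AddCommGroup P] [Module R P] {ι : Type*} [Fintype ι]
    (e : Module.Basis ι ℤ P) : FunLike (realHom R P e) P ℝ :=
  inferInstanceAs (FunLike (HomSpace P ℝ) P ℝ)

lemma Dual.ext_apply {M : LCAMod.{u} R} {φ ψ : M.Dual} (h : ∀ m, φ m = ψ m) : φ = ψ :=
  DFunLike.ext _ _ h

lemma Dual.continuous {M : LCAMod.{u} R} (φ : M.Dual) : Continuous φ :=
  ContinuousAddMonoidHom.continuous_toFun φ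

/-- Restriction of characters along a morphism. -/
noncomputable def dualMap {X Y : LCAMod.{u} R} (i : X ⟶ Y) : Y.Dual →ₗ[R] X.Dual where
  toFun ψ := ⟨(ψ : Y →+ UnitAddCircle).comp (i.hom : X →+ Y), (Dual.continuous ψ).comp i.hom.continuous⟩
  map_add' _ _ := rfl
  map_smul' α ψ := Dual.ext_apply fun x => by
    change ψ (MulOpposite.op α • i.hom x) = ψ (i.hom (MulOpposite.op α • x))
    exact congrArg ψ (map_smul i.hom _ x).symm

lemma dualMap_surjective {X Y : LCAMod.{u} R} (i : X ⟶ Y) (hi : IsClosedEmbedding i.hom) :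
    Function.Surjective (dualMap i) := by
  intro χ
  obtain ⟨ψ, hψ⟩ := exists_character_extension (i.hom : X →+ Y) hi χ
  exact ⟨ψ, Dual.ext_apply hψ⟩

/-- Morphisms to `Hom(P, ℝ/ℤ)` from linear maps to the dual. -/
noncomputable def toCircleHom {X : LCAMod.{u} R} {P : Type u} [AddCommGroup P] [Module R P]
    (φ : P →ₗ[R] X.Dual) : X ⟶ circleHom R P :=
  ⟨{ toFun := fun x => (AddMonoidHom.mk' (fun p => φ p x) fun p q => by
      rw [map_add]; rfl : P →+ UnitAddCircle)
     map_add' := fun x y => DFunLike.ext (F := circleHom R P) _ _ fun p => map_add (φ p) x y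
     map_smul' := fun α x => DFunLike.ext (F := circleHom R P) _ _ fun p => by
      change φ p (α • x) = φ (α.unop • p) x
      exact (DFunLike.congr_fun (map_smul φ α.unop p) x).symm
     cont := HomSpace.continuous_iff.2 fun p => Dual.continuous (φ p) }⟩

/-- The transpose of a morphism to `Hom(P, ℝ/ℤ)`. -/
noncomputable def ofCircleHom {X : LCAMod.{u} R} {P : Type u} [AddCommGroup P] [Module R P]
    (f : X ⟶ circleHom R P) : P →ₗ[R] X.Dual where
  toFun p := ⟨AddMonoidHom.mk' (fun x => (f.hom x) p) fun x y => by
      rw [map_add]; rfl,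
    (HomSpace.continuous_apply p).comp f.hom.continuous⟩
  map_add' p q := Dual.ext_apply fun x => map_add (f.hom x) p q
  map_smul' α p := Dual.ext_apply fun x => by
    change (f.hom x) (α • p) =
      (f.hom (MulOpposite.op α • x)) p
    exact (DFunLike.congr_fun (F := circleHom R P) (map_smul f.hom (MulOpposite.op α) x) p).symm

/-- `Hom(P, ℝ/ℤ)` is injective if `P` is projective. -/
theorem isExactInjective_circleHom (P : Type u) [AddCommGroup P] [Module R P]
    [Module.Projective R P] : IsExactInjective (circleHom R P) := by
  rw [isExactInjective_iff]
  intro X Y i hi f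
  obtain ⟨ψ, hψ⟩ := Module.projective_lifting_property (dualMap i) (ofCircleHom f)
    (dualMap_surjective i hi)
  refine ⟨toCircleHom ψ, hom_ext_apply fun x => DFunLike.ext (F := HomSpace P UnitAddCircle) _ _
    fun p => ?_⟩
  exact DFunLike.congr_fun (LinearMap.congr_fun hψ p) x

/-- The evaluation morphism `M → Hom(M^∨, ℝ/ℤ)`. -/
noncomputable def evalDual (M : LCAMod.{u} R) : M ⟶ circleHom R M.Dual :=
  toCircleHom LinearMap.id

lemma evalDual_injective (M : LCAMod.{u} R) : Function.Injective (evalDual M).hom := by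
  intro x y hxy
  by_contra hne
  obtain ⟨χ, hχ⟩ := exists_character_ne_zero (sub_ne_zero.2 hne)
  refine hχ ?_
  rw [map_sub, sub_eq_zero]
  exact DFunLike.congr_fun (F := HomSpace M.Dual UnitAddCircle) hxy χ

/-- Pontryagin duality for compact modules. -/
theorem evalDual_bijective (M : LCAMod.{u} R) [CompactSpace M] :
    Function.Bijective (evalDual M).hom := by
  refine ⟨evalDual_injective M, fun f => ?_⟩
  by_contra hf
  have hcl : IsClosed (((evalDual M).hom : M →+ circleHom R M.Dual).range :
      Set (circleHom R M.Dual)) := by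
    rw [AddMonoidHom.coe_range]
    exact (isCompact_range (evalDual M).hom.continuous).isClosed
  -- A character vanishing on the image of `M` is evaluation at some `χ`, and this `χ` vanishes on
  -- `M`, hence is zero.
  obtain ⟨Θ, hΘ, hΘf⟩ := exists_character_of_notMem _ hcl (y := f) hf
  obtain ⟨χ, hχ⟩ := HomSpace.exists_eq_eval (P := M.Dual) Θ
  have h0 : χ = 0 := Dual.ext_apply fun m => by
    have := hΘ _ ⟨m, rfl⟩
    exact (hχ _).symm.trans this
  apply hΘf
  refine (hχ f).trans ?_
  rw [h0]
  exact map_zero (f : HomSpace M.Dual UnitAddCircle)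

end LCAMod

/-! ### Averaging; vector modules are injective and projective -/

/-- The ring has a Casimir element `∑ cᵢ ⊗ bᵢ` whose image in the ring is a positive integer. -/
def HasCasimir (R : Type*) [Ring R] : Prop :=
  ∃ (n : ℕ) (c b : Fin n → R) (N : ℕ), 0 < N ∧ ∑ i, c i * b i = N ∧
    ∀ x, ∃ t : Fin n → Fin n → ℤ, (∀ i, x * c i = ∑ j, t i j • c j) ∧
      ∀ j, b j * x = ∑ i, t i j • b i

namespace LCAMod

variable {R : Type v} [Ring R]

/-- Averaging a continuous homomorphism over a Casimir element. -/
theorem exists_average (hR : HasCasimir R) : ∃ N : ℕ, 0 < N ∧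
    ∀ (M M' : LCAMod.{u} R) (h : M →ₜ+ M'), ∃ g : M ⟶ M',
      (∀ (X : LCAMod.{u} R) (i : X ⟶ M) (f : X ⟶ M'), (∀ x, h (i.hom x) = f.hom x) →
        ∀ x, g.hom (i.hom x) = N • f.hom x) ∧
      ∀ (Z : LCAMod.{u} R) (p : M' ⟶ Z) (f : M ⟶ Z), (∀ m, p.hom (h m) = f.hom m) →
        ∀ m, p.hom (g.hom m) = N • f.hom m := by
  obtain ⟨n, c, b, N, hN, hsum, hcas⟩ := hR
  refine ⟨N, hN, fun M M' h => ?_⟩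
  have hlin : ∀ {A B : LCAMod.{u} R} (f : A ⟶ B) (x : A),
      ∑ i, MulOpposite.op (b i) • f.hom (MulOpposite.op (c i) • x) = N • f.hom x := by
    intro A B f x
    simp only [map_smul, smul_smul, ← MulOpposite.op_mul]
    rw [← Finset.sum_smul, ← Finset.op_sum, hsum, MulOpposite.op_natCast, Nat.cast_smul_eq_nsmul]
  let g : M → M' := fun m => ∑ i, MulOpposite.op (b i) • h (MulOpposite.op (c i) • m)
  have hg : Continuous g := continuous_finsetSum _ fun i _ =>
    ((map_continuous h).comp (continuous_const_smul (MulOpposite.op (c i)))).const_smul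
      (MulOpposite.op (b i))
  have hadd : ∀ x y, g (x + y) = g x + g y := fun x y => by
    simp only [g, smul_add, map_add, Finset.sum_add_distrib]
  -- Moving `a` past the `c i` produces the same integers `t i j` as moving it past the `b j`, and
  -- `h` commutes with integers.
  have hsmul : ∀ (a : Rᵐᵒᵖ) x, g (a • x) = a • g x := fun a x => by
    obtain ⟨t, ht, ht'⟩ := hcas a.unop
    have h1 : ∀ i, MulOpposite.op (c i) • a • x = ∑ j, t i j • MulOpposite.op (c j) • x := by
      intro i
      conv_lhs => rw [← MulOpposite.op_unop a, smul_smul, ← MulOpposite.op_mul, ht i,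
        Finset.op_sum, Finset.sum_smul]
      simp only [MulOpposite.op_smul, smul_assoc]
    have h2 : ∀ j (y : M'), a • MulOpposite.op (b j) • y = ∑ i, t i j • MulOpposite.op (b i) • y := by
      intro j y
      conv_lhs => rw [← MulOpposite.op_unop a, smul_smul, ← MulOpposite.op_mul, ht' j,
        Finset.op_sum, Finset.sum_smul]
      simp only [MulOpposite.op_smul, smul_assoc]
    simp only [g, h1, map_sum, map_zsmul, Finset.smul_sum, h2]
    rw [Finset.sum_comm]
    refine Finset.sum_congr rfl fun i _ => Finset.sum_congr rfl fun j _ => ?_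
    rw [smul_comm]
  refine ⟨⟨⟨⟨⟨g, hadd⟩, hsmul⟩, hg⟩⟩, fun X i f hf x => ?_, fun Z p f hf m => ?_⟩
  · change ∑ k, MulOpposite.op (b k) • h (MulOpposite.op (c k) • i.hom x) = _
    simp only [← map_smul i.hom, hf, hlin]
  · change p.hom (∑ k, MulOpposite.op (b k) • h (MulOpposite.op (c k) • m)) = _
    simp only [map_sum, map_smul p.hom, hf, hlin]

/-- Division by `N` is continuous in real coordinates, and linear over the ring because it is
unique. It cancels the factor left by averaging. -/
lemma IsVectorModule.exists_div {V : LCAMod.{u} R} (hV : V.IsVectorModule) {N : ℕ} (hN : 0 < N) :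
    ∃ d : V ⟶ V, ∀ v, d.hom (N • v) = v := by
  obtain ⟨n, ⟨e⟩⟩ := hV
  have hN' : (N : ℝ) ≠ 0 := Nat.cast_ne_zero.2 hN.ne'
  let d : V → V := fun v => e.symm ((N : ℝ)⁻¹ • e v)
  have hd : ∀ v, N • d v = v := fun v => e.injective (by
    rw [map_nsmul, e.apply_symm_apply, ← Nat.cast_smul_eq_nsmul ℝ, smul_smul, mul_inv_cancel₀ hN',
      one_smul])
  have hinj : ∀ v w : V, N • v = N • w → v = w := fun v w h => e.injective (by
    have h1 := congrArg e h
    rw [map_nsmul, map_nsmul, ← Nat.cast_smul_eq_nsmul ℝ, ← Nat.cast_smul_eq_nsmul ℝ] at h1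
    exact smul_right_injective _ hN' h1)
  refine ⟨⟨⟨⟨⟨d, fun v w => hinj _ _ ?_⟩, fun a v => hinj _ _ ?_⟩, ?_⟩⟩, fun v => hinj _ _ (hd _)⟩
  · rw [smul_add, hd, hd, hd]
  · change N • d (a • v) = N • a • d v
    rw [smul_comm N a, hd, hd]
  · exact e.symm.continuous.comp ((continuous_const_smul _).comp e.continuous)

/-- Vector modules are injective. -/
theorem IsVectorModule.isExactInjective (hR : HasCasimir R) {V : LCAMod.{u} R}
    (hV : V.IsVectorModule) : IsExactInjective V := by
  rw [isExactInjective_iff]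
  intro X Y i hi f
  obtain ⟨N, hN, hav⟩ := exists_average.{u} hR
  obtain ⟨d, hd⟩ := hV.exists_div hN
  obtain ⟨n, ⟨e⟩⟩ := hV
  have h1 : ∀ k, ∃ F : Y →ₜ+ ℝ, ∀ x, F (i.hom x) = e (f.hom x) k := fun k =>
    exists_real_extension (i.hom : X →+ Y) hi
      ⟨((Pi.evalAddMonoidHom (fun _ : Fin n => ℝ) k).comp (e : V →+ (Fin n → ℝ))).comp
        (f.hom : X →+ V), (continuous_apply k).comp (e.continuous.comp f.hom.continuous)⟩
  choose F hF using h1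
  -- The coordinatewise extension is only additive; averaging makes it linear, and it then restricts
  -- to `N • f`.
  obtain ⟨g, hg, -⟩ := hav Y V
    ⟨(e.symm : (Fin n → ℝ) →+ V).comp (AddMonoidHom.pi fun k => (F k : Y →+ ℝ)),
      e.symm.continuous.comp (continuous_pi fun k => map_continuous (F k))⟩
  refine ⟨g ≫ d, hom_ext_apply fun x => ?_⟩
  rw [comp_hom_apply, comp_hom_apply, hg X i f fun x => ?_, hd]
  exact (congrArg e.symm (funext fun k => hF k x)).trans (e.symm_apply_apply _)

/-- Vector modules are projective. -/
theorem IsVectorModule.isExactProjective (hR : HasCasimir R) {V : LCAMod.{u} R}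
    (hV : V.IsVectorModule) : IsExactProjective V := by
  rw [isExactProjective_iff]
  intro Y Z p hpo hps f
  obtain ⟨N, hN, hav⟩ := exists_average.{u} hR
  obtain ⟨d, hd⟩ := hV.exists_div hN
  obtain ⟨n, ⟨e⟩⟩ := hV
  have h1 : ∀ k, ∃ γ : ℝ →ₜ+ Y, ∀ t, p.hom (γ t) = f.hom (e.symm (Pi.single k t)) := fun k =>
    exists_real_lift ⟨(p.hom : Y →+ Z), p.hom.continuous⟩ hpo
      ⟨((f.hom : V →+ Z).comp (e.symm : (Fin n → ℝ) →+ V)).comp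
        (AddMonoidHom.single (fun _ : Fin n => ℝ) k),
        (f.hom.continuous.comp e.symm.continuous).comp
          (continuous_single (A := fun _ : Fin n => ℝ) k)⟩
  choose γ hγ using h1
  obtain ⟨g, -, hg⟩ := hav V Y
    ⟨AddMonoidHom.mk' (fun v => ∑ k, γ k (e v k)) fun v w => by
        simp only [map_add, Pi.add_apply, Finset.sum_add_distrib],
      (continuous_finsetSum _ fun k _ => (map_continuous (γ k)).comp
        ((continuous_apply k).comp e.continuous) : Continuous fun v => ∑ k, γ k (e v k))⟩
  refine ⟨d ≫ g, hom_ext_apply fun v => ?_⟩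
  rw [comp_hom_apply, comp_hom_apply, hg Z p f fun v => ?_, ← map_nsmul, ← map_nsmul, hd]
  change p.hom (∑ k, γ k (e v k)) = f.hom v
  simp only [map_sum, hγ]
  rw [← map_sum, ← map_sum, Finset.univ_sum_single, e.symm_apply_apply]

/-- The inclusion of the first summand. -/
def inl (M N : LCAMod.{u} R) : M ⟶ M.directSum N := ⟨ContinuousLinearMap.inl Rᵐᵒᵖ M N⟩

/-- The inclusion of the second summand. -/
def inr (M N : LCAMod.{u} R) : N ⟶ M.directSum N := ⟨ContinuousLinearMap.inr Rᵐᵒᵖ M N⟩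

/-- The projection to the first summand. -/
def fst (M N : LCAMod.{u} R) : M.directSum N ⟶ M := ⟨ContinuousLinearMap.fst Rᵐᵒᵖ M N⟩

/-- The projection to the second summand. -/
def snd (M N : LCAMod.{u} R) : M.directSum N ⟶ N := ⟨ContinuousLinearMap.snd Rᵐᵒᵖ M N⟩

lemma isExactInjective_directSum {M N : LCAMod.{u} R} (hM : IsExactInjective M)
    (hN : IsExactInjective N) : IsExactInjective (M.directSum N) := by
  intro X Y i hi f
  obtain ⟨g, hg⟩ := hM i hi (f ≫ fst M N)
  obtain ⟨g', hg'⟩ := hN i hi (f ≫ snd M N)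
  refine ⟨⟨g.hom.prod g'.hom⟩, hom_ext_apply fun x => ?_⟩
  exact Prod.ext (congrArg (fun k : X ⟶ M => k.hom x) hg)
    (congrArg (fun k : X ⟶ N => k.hom x) hg')

lemma isExactProjective_directSum {M N : LCAMod.{u} R} (hM : IsExactProjective M)
    (hN : IsExactProjective N) : IsExactProjective (M.directSum N) := by
  intro Y Z p hp f
  obtain ⟨g, hg⟩ := hM p hp (inl M N ≫ f)
  obtain ⟨g', hg'⟩ := hN p hp (inr M N ≫ f)
  refine ⟨⟨g.hom.coprod g'.hom⟩, hom_ext_apply fun x => ?_⟩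
  change p.hom (g.hom x.1 + g'.hom x.2) = f.hom x
  have h1 : p.hom (g.hom x.1) = f.hom ((x.1, 0) : M × N) :=
    congrArg (fun k : M ⟶ Z => k.hom x.1) hg
  have h2 : p.hom (g'.hom x.2) = f.hom ((0, x.2) : M × N) :=
    congrArg (fun k : N ⟶ Z => k.hom x.2) hg'
  rw [map_add, h1, h2]
  exact (map_add f.hom _ _).symm.trans (congrArg f.hom (Prod.fst_add_snd x))

end LCAMod

/-! ### Retracts and direct sum decompositions -/

section Retract

variable {C : Type u} [Category.{v} C] [HasZeroMorphisms C]

lemma IsExactInjective.of_retract {G H : C} (hG : IsExactInjective G) (s : H ⟶ G) (r : G ⟶ H)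
    (h : s ≫ r = 𝟙 H) : IsExactInjective H := by
  intro X Y i hi f
  obtain ⟨g, hg⟩ := hG i hi (f ≫ s)
  exact ⟨g ≫ r, by rw [← Category.assoc, hg, Category.assoc, h, Category.comp_id]⟩

lemma IsExactProjective.of_retract {G H : C} (hG : IsExactProjective G) (s : H ⟶ G) (r : G ⟶ H)
    (h : s ≫ r = 𝟙 H) : IsExactProjective H := by
  intro Y Z p hp f
  obtain ⟨g, hg⟩ := hG p hp (r ≫ f)
  exact ⟨s ≫ g, by rw [Category.assoc, hg, ← Category.assoc, h, Category.id_comp]⟩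

end Retract

namespace LCAMod

variable {R : Type v} [Ring R]

/-- A retraction decomposes an object as the direct sum of the retract and the kernel. -/
def isoDirectSumOfRetract {G V : LCAMod.{u} R} (s : V ⟶ G) (r : G ⟶ V) (h : s ≫ r = 𝟙 V) :
    G ≅ V.directSum (G.closedSubmodule _ (isClosed_ker r)) :=
  have hr : ∀ v, r.hom (s.hom v) = v := fun v => congrArg (fun k : V ⟶ V => k.hom v) h
  { hom := ⟨r.hom.prod (((ContinuousLinearMap.id Rᵐᵒᵖ G) - s.hom.comp r.hom).codRestrict
      (LinearMap.ker r.hom.toLinearMap) fun x => by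
        change r.hom (x - s.hom (r.hom x)) = 0
        rw [map_sub, hr, sub_self])⟩
    inv := ⟨s.hom.coprod (G.closedSubmoduleι _ (isClosed_ker r)).hom⟩
    hom_inv_id := hom_ext_apply fun x => by
      change s.hom (r.hom x) + (x - s.hom (r.hom x)) = x
      abel
    inv_hom_id := hom_ext_apply fun x => by
      have hx : r.hom (s.hom x.1 + x.2.1) = x.1 := by
        rw [map_add, hr, show r.hom x.2.1 = 0 from x.2.2, add_zero]
      refine Prod.ext hx (Subtype.ext ?_)
      change s.hom x.1 + x.2.1 - s.hom (r.hom (s.hom x.1 + x.2.1)) = x.2.1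
      rw [hx]
      abel }

end LCAMod

/-! ### Compact injective objects and one-parameter subgroups -/

namespace LCAMod

section

variable {R : Type v} [Ring R]

/-- The inverse of a morphism that is a homeomorphism. -/
lemma exists_inverse {X Y : LCAMod.{u} R} (f : X ⟶ Y) (hf : IsHomeomorph f.hom) :
    ∃ g : Y ⟶ X, f ≫ g = 𝟙 X ∧ g ≫ f = 𝟙 Y := by
  let e := hf.homeomorph
  have he : ∀ y, f.hom (e.symm y) = y := e.apply_symm_apply
  refine ⟨⟨⟨⟨⟨e.symm, fun a b => hf.injective ?_⟩, fun a b => hf.injective ?_⟩,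
    e.symm.continuous⟩⟩, hom_ext_apply e.symm_apply_apply, hom_ext_apply he⟩
  · rw [map_add f.hom, he, he, he]
  · rw [map_smul f.hom, he, he]; rfl

/-- Compact modules with projective dual are injective. -/
theorem isExactInjective_of_projective_dual (I : LCAMod.{u} R) [CompactSpace I]
    [Module.Projective R I.Dual] : IsExactInjective I := by
  have hb := evalDual_bijective I
  obtain ⟨g, hg, -⟩ := exists_inverse (evalDual I) (isHomeomorph_iff_isEmbedding_surjective.2
    ⟨((evalDual I).hom.continuous.isClosedEmbedding hb.1).isEmbedding, hb.2⟩)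
  exact (isExactInjective_circleHom I.Dual).of_retract (evalDual I) g hg

/-- A module with discrete topology. -/
def discrete (R : Type v) [Ring R] (P : Type u) [AddCommGroup P] [Module Rᵐᵒᵖ P] : LCAMod.{u} R :=
  let _ : TopologicalSpace P := ⊥
  have : DiscreteTopology P := ⟨rfl⟩
  have : ContinuousConstSMul Rᵐᵒᵖ P := ⟨fun _ => continuous_of_discreteTopology⟩
  { carrier := P }

instance (P : Type u) [AddCommGroup P] [Module Rᵐᵒᵖ P] : DiscreteTopology (discrete R P) := ⟨rfl⟩

/-- Morphisms from a discrete module. -/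
def ofDiscrete {P : Type u} [AddCommGroup P] [Module Rᵐᵒᵖ P] {G : LCAMod.{u} R}
    (f : P →ₗ[Rᵐᵒᵖ] G) : discrete R P ⟶ G :=
  ⟨⟨f, continuous_of_discreteTopology (α := discrete R P)⟩⟩

lemma exists_addMonoidHom_circle_ne_zero {F : Type u} [AddCommGroup F] {p : F} (hp : p ≠ 0) :
    ∃ f : F →+ UnitAddCircle, f p ≠ 0 := by
  let _ : TopologicalSpace F := ⊥
  have : DiscreteTopology F := ⟨rfl⟩
  obtain ⟨χ, hχ⟩ := exists_character_ne_zero hp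
  exact ⟨χ, hχ⟩

end

section

variable {R : Type u} [Ring R]

/-- The dual of a compact injective module is projective. -/
theorem projective_dual_of_isExactInjective (K : LCAMod.{u} R) [CompactSpace K]
    (hK : IsExactInjective K) : Module.Projective R K.Dual := by
  let π : (K.Dual →₀ R) →ₗ[R] K.Dual := Finsupp.linearCombination R id
  have hπ : Function.Surjective π := Finsupp.linearCombination_id_surjective R _
  -- A free cover of the dual embeds `K` in a circle-valued Hom. A retraction of this embedding
  -- transposes, by the description of characters as evaluations, to a section of the cover.
  let i : K ⟶ circleHom R (K.Dual →₀ R) := toCircleHom π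
  have hinj : Function.Injective i.hom := fun x y hxy => evalDual_injective K
    (DFunLike.ext (F := circleHom R K.Dual) _ _ fun χ => by
      obtain ⟨p, rfl⟩ := hπ χ
      exact DFunLike.congr_fun (F := circleHom R (K.Dual →₀ R)) hxy p)
  obtain ⟨r, hr⟩ := (isExactInjective_iff K).1 hK i
    (i.hom.continuous.isClosedEmbedding hinj) (𝟙 K)
  have hr' : ∀ k, r.hom (i.hom k) = k := fun k => congrArg (fun f : K ⟶ K => f.hom k) hr
  have h1 : ∀ χ : K.Dual, ∃ p : K.Dual →₀ R, ∀ f : circleHom R (K.Dual →₀ R),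
      χ (r.hom f) = f p := fun χ =>
    HomSpace.exists_eq_eval (P := K.Dual →₀ R)
      ⟨(χ : K →+ UnitAddCircle).comp (r.hom : circleHom R (K.Dual →₀ R) →+ K),
        (Dual.continuous χ).comp r.hom.continuous⟩
  choose s hs using h1
  have huniq : ∀ p q : K.Dual →₀ R, (∀ f : circleHom R (K.Dual →₀ R), f p = f q) → p = q := by
    intro p q h
    by_contra hne
    obtain ⟨f, hf⟩ := exists_addMonoidHom_circle_ne_zero (sub_ne_zero.2 hne)
    exact hf (by rw [map_sub, sub_eq_zero]; exact h f)
  refine Module.Projective.of_split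
    { toFun := s
      map_add' := fun χ ψ => huniq _ _ fun f => ?_
      map_smul' := fun α χ => huniq _ _ fun f => ?_ } π
    (LinearMap.ext fun χ => Dual.ext_apply fun k => ?_)
  · rw [map_add, ← hs, ← hs, ← hs]
    rfl
  · rw [← hs, Dual.smul_apply, ← map_smul, hs]
    rfl
  · exact (hs χ (i.hom k)).symm.trans (congrArg χ (hr' k))

/-- Injective objects are covered by one-parameter subgroups. -/
theorem exists_oneParameter [Module.Free ℤ R] [Module.Finite ℤ R] {G : LCAMod.{u} R}
    (hG : IsExactInjective G) (g : G) : ∃ γ : ℝ →ₜ+ G, γ 1 = g := by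
  classical
  let b := Module.Free.chooseBasis ℤ R
  -- The extension of the right regular module to `ℝ` is realised as `Hom(Hom(R, ℤ), ℝ)`. Each Hom
  -- exchanges left and right modules, so two are needed, and this one is taken over the opposite
  -- ring.
  let _ : Module R (HomSpace R ℤ) :=
    Module.compHom (R := Rᵐᵒᵖᵐᵒᵖ) (HomSpace R ℤ) (RingEquiv.opOp R).toRingHom
  let φ := HomSpace.homeomorphOfBasis (B := ℤ) b
  let e : Module.Basis (Module.Free.ChooseBasisIndex ℤ R) ℤ (HomSpace R ℤ) :=
    Module.Basis.ofEquivFun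
      (AddEquiv.toIntLinearEquiv { φ.toEquiv with map_add' := fun _ _ => rfl })
  have he : ∀ i x, e i x = b.repr x i := fun i x => by
    have h1 : φ (e i) = Pi.single i 1 := funext fun k => by
      have := e.equivFun_self i k
      rw [Module.Basis.equivFun_ofEquivFun] at this
      refine Eq.trans this ?_
      rw [Pi.single_apply]
      simp only [eq_comm]
    have h2 : e i = φ.symm (Pi.single i 1) := by rw [← h1, φ.symm_apply_apply]
    rw [h2]
    change ∑ j, b.repr x j • (Pi.single i 1 : _ → ℤ) j = _
    rw [Finset.sum_eq_single i] <;> simp +contextual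
  let V := realHom R (HomSpace R ℤ) e
  let j₀ : R →ₗ[Rᵐᵒᵖ] V :=
    { toFun := fun x => (AddMonoidHom.mk' (fun f : HomSpace R ℤ => (f x : ℝ)) fun f f' => by
        rw [HomSpace.add_apply, Int.cast_add] : HomSpace R ℤ →+ ℝ)
      map_add' := fun x y => DFunLike.ext (F := HomSpace (HomSpace R ℤ) ℝ) _ _ fun f => by
        change ((f (x + y) : ℤ) : ℝ) = f x + f y
        rw [map_add, Int.cast_add]
      map_smul' := fun a x => rfl }
  let j : discrete R R ⟶ V := ofDiscrete j₀
  have hj : IsClosedEmbedding j.hom := by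
    have h1 : IsClosedEmbedding (Pi.map fun (_ : Module.Free.ChooseBasisIndex ℤ R) (z : ℤ) => (z : ℝ)) :=
      .piMap fun _ => Int.isClosedEmbedding_coe_real
    let b' : discrete R R ≃ₜ (Module.Free.ChooseBasisIndex ℤ R → ℤ) :=
      { toFun := fun x => b.equivFun x
        invFun := fun x => b.equivFun.symm x
        left_inv := b.equivFun.symm_apply_apply
        right_inv := b.equivFun.apply_symm_apply
        continuous_toFun := continuous_of_discreteTopology (α := discrete R R)
        continuous_invFun := continuous_of_discreteTopology }
    have h2 := (HomSpace.homeomorphOfBasis (B := ℝ) e).isClosedEmbedding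
    refine (IsClosedEmbedding.of_comp_iff (f := fun x : discrete R R =>
      (j.hom x : HomSpace (HomSpace R ℤ) ℝ)) h2).1 ?_
    convert h1.comp b'.isClosedEmbedding using 1
    funext x i
    exact congrArg (fun z : ℤ => (z : ℝ)) (he i x)
  -- The regular module sits in `V` as a closed lattice, so the orbit map of `g` extends to `V`; the
  -- extension restricted to the line through `1` is the one-parameter subgroup.
  obtain ⟨F, hF⟩ := (isExactInjective_iff G).1 hG j hj (ofDiscrete
    { toFun := fun x => MulOpposite.op x • g
      map_add' := fun x y => by rw [MulOpposite.op_add, add_smul]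
      map_smul' := fun a x => by
        change MulOpposite.op (x * a.unop) • g = _
        rw [MulOpposite.op_mul, MulOpposite.op_unop, mul_smul]
        rfl })
  let u : ℝ →+ V :=
    { toFun := fun t => (AddMonoidHom.mk' (fun f : HomSpace R ℤ => t * (f 1 : ℝ)) fun f f' => by
        rw [HomSpace.add_apply, Int.cast_add, mul_add] : HomSpace R ℤ →+ ℝ)
      map_zero' := DFunLike.ext (F := HomSpace (HomSpace R ℤ) ℝ) _ _ fun f => zero_mul _
      map_add' := fun t t' => DFunLike.ext (F := HomSpace (HomSpace R ℤ) ℝ) _ _ fun f =>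
        add_mul _ _ _ }
  have hu : Continuous u := HomSpace.continuous_iff.2 fun f => continuous_id.mul continuous_const
  have hu1 : u 1 = j.hom (1 : R) :=
    DFunLike.ext (F := HomSpace (HomSpace R ℤ) ℝ) _ _ fun f => one_mul _
  refine ⟨⟨(F.hom : V →+ G).comp u, F.hom.continuous.comp hu⟩, ?_⟩
  change F.hom (u 1) = g
  rw [hu1]
  exact (congrArg (fun k : discrete R R ⟶ G => k.hom (1 : R)) hF).trans (one_smul Rᵐᵒᵖ g)

end

end LCAMod

/-! ### Structure of injective objects; discrete projective objects -/

namespace LCAMod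

variable {R : Type u} [Ring R]

lemma connectedSpace_of_isExactInjective [Module.Free ℤ R] [Module.Finite ℤ R] {G : LCAMod.{u} R}
    (hG : IsExactInjective G) : ConnectedSpace G := by
  have : PreconnectedSpace G := ⟨isPreconnected_of_forall 0 fun g _ => by
    obtain ⟨γ, hγ⟩ := exists_oneParameter hG g
    exact ⟨range γ, subset_univ _, ⟨0, map_zero γ⟩, ⟨1, hγ⟩,
      isPreconnected_range (map_continuous γ)⟩⟩
  exact { toNonempty := ⟨0⟩ }

lemma exists_iso_of_isExactProjective_quotient {G : LCAMod.{u} R} (S : Submodule Rᵐᵒᵖ G)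
    (hS : IsClosed (S : Set G)) (h : IsExactProjective (G.quotient S hS)) :
    Nonempty (G ≅ (G.quotient S hS).directSum (G.closedSubmodule S hS)) := by
  have hq : IsOpenQuotientMap (G.quotientMk S hS).hom := S.isOpenQuotientMap_mkQ
  obtain ⟨s, hs⟩ := (isExactProjective_iff _).1 h (G.quotientMk S hS) hq.isOpenMap hq.surjective (𝟙 _)
  have hker : LinearMap.ker (G.quotientMk S hS).hom.toLinearMap = S := S.ker_mkQ
  have := isoDirectSumOfRetract s _ hs
  have key : ∀ (T : Submodule Rᵐᵒᵖ G) (hT : IsClosed (T : Set G)), T = S →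
      (G ≅ (G.quotient S hS).directSum (G.closedSubmodule T hT)) →
      (G ≅ (G.quotient S hS).directSum (G.closedSubmodule S hS)) := by
    rintro T hT rfl
    exact id
  exact ⟨key _ _ hker this⟩

/-- The kernel of a homomorphism to `ℝⁿ` is a submodule if it is compact. -/
lemma smul_mem_ker_of_isCompact {G : LCAMod.{u} R} {n : ℕ} (Φ : G →ₜ+ (Fin n → ℝ))
    (hK : IsCompact {g | Φ g = 0}) (a : Rᵐᵒᵖ) {g : G} (hg : Φ g = 0) : Φ (a • g) = 0 := by
  funext k
  let K : AddSubgroup G := (Φ : G →+ (Fin n → ℝ)).ker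
  let f : K →+ ℝ := ((Pi.evalAddMonoidHom (fun _ : Fin n => ℝ) k).comp (Φ : G →+ (Fin n → ℝ))).comp
    ((DistribSMul.toAddMonoidHom G a).comp K.subtype)
  have hc : Continuous fun x : G => Φ (a • x) k :=
    (continuous_apply k).comp ((map_continuous Φ).comp (continuous_const_smul a))
  obtain ⟨B, hB⟩ := (hK.image hc).isBounded.exists_norm_le
  -- On the compact kernel, the `k`-th coordinate of `x ↦ Φ (a • x)` is a bounded real homomorphism,
  -- hence zero.
  exact AddMonoidHom.eq_zero_of_bounded f (B := B) (fun x => hB _ ⟨x, x.2, rfl⟩) ⟨g, hg⟩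

lemma connectedSpace_directSum_right {V K : LCAMod.{u} R} {G : LCAMod.{u} R} [ConnectedSpace G]
    (e : G ≅ V.directSum K) : ConnectedSpace K := by
  have hs : Function.Surjective (e.hom ≫ snd V K).hom := fun k =>
    ⟨e.inv.hom ((0, k) : V × K), congrArg Prod.snd
      (congrArg (fun f : V.directSum K ⟶ V.directSum K => f.hom ((0, k) : V × K)) e.inv_hom_id)⟩
  exact hs.connectedSpace (e.hom ≫ snd V K).hom.continuous

/-- Injective objects are sums of vector modules and compact connected modules with projective
dual. -/
theorem exists_iso_of_isExactInjective [Module.Free ℤ R] [Module.Finite ℤ R] (hR : HasCasimir R)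
    {G : LCAMod.{u} R} (hG : IsExactInjective G) :
    ∃ V I : LCAMod.{u} R, V.IsVectorModule ∧ CompactSpace I ∧ ConnectedSpace I ∧
      Module.Projective R I.Dual ∧ Nonempty (G ≅ V.directSum I) := by
  have := connectedSpace_of_isExactInjective hG
  obtain ⟨n, v, Φ, -, -, hΦv, hΦ⟩ := (hasCocompactLattice_of_connectedSpace (G := G)).exists_proper
  choose γ hγ using fun i => exists_oneParameter hG (v i)
  have hK : IsCompact {g | Φ g = 0} := hΦ.isCompact_preimage isCompact_singleton
  let S : Submodule Rᵐᵒᵖ G :=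
    { (Φ : G →+ (Fin n → ℝ)).ker with
      smul_mem' := fun a g hg => smul_mem_ker_of_isCompact Φ hK a hg }
  have hS : IsClosed (S : Set G) := hK.isClosed
  -- A continuous homomorphism from `ℝ` to `ℝⁿ` is real linear, so its value at `1` determines it.
  -- Thus `σ` is a continuous section of `Φ`, and the quotient by `S` is `ℝⁿ`.
  have hΦγ : ∀ i t, Φ (γ i t) = Pi.single i t := fun i t => by
    have := map_real_smul ((Φ : G →+ (Fin n → ℝ)).comp (γ i : ℝ →+ G))
      ((map_continuous Φ).comp (map_continuous (γ i))) t 1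
    rw [smul_eq_mul, mul_one] at this
    refine this.trans ?_
    change t • Φ (γ i 1) = _
    rw [hγ, hΦv, ← Pi.single_smul, smul_eq_mul, mul_one]
  let σ : (Fin n → ℝ) → G := fun x => ∑ i, γ i (x i)
  have hσ : Continuous σ := continuous_finsetSum _ fun i _ =>
    (map_continuous (γ i)).comp (continuous_apply i)
  have hΦσ : ∀ x, Φ (σ x) = x := fun x => by
    simp only [σ, map_sum, hΦγ, Finset.univ_sum_single]
  let Φ' : (G ⧸ S) →+ (Fin n → ℝ) := QuotientAddGroup.lift S.toAddSubgroup (Φ : G →+ (Fin n → ℝ))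
    fun g hg => hg
  have hV : (G.quotient S hS).IsVectorModule := ⟨n, ⟨
    { toFun := Φ'
      invFun := fun x => Submodule.Quotient.mk (σ x)
      left_inv := fun q => by
        obtain ⟨g, rfl⟩ := S.mkQ_surjective q
        refine (Submodule.Quotient.eq S).2 ?_
        change Φ (σ (Φ g) - g) = 0
        rw [map_sub, hΦσ, sub_self]
      right_inv := hΦσ
      map_add' := map_add Φ'
      continuous_toFun := S.isOpenQuotientMap_mkQ.continuous_comp_iff.1 (map_continuous Φ)
      continuous_invFun := S.isOpenQuotientMap_mkQ.continuous.comp hσ }⟩⟩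
  obtain ⟨e⟩ := exists_iso_of_isExactProjective_quotient S hS (hV.isExactProjective hR)
  have : CompactSpace (G.closedSubmodule S hS) := isCompact_iff_compactSpace.1 hK
  have hI : IsExactInjective (G.closedSubmodule S hS) := hG.of_retract (inr _ _ ≫ e.inv)
    (e.hom ≫ snd _ _) (by
      rw [Category.assoc, ← Category.assoc e.inv, e.inv_hom_id, Category.id_comp]
      rfl)
  exact ⟨_, _, hV, this, connectedSpace_directSum_right e,
    projective_dual_of_isExactInjective _ hI, ⟨e⟩⟩

theorem isExactInjective_of_iso (hR : HasCasimir R) {G V I : LCAMod.{u} R} (hV : V.IsVectorModule)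
    [CompactSpace I] [Module.Projective R I.Dual] (e : G ≅ V.directSum I) : IsExactInjective G :=
  (isExactInjective_directSum (hV.isExactInjective hR)
    (isExactInjective_of_projective_dual I)).of_retract e.hom e.inv e.hom_inv_id

/-- Discrete projective modules are projective. -/
theorem isExactProjective_of_discrete (P : LCAMod.{u} R) [DiscreteTopology P]
    [Module.Projective Rᵐᵒᵖ P] : IsExactProjective P := by
  rw [isExactProjective_iff]
  intro Y Z p hpo hps f
  obtain ⟨g, hg⟩ := Module.projective_lifting_property p.hom.toLinearMap f.hom.toLinearMap hps
  exact ⟨⟨⟨g, continuous_of_discreteTopology⟩⟩, hom_ext_apply fun x => LinearMap.congr_fun hg x⟩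

theorem isExactProjective_of_iso (hR : HasCasimir R) {G V P : LCAMod.{u} R} (hV : V.IsVectorModule)
    [DiscreteTopology P] [Module.Projective Rᵐᵒᵖ P] (e : G ≅ V.directSum P) :
    IsExactProjective G :=
  (isExactProjective_directSum (hV.isExactProjective hR)
    (isExactProjective_of_discrete P)).of_retract e.hom e.inv e.hom_inv_id

/-- Discrete projective objects are projective modules. -/
theorem projective_of_isExactProjective (P : LCAMod.{u} R) [DiscreteTopology P]
    (hP : IsExactProjective P) : Module.Projective Rᵐᵒᵖ P := by
  refine Module.Projective.of_lifting_property'' fun f hf => ?_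
  obtain ⟨g, hg⟩ := (isExactProjective_iff P).1 hP (ofDiscrete f) (fun U _ => isOpen_discrete _)
    hf (𝟙 P)
  exact ⟨g.hom.toLinearMap, LinearMap.ext fun x => congrArg (fun k : P ⟶ P => k.hom x) hg⟩

end LCAMod

/-! ### Structure of projective objects -/

/-- A closed subgroup of `ℝⁿ` contains a linear subspace as an open subgroup. -/
theorem exists_submodule_isOpen_of_isClosed {ι : Type} [Fintype ι] (L : AddSubgroup (ι → ℝ))
    (hL : IsClosed (L : Set (ι → ℝ))) : ∃ W : Submodule ℝ (ι → ℝ), (∀ w ∈ W, w ∈ L) ∧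
      ∃ U : Set (ι → ℝ), IsOpen U ∧ ∀ y ∈ L, y ∈ W ↔ y ∈ U := by
  -- The set `M` is the annihilator of `L` under the integral pairing. Its real orthogonal
  -- complement `W` lies in `L` by duality, and is cut out by a finite spanning subset of `M`.
  let M : Set (ι → ℝ) := {a | ∀ y ∈ L, ∃ m : ℤ, a ⬝ᵥ y = m}
  obtain ⟨s, hsM, hs⟩ := Submodule.fg_span_iff_fg_span_finset_subset M |>.1
    (IsNoetherian.noetherian (Submodule.span ℝ M))
  let W : Submodule ℝ (ι → ℝ) :=
    { carrier := {w | ∀ a ∈ s, a ⬝ᵥ w = 0}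
      zero_mem' := fun a _ => dotProduct_zero a
      add_mem' := fun {v w} hv hw a ha => by rw [dotProduct_add, hv a ha, hw a ha, add_zero]
      smul_mem' := fun c w hw a ha => by rw [dotProduct_smul, hw a ha, smul_zero] }
  have hWM : ∀ w ∈ W, ∀ a ∈ M, a ⬝ᵥ w = 0 := by
    intro w hw a ha
    have h1 : a ∈ Submodule.span ℝ (s : Set (ι → ℝ)) := hs ▸ Submodule.subset_span ha
    clear ha
    induction h1 using Submodule.span_induction with
    | mem x hx => exact hw x hx
    | zero => exact zero_dotProduct w
    | add x y _ _ hx hy => rw [add_dotProduct, hx, hy, add_zero]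
    | smul c x _ hx => rw [smul_dotProduct, hx, smul_zero]
  refine ⟨W, fun w hw => ?_, {y | ∀ a ∈ s, |a ⬝ᵥ y| < 1}, ?_, fun y hy => ?_⟩
  · by_contra hwL
    obtain ⟨χ, hχ, hχw⟩ := exists_character_of_notMem L hL hwL
    obtain ⟨a, ha⟩ := exists_eq_coe_sum_of_character χ
    have haM : a ∈ M := fun y hy => by
      have h1 := (ha y).symm.trans (hχ y hy)
      rw [AddCircle.coe_eq_zero_iff] at h1
      obtain ⟨m, hm⟩ := h1
      exact ⟨m, hm.symm.trans (by simp)⟩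
    refine hχw ((ha w).trans ?_)
    rw [show ∑ i, a i * w i = 0 from hWM w hw a haM]
    rfl
  · rw [ofPred_forall]
    simp only [ofPred_forall]
    refine isOpen_biInter_finset fun a _ => ?_
    exact isOpen_lt (by unfold dotProduct; fun_prop) continuous_const
  · refine ⟨fun h a ha => ?_, fun h a ha => ?_⟩
    · rw [h a ha, abs_zero]
      exact one_pos
    -- On `L` the pairings with `s` are integers, so those smaller than `1` vanish.
    · obtain ⟨m, hm⟩ := hsM ha y hy
      have h1 := h a ha
      rw [hm, ← Int.cast_abs, ← Int.cast_one, Int.cast_lt, Int.abs_lt_one_iff] at h1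
      rw [hm, h1, Int.cast_zero]

/-- A locally compact group on which real characters separate points has an open subgroup
isomorphic to `ℝᵐ`. -/
theorem exists_isOpen_addEquiv_real {G : Type u} [AddCommGroup G] [TopologicalSpace G]
    [IsTopologicalAddGroup G] [LocallyCompactSpace G] [T2Space G]
    (hG : ∀ g : G, g ≠ 0 → ∃ f : G →ₜ+ ℝ, f g ≠ 0) :
    ∃ (S : AddSubgroup G) (m : ℕ), IsOpen (S : Set G) ∧ Nonempty (S ≃ₜ+ (Fin m → ℝ)) := by
  obtain ⟨G', hG'o, hG'⟩ := exists_isOpen_hasCocompactLattice G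
  have : LocallyCompactSpace G' :=
    (AddSubgroup.isClosed_of_isOpen _ hG'o).isClosedEmbedding_subtypeVal.locallyCompactSpace
  obtain ⟨n, v, Φ, -, -, -, hΦ⟩ := hG'.exists_proper
  have hK : IsCompact {g | Φ g = 0} := hΦ.isCompact_preimage isCompact_singleton
  -- Real characters are bounded on the compact kernel of `Φ`, hence zero there; since they separate
  -- points, the kernel is trivial.
  have hinj : Function.Injective Φ := (injective_iff_map_eq_zero Φ).2 fun g hg => by
    by_contra hne
    obtain ⟨f, hf⟩ := hG g fun h => hne (Subtype.ext h)
    obtain ⟨B, hB⟩ := (hK.image ((map_continuous f).comp continuous_subtype_val)).isBounded.exists_norm_le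
    exact hf (AddMonoidHom.eq_zero_of_bounded ((f : G →+ ℝ).comp
      (G'.subtype.comp (Φ : G' →+ (Fin n → ℝ)).ker.subtype)) (B := B)
        (fun x => hB _ ⟨x, x.2, rfl⟩) ⟨g, hg⟩)
  have hΦe : IsClosedEmbedding Φ :=
    .of_continuous_injective_isClosedMap (map_continuous Φ) hinj hΦ.isClosedMap
  obtain ⟨W, hWL, U, hU, hWU⟩ := exists_submodule_isOpen_of_isClosed
    (Φ : G' →+ (Fin n → ℝ)).range (by
      rw [AddMonoidHom.coe_range]; exact hΦe.isClosed_range)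
  let S' : AddSubgroup G' := W.toAddSubgroup.comap (Φ : G' →+ (Fin n → ℝ))
  have hS'o : IsOpen (S' : Set G') := by
    convert hU.preimage (map_continuous Φ) using 1
    ext g
    exact hWU _ ⟨g, rfl⟩
  choose ψ hψ using fun w : W => hWL w w.2
  replace hψ : ∀ w : W, Φ (ψ w) = w := hψ
  have hψc : Continuous ψ := hΦe.isInducing.continuous_iff.2
    (continuous_subtype_val.congr fun w => (hψ w).symm)
  have hψW : ∀ w, ψ w ∈ S' := fun w => by
    change Φ (ψ w) ∈ W
    rw [hψ]
    exact w.2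
  let b := (Module.finBasis ℝ W).equivFunL
  let e : S' ≃ₜ+ W :=
    { toFun := fun g => ⟨Φ g, g.2⟩
      invFun := fun w => ⟨ψ w, hψW w⟩
      left_inv := fun g => Subtype.ext (hinj (hψ _))
      right_inv := fun w => Subtype.ext (hψ w)
      map_add' := fun g h => Subtype.ext (map_add Φ _ _)
      continuous_toFun := ((map_continuous Φ).comp continuous_subtype_val).subtype_mk _
      continuous_invFun := hψc.subtype_mk hψW }
  let e' : (S'.map G'.subtype) ≃ₜ+ S' :=
    { (S'.equivMapOfInjective G'.subtype G'.subtype_injective).symm with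
      continuous_toFun := by
        rw [continuous_induced_rng, continuous_induced_rng]
        refine continuous_subtype_val.congr fun x => ?_
        obtain ⟨y, rfl⟩ := (S'.equivMapOfInjective G'.subtype G'.subtype_injective).surjective x
        simp
      continuous_invFun :=
        (continuous_subtype_val.comp continuous_subtype_val).subtype_mk _ }
  refine ⟨S'.map G'.subtype, _, ?_, ⟨(e'.trans e).trans
    { b.toLinearEquiv.toAddEquiv with
      continuous_toFun := b.continuous
      continuous_invFun := b.symm.continuous }⟩⟩
  rw [AddSubgroup.coe_map]
  exact hG'o.isOpenEmbedding_subtypeVal.isOpenMap _ hS'o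

namespace LCAMod

variable {R : Type u} [Ring R]

/-- Real characters separate the points of projective objects. -/
theorem exists_real_character_ne_zero [Module.Free ℤ R] [Module.Finite ℤ R] {G : LCAMod.{u} R}
    (hG : IsExactProjective G) {g : G} (hg : g ≠ 0) : ∃ f : G →ₜ+ ℝ, f g ≠ 0 := by
  let e := Module.Free.chooseBasis ℤ R
  let c : ℝ →+ UnitAddCircle := QuotientAddGroup.mk' _
  have hc : IsOpenQuotientMap c :=
    ⟨QuotientAddGroup.mk'_surjective _, AddCircle.continuous_mk' 1, QuotientAddGroup.isOpenMap_coe⟩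
  let p₀ : realHom R R e → circleHom R R := fun f =>
    (c.comp (f : R →+ ℝ) : R →+ UnitAddCircle)
  let p : realHom R R e ⟶ circleHom R R := ⟨
    { toFun := p₀
      map_add' := fun f f' => DFunLike.ext (F := HomSpace R UnitAddCircle) _ _ fun x =>
        map_add c (f x) (f' x)
      map_smul' := fun a f => rfl
      cont := HomSpace.continuous_iff.2 fun x =>
        hc.continuous.comp (HomSpace.continuous_apply x) }⟩
  have hp : IsOpenQuotientMap p.hom := by
    have h1 : IsOpenQuotientMap (Pi.map fun (_ : Module.Free.ChooseBasisIndex ℤ R) => c) :=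
      .piMap fun _ => hc
    have h2 : p₀ = (HomSpace.homeomorphOfBasis e).symm ∘
        (Pi.map fun (_ : Module.Free.ChooseBasisIndex ℤ R) => c) ∘
          (HomSpace.homeomorphOfBasis e) := by
      funext f
      exact ((HomSpace.homeomorphOfBasis e).symm_apply_apply (p₀ f)).symm
    change IsOpenQuotientMap p₀
    rw [h2]
    exact (HomSpace.homeomorphOfBasis e).symm.isOpenQuotientMap.comp
      (h1.comp (HomSpace.homeomorphOfBasis e).isOpenQuotientMap)
  obtain ⟨χ, hχ⟩ := exists_character_ne_zero hg
  -- The character `χ` induces a morphism to `Hom(R, ℝ/ℤ)`. It lifts to `Hom(R, ℝ)` by projectivity,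
  -- and evaluating the lift at `1` gives a real homomorphism reducing to `χ` modulo `1`.
  obtain ⟨F, hF⟩ := (isExactProjective_iff G).1 hG p hp.isOpenMap hp.surjective
    (toCircleHom (LinearMap.toSpanSingleton R G.Dual χ))
  refine ⟨⟨AddMonoidHom.mk' (fun x => F.hom x (1 : R)) fun x y => by
    rw [map_add F.hom]; rfl, (HomSpace.continuous_apply (1 : R)).comp F.hom.continuous⟩,
    fun h0 => hχ ?_⟩
  have h1 : c (F.hom g (1 : R)) = ((1 : R) • (show G.Dual from χ)) g :=
    DFunLike.congr_fun (F := circleHom R R)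
      (congrArg (fun k : G ⟶ circleHom R R => k.hom g) hF) (1 : R)
  rw [one_smul] at h1
  refine h1.symm.trans ?_
  rw [show F.hom g (1 : R) = 0 from h0, map_zero]

/-- The image of the connected group `S` under multiplication by `a` is connected and contains `0`,
so it stays inside the clopen set `S`. -/
lemma smul_mem_of_addEquiv_real {G : LCAMod.{u} R} {S : AddSubgroup G} {m : ℕ}
    (hS : IsOpen (S : Set G)) (e : S ≃ₜ+ (Fin m → ℝ)) (a : Rᵐᵒᵖ) {g : G} (hg : g ∈ S) :
    a • g ∈ S := by
  have h1 : IsPreconnected (range fun x : Fin m → ℝ => a • (e.symm x : G)) :=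
    isPreconnected_range ((continuous_subtype_val.comp e.symm.continuous).const_smul a)
  refine h1.subset_isClopen ⟨AddSubgroup.isClosed_of_isOpen _ hS, hS⟩
    ⟨0, ⟨0, ?_⟩, S.zero_mem⟩ ⟨e ⟨g, hg⟩, ?_⟩
  · change a • ((e.symm 0 : S) : G) = 0
    rw [map_zero, S.coe_zero, smul_zero]
  · change a • ((e.symm (e ⟨g, hg⟩) : S) : G) = a • g
    rw [e.symm_apply_apply]

/-- Projective objects are sums of vector modules and discrete projective modules. -/
theorem exists_iso_of_isExactProjective [Module.Free ℤ R] [Module.Finite ℤ R] (hR : HasCasimir R)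
    {G : LCAMod.{u} R} (hG : IsExactProjective G) :
    ∃ V P : LCAMod.{u} R, V.IsVectorModule ∧ DiscreteTopology P ∧ Module.Projective Rᵐᵒᵖ P ∧
      Nonempty (G ≅ V.directSum P) := by
  obtain ⟨S₀, m, hS₀, ⟨e⟩⟩ := exists_isOpen_addEquiv_real fun g : G =>
    exists_real_character_ne_zero hG
  let S : Submodule Rᵐᵒᵖ G :=
    { S₀ with smul_mem' := fun a g hg => smul_mem_of_addEquiv_real hS₀ e a hg }
  have hS : IsClosed (S : Set G) := AddSubgroup.isClosed_of_isOpen _ hS₀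
  have hV : (G.closedSubmodule S hS).IsVectorModule := ⟨m, ⟨e⟩⟩
  obtain ⟨r, hr⟩ := (isExactInjective_iff _).1 (hV.isExactInjective hR) (G.closedSubmoduleι S hS)
    hS.isClosedEmbedding_subtypeVal (𝟙 _)
  let f := isoDirectSumOfRetract _ r hr
  -- The complement meets the open submodule `S` only in `0`, because `r` is the identity on `S` and
  -- zero on the complement.
  have hd : DiscreteTopology (G.closedSubmodule _ (isClosed_ker r)) := by
    refine discreteTopology_of_isOpen_singleton_zero ?_
    convert hS₀.preimage (G.closedSubmoduleι _ (isClosed_ker r)).hom.continuous using 1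
    ext x
    refine ⟨fun hx => ?_, fun hx => Subtype.ext ?_⟩
    · rw [mem_singleton_iff.1 hx]
      exact S.zero_mem
    · have h1 : r.hom x.1 = (⟨x.1, hx⟩ : S) :=
        congrArg (fun k : G.closedSubmodule S hS ⟶ _ => k.hom (⟨x.1, hx⟩ : S)) hr
      exact congrArg (fun y : S => (y : G)) (h1.symm.trans x.2)
  have hP : IsExactProjective (G.closedSubmodule _ (isClosed_ker r)) :=
    hG.of_retract (inr _ _ ≫ f.inv) (f.hom ≫ snd _ _) (by
      rw [Category.assoc, ← Category.assoc f.inv, f.inv_hom_id, Category.id_comp]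
      rfl)
  exact ⟨_, _, hV, hd, projective_of_isExactProjective _ hP, ⟨f⟩⟩

end LCAMod

theorem mainTheorem11 {A : Type u} [Ring A] [Algebra ℚ A] [FiniteDimensional ℚ A]
    [IsSemisimpleRing A] (𝔄 : Subring A) (h𝔄 : IsOrder 𝔄) :
    (∀ G : LCAMod.{u} 𝔄, IsExactInjective G ↔
      ∃ V I : LCAMod.{u} 𝔄, V.IsVectorModule ∧
        CompactSpace I ∧ ConnectedSpace I ∧ Module.Projective 𝔄 I.Dual ∧
        Nonempty (G ≅ V.directSum I)) ∧
    (∀ G : LCAMod.{u} 𝔄, IsExactProjective G ↔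
      ∃ V P : LCAMod.{u} 𝔄, V.IsVectorModule ∧
        DiscreteTopology P ∧ Module.Projective 𝔄ᵐᵒᵖ P ∧
        Nonempty (G ≅ V.directSum P)) := by
  have hR : HasCasimir 𝔄 := h𝔄.exists_casimir
  have := h𝔄.finite
  have := h𝔄.free
  refine ⟨fun G => ⟨LCAMod.exists_iso_of_isExactInjective hR, ?_⟩,
    fun G => ⟨LCAMod.exists_iso_of_isExactProjective hR, ?_⟩⟩
  · rintro ⟨V, I, hV, _, -, _, ⟨e⟩⟩
    exact LCAMod.isExactInjective_of_iso hR hV e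
  · rintro ⟨V, P, hV, _, _, ⟨e⟩⟩
    exact LCAMod.isExactProjective_of_iso hR hV e
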